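/- **The block.** For external dimensions $h_1,\dots,h_4$, intermediate dimension $\tilde h$ and central charge $c$, let $\mathcal F(h_i,\tilde h,c|z)=\sum_{n\ge 0}F_n z^n$ be the bare four-point Virasoro block, a formal power series in $z$ with $$F_n=\sum_{|Y|=|Y'|=n}\Gamma(h_2,h_1;Y)\,\big(Q^{-1}\big)_{Y,Y'}\,\Gamma(h_3,h_4;Y').$$ Here $Y=(\lambda_1\ge\dots\ge\lambda_r)$ and $Y'$ run over the partitions of $n$, $Q$ is the Gram matrix of the vectors $L_{-\lambda_1}\cdots L_{-\lambda_r}|\tilde h\rangle$ in the Verma module of highest weight $\tilde h$ and central charge $c$, and $\Gamma(a,b;Y)=\prod_i\big(\tilde h+\lambda_i a-b+\sum_{j>i}\lambda_j\big)$. Each $F_n$ is a rational function of $(h_i,\tilde h,c)$, and so is each coefficient $g_n$ of $\log\mathcal F=\sum_{n\ge1}g_nz^n$. **Classical coefficients.** For $\alpha\in\mathbb Q$ and classical dimensions $\delta=(\delta_1,\dots,\delta_4)\in\mathbb C^4$, $\tilde\delta\in\mathbb C\setminus\{0\}$, put $h_i=\delta_i c^\alpha$, $\tilde h=\tilde\delta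 c^\alpha$ and expand every $g_n$ in a Puiseux series at $c=\infty$. Let $f^{(\alpha)}_r(\delta,\tilde\delta|z)\in\mathbb C[[z]]$ be the coefficient of $c^r$ in $\log\mathcal F$. The Zamolodchikov classical block is $f^{(1)}_1$. **Conventions.** A function $P(\delta,\tilde\delta|z)$ is homogeneous of degree $d$ if $P(t\delta,t\tilde\delta|z)=t^dP(\delta,\tilde\delta|z)$ for all $t\in\mathbb C\setminus\{0\}$ and $\tilde\delta\ne0$. An identity $f=\sum_iQ_i$ holds *around zero* (resp. *around infinity*) if for every $n$ and every $(\delta,\tilde\delta)$ with $\tilde\delta\neq0$ the series of the coefficients of $z^n$ in $Q_i(t\delta,t\tilde\delta|z)$ converges to the coefficient of $z^n$ in $f(t\delta,t\tilde\delta|z)$ for all $t\in\mathbb C\setminus\{0\}$ with $|t|$ small enough (resp. large enough). **Proposition.** In the following all identities between functions are for all $\delta\in\mathbb C^4$ and $\tilde\delta\ne0$. 1. There are $P_m$ ($m\in\mathbb Z$), homogeneous of degree $m$, with $f^{(1)}_1=\sum_mP_m$ around zero. For every such family, $P_m=0$ for $m\le0$, and for every integer $m\ge1$ and every rational $\alpha\in\left(\frac{m-1}{m},1\right)$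 $$P_m(\delta,\tilde\delta|z)=f^{(\alpha)}_{m\alpha-m+1}(\delta,\tilde\delta|z).$$ Hence, for any choice of rational $\alpha_m\in\left(\frac{m-1}{m},1\right)$, $m\ge 1$, $\;f^{(1)}_1=\sum_{m=1}^\infty f^{(\alpha_m)}_{m\alpha_m-m+1}$ around zero. 2. There are $S_k$ ($k\in\mathbb Z$), homogeneous of degree $-k$, with $f^{(1)}_1=\sum_kS_k$ around infinity. For every such family, $S_k=0$ for $k<-1$, and for every integer $k\ge-1$ and every rational $\alpha$ with $\alpha\in(1,\infty)$ if $k\in\{-1,0\}$ and $\alpha\in\left(1,\frac{k+1}{k}\right)$ if $k\ge1$ $$S_k(\delta,\tilde\delta|z)=f^{(\alpha)}_{-k\alpha+k+1}(\delta,\tilde\delta|z).$$ Hence, for any choice of rational $\alpha_k$ in these ranges, $\;f^{(1)}_1=\sum_{k=-1}^\infty f^{(\alpha_k)}_{-k\alpha_k+k+1}$ around infinity. -/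

import Mathlib

open Filter Topology

noncomputable section

namespace ClassicalBlock

/-! ### The Virasoro conformal block

A list `[l₁, …, l_r]` of positive integers stands for the descendant
`L_{-l₁} ⋯ L_{-l_r} |ht⟩` of the highest weight vector `|ht⟩` (so `L_k |ht⟩ = 0` for `k > 0` and
`L_0 |ht⟩ = ht |ht⟩`) of the Virasoro algebra
`[L_m, L_n] = (m - n) L_{m+n} + (c / 12) (m ^ 3 - m) δ_{m+n,0}`.
All parameters lie in an arbitrary field `K`; the block coefficients are rational functions of
them. -/

section Block

variable {K : Type*} [Field K]

/-- `lower ht c k w` is `L_k` (`k ≥ 0`) applied to the descendant `w`, computed by commuting `L_k`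
to the right:
`L_k L_{-l} = L_{-l} L_k + (k + l) L_{k-l} + (c / 12) (k ^ 3 - k) δ_{k,l}`. -/
def lower (ht c : K) : ℕ → List ℕ → (List ℕ →₀ K)
  | k, [] => if k = 0 then Finsupp.single [] ht else 0
  | k, l :: w =>
      (lower ht c k w).mapDomain (List.cons l) +
        if k < l then Finsupp.single ((l - k) :: w) ((k : K) + l)
        else ((k : K) + l) • lower ht c (k - l) w +
          if k = l then Finsupp.single w (c / 12 * ((k : K) ^ 3 - k)) else 0

/-- `lower` extended linearly to combinations of descendants. -/
def lowerLin (ht c : K) (k : ℕ) : (List ℕ →₀ K) →ₗ[K] (List ℕ →₀ K) :=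
  Finsupp.linearCombination K (lower ht c k)

/-- The (Shapovalov) pairing of the descendants `y` and `w`:
`⟨ht| L_{y_r} ⋯ L_{y₁} L_{-w₁} ⋯ L_{-w_s} |ht⟩`, normalized by `⟨ht|ht⟩ = 1`. -/
def pairing (ht c : K) (y w : List ℕ) : K :=
  (y.foldl (fun v k => lowerLin ht c k v) (Finsupp.single w 1)) []

/-- The basis descendant `L_{-λ₁} ⋯ L_{-λ_r} |ht⟩`, `λ₁ ≥ ⋯ ≥ λ_r`, given by a partition. -/
def word {n : ℕ} (p : n.Partition) : List ℕ := p.parts.sort (· ≥ ·)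

/-- The Gram matrix of the Verma module at level `n`. -/
def gram (ht c : K) (n : ℕ) : Matrix n.Partition n.Partition K :=
  Matrix.of fun p q => pairing ht c (word p) (word q)

/-- The matrix element of a primary field of dimension `a` between a primary state of dimension
`b` and the descendant `[l₁, …, l_r]`, divided by the one with the primary state `|ht⟩` itself:
`⟨b| O_a(1) L_{-l₁} ⋯ L_{-l_r} |ht⟩ = ∏ᵢ (ht + lᵢ a - b + ∑_{j > i} l_j)`. -/
def vertex (a b ht : K) : List ℕ → K
  | [] => 1
  | l :: w => (ht + l * a - b + (w.sum : ℕ)) * vertex a b ht w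

/-- The level-`n` coefficient `F_n` of the four-point Virasoro block with external dimensions
`h 0, h 1, h 2, h 3` (that is, `h₁, h₂, h₃, h₄`), intermediate dimension `ht` and central
charge `c`. -/
def blockCoeff (h : Fin 4 → K) (ht c : K) (n : ℕ) : K :=
  ∑ p : n.Partition, ∑ q : n.Partition,
    vertex (h 1) (h 0) ht (word p) * (gram ht c n)⁻¹ p q * vertex (h 2) (h 3) ht (word q)

/-- The bare Virasoro block `F = ∑ₙ F_n zⁿ`, a formal power series in `z`. -/
def block (h : Fin 4 → K) (ht c : K) : PowerSeries K :=
  PowerSeries.mk (blockCoeff h ht c)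

/-- The logarithmic Virasoro block `f = log F = ∑ₙ g_n zⁿ`. -/
def logBlock [Algebra ℚ K] (h : Fin 4 → K) (ht c : K) : PowerSeries K :=
  PowerSeries.logOf (block h ht c)

end Block

/-! ### Large central charge

Puiseux series at `c = ∞` are Hahn series in `1 / c` with rational exponents:
`HahnSeries.single (-r) a` stands for `a * c ^ r`. -/

/-- The logarithmic block `f^(α)` with `h_i = δ_i c ^ α`, `ht = δt c ^ α`, each of its
coefficients `g_n` being expanded near `c = ∞`. -/
def heavyLogBlock (α : ℚ) (δ : Fin 4 → ℂ) (δt : ℂ) : PowerSeries (HahnSeries ℚ ℂ) :=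
  logBlock (fun i => HahnSeries.single (-α) (δ i)) (HahnSeries.single (-α) δt)
    (HahnSeries.single (-1 : ℚ) (1 : ℂ))

/-- `f^(α)_r (δ, δt | z)`: the coefficient of `c ^ r` in `f^(α)`. -/
def classicalCoeff (α r : ℚ) (δ : Fin 4 → ℂ) (δt : ℂ) : PowerSeries ℂ :=
  PowerSeries.mk fun n => (PowerSeries.coeff n (heavyLogBlock α δ δt)).coeff (-r)

/-- The Zamolodchikov classical block `f^(1)_1`. -/
def zamolodchikovBlock : (Fin 4 → ℂ) → ℂ → PowerSeries ℂ := classicalCoeff 1 1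

/-! ### Expansions for small and for large classical dimensions -/

/-- `P` is homogeneous of degree `d` in the classical dimensions, on the domain `δt ≠ 0`. -/
def IsHomogeneous (d : ℤ) (P : (Fin 4 → ℂ) → ℂ → PowerSeries ℂ) : Prop :=
  ∀ (δ : Fin 4 → ℂ) (δt t : ℂ), δt ≠ 0 → t ≠ 0 →
    P (t • δ) (t * δt) = PowerSeries.C (t ^ d) * P δ δt

/-- `f = ∑ᵢ Q i` around zero classical dimensions: in every order in `z` and along every ray the
series converges to `f` as soon as the common scale `t ≠ 0` of the dimensions is small enough. -/
def SumsNearZero {ι : Type*} (Q : ι → (Fin 4 → ℂ) → ℂ → PowerSeries ℂ)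
    (f : (Fin 4 → ℂ) → ℂ → PowerSeries ℂ) : Prop :=
  ∀ (δ : Fin 4 → ℂ) (δt : ℂ), δt ≠ 0 → ∀ n : ℕ, ∀ᶠ t : ℂ in 𝓝[≠] 0,
    HasSum (fun i => PowerSeries.coeff n (Q i (t • δ) (t * δt)))
      (PowerSeries.coeff n (f (t • δ) (t * δt)))

/-- `f = ∑ᵢ Q i` around infinite classical dimensions: the same, as soon as the common scale `t`
of the dimensions is large enough. -/
def SumsNearInfinity {ι : Type*} (Q : ι → (Fin 4 → ℂ) → ℂ → PowerSeries ℂ)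
    (f : (Fin 4 → ℂ) → ℂ → PowerSeries ℂ) : Prop :=
  ∀ (δ : Fin 4 → ℂ) (δt : ℂ), δt ≠ 0 → ∀ n : ℕ, ∀ᶠ t : ℂ in Bornology.cobounded ℂ,
    HasSum (fun i => PowerSeries.coeff n (Q i (t • δ) (t * δt)))
      (PowerSeries.coeff n (f (t • δ) (t * δt)))

/-- `f = ∑ₘ P m` with `P m` homogeneous of degree `m`, around zero classical dimensions. -/
structure IsSmallExpansion (P : ℤ → (Fin 4 → ℂ) → ℂ → PowerSeries ℂ)
    (f : (Fin 4 → ℂ) → ℂ → PowerSeries ℂ) : Prop where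
  homogeneous : ∀ m, IsHomogeneous m (P m)
  sums : SumsNearZero P f

/-- `f = ∑ₖ S k` with `S k` homogeneous of degree `-k`, around infinite classical dimensions. -/
structure IsLargeExpansion (S : ℤ → (Fin 4 → ℂ) → ℂ → PowerSeries ℂ)
    (f : (Fin 4 → ℂ) → ℂ → PowerSeries ℂ) : Prop where
  homogeneous : ∀ k, IsHomogeneous (-k) (S k)
  sums : SumsNearInfinity S f

/-- The admissible exponents for the degree `m ≥ 1`: `α ∈ ((m - 1) / m, 1) ∩ ℚ`. -/
def SmallRange (m : ℕ) (α : ℚ) : Prop := ((m : ℚ) - 1) / m < α ∧ α < 1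

/-- The admissible exponents for the degree `-k`, `k ≥ -1`: `α ∈ (1, ∞) ∩ ℚ` if `k ∈ {-1, 0}`,
and `α ∈ (1, (k + 1) / k) ∩ ℚ` if `k ≥ 1`. -/
def LargeRange (k : ℤ) (α : ℚ) : Prop := 1 < α ∧ (1 ≤ k → α < ((k : ℚ) + 1) / k)

end ClassicalBlock

end

/-! Fix `δ`, `δt ≠ 0` and `n`. Parametrize the dimensions as `δ / y`, `δt / y` and the central
charge as `1 / (x * y)`, so that `1 / y` is the scale of the dimensions and `x` is its ratio to `c`.
The heart of the proof is exponentiation: `y * g_n` is a fraction `N / D` of polynomials in `x, y`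
with `D(0, 0) ≠ 0`. The same holds with `c = x / y`, where `x` is the inverse ratio. This gives both
expansions. The Zamolodchikov block at scale `t` is the limit `y → 0` at constant `x = t`, hence `t
* N(t, 0) / D(t, 0)`, which a Taylor series expands. For `f^(α)` with `α < 1` one has `x = c ^ (α -
1)` and `y = c ^ (-α)`. As long as `x ^ i` dominates `y`, that is `i * (1 - α) < α`, the coefficient
at the order of `x ^ i` is the same Taylor coefficient of `N(x, 0) / D(x, 0)`. With `i = m - 1` this
is the range of `α` in the theorem. For large dimensions `x = c ^ (1 - α)`, `i = k + 1` and the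
condition is `i * (α - 1) < α`. Uniqueness of the homogeneous pieces is uniqueness of Laurent
coefficients along a ray (`eq_zero_of_hasSum_zpow`).

Exponentiation is proved without any explicit form of the inverse Gram matrix. Functionals on
descendants are functions of words, with the shuffle product. The transpose of `L_k` is a derivation
plus multiplication by a function linear in `ht` and `c`. So the pairing is an exponential whose
logarithm is linear in `ht` and `c` (`pairingFun_eq_expo`); the vertex is one too
(`vertexFun_eq_expo`). With `ε = y`, both logarithms are `O(1 / ε)`, after the letters are suitably
weighted.

Contracting two such exponentials over partitions, with a factor `ε` per letter and the symmetry
factor in the denominator, is evaluating a heat flow. As in the Hopf–Cole transformation, `ε ∂ log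
Z` solves a Burgers type equation with no negative power of `ε`, so `log Z` is again `O(1 / ε)`
(`exists_eulerD_partitionSeries`).

The vertex contracted with the inverse Gram matrix is the covector that solves a linear system. Its
logarithm is bounded by induction on the level (`exists_covector_eq_expo`): the part at the top
level enters linearly, through the row-normalized Gram matrix, whose residue is invertible because
it is block triangular in the number of letters (`res_det_ringGram`). A last contraction with the
other vertex gives `eps_mul_logBlock_mem`, and clearing denominators gives
`exists_universal_fraction`, valid at numerical points and in Hahn series alike. -/

set_option linter.unusedSectionVars false

/-! ### The shuffle algebra and its exponential -/

section

/-- Functions on words in the alphabet `ι`, that is, linear functionals on the free algebra;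
the product is the shuffle product. -/
def Shuffle (ι R : Type*) := List ι → R

namespace Shuffle

variable {ι R : Type*}

@[ext] lemma ext {f g : Shuffle ι R} (h : ∀ w, f w = g w) : f = g := funext h

section Ring

variable [CommRing R]

instance : AddCommGroup (Shuffle ι R) := inferInstanceAs (AddCommGroup (List ι → R))

@[simp] lemma eval_add (f g : Shuffle ι R) (w : List ι) : (f + g) w = f w + g w := rfl
@[simp] lemma eval_sub (f g : Shuffle ι R) (w : List ι) : (f - g) w = f w - g w := rfl
@[simp] lemma eval_zero (w : List ι) : (0 : Shuffle ι R) w = 0 := rfl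

/-- The derivative of a function of words with respect to the first letter. -/
def shift (l : ι) (f : Shuffle ι R) : Shuffle ι R := fun w => f (l :: w)

@[simp] lemma shift_apply (l : ι) (f : Shuffle ι R) (w : List ι) : shift l f w = f (l :: w) := rfl

/-- The shuffle product. -/
def mulAux : List ι → Shuffle ι R → Shuffle ι R → R
  | [], f, g => f [] * g []
  | l :: w, f, g => mulAux w (shift l f) g + mulAux w f (shift l g)

instance : Mul (Shuffle ι R) := ⟨fun f g w => mulAux w f g⟩

open Classical in
instance : One (Shuffle ι R) := ⟨fun w => if w = [] then 1 else 0⟩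

@[simp] lemma mul_nil (f g : Shuffle ι R) : (f * g) [] = f [] * g [] := rfl
@[simp] lemma one_nil : (1 : Shuffle ι R) [] = 1 := if_pos rfl
@[simp] lemma one_cons (l : ι) (w : List ι) : (1 : Shuffle ι R) (l :: w) = 0 :=
  if_neg (List.cons_ne_nil _ _)

lemma mul_cons (f g : Shuffle ι R) (l : ι) (w : List ι) :
    (f * g) (l :: w) = (shift l f * g) w + (f * shift l g) w := rfl

lemma shift_mul (l : ι) (f g : Shuffle ι R) :
    shift l (f * g) = shift l f * g + f * shift l g := rfl

@[simp] lemma shift_add (l : ι) (f g : Shuffle ι R) :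
    shift l (f + g) = shift l f + shift l g := rfl
@[simp] lemma shift_sub (l : ι) (f g : Shuffle ι R) :
    shift l (f - g) = shift l f - shift l g := rfl
@[simp] lemma shift_zero (l : ι) : shift l (0 : Shuffle ι R) = 0 := rfl
@[simp] lemma shift_one (l : ι) : shift l (1 : Shuffle ι R) = 0 := by ext w; simp

/-- The recursion makes every `shift l` a derivation of the product. So ring identities hold by
induction on the word: both sides agree at `[]` and have derivatives of the same form. -/
lemma mul_comm_aux (w : List ι) (f g : Shuffle ι R) : (f * g) w = (g * f) w := by
  induction w generalizing f g with
  | nil => simp [mul_comm]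
  | cons l w ih => rw [mul_cons, mul_cons, ih, ih f, add_comm]

lemma add_mul_aux (w : List ι) (f g h : Shuffle ι R) :
    ((f + g) * h) w = (f * h) w + (g * h) w := by
  induction w generalizing f g h with
  | nil => simp [add_mul]
  | cons l w ih => simp only [mul_cons, shift_add, ih]; abel

lemma zero_mul_aux (w : List ι) (f : Shuffle ι R) : (0 * f) w = 0 := by
  induction w generalizing f with
  | nil => simp
  | cons l w ih => simp [mul_cons, ih]

lemma one_mul_aux (w : List ι) (f : Shuffle ι R) : (1 * f) w = f w := by
  induction w generalizing f with
  | nil => simp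
  | cons l w ih => simp [mul_cons, ih, zero_mul_aux]

lemma mul_assoc_aux (w : List ι) (f g h : Shuffle ι R) : (f * g * h) w = (f * (g * h)) w := by
  induction w generalizing f g h with
  | nil => simp [mul_assoc]
  | cons l w ih =>
    have h1 : ((f * (shift l g * h + g * shift l h)) w : R)
        = (f * (shift l g * h)) w + (f * (g * shift l h)) w := by
      rw [mul_comm_aux, add_mul_aux, mul_comm_aux, mul_comm_aux w (g * shift l h)]
    rw [mul_cons, mul_cons, shift_mul, shift_mul, add_mul_aux, h1, ih, ih, ih]
    abel

instance : CommRing (Shuffle ι R) :=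
  { (inferInstance : AddCommGroup (Shuffle ι R)), (inferInstance : Mul (Shuffle ι R)),
    (inferInstance : One (Shuffle ι R)) with
    left_distrib := fun f g h => by
      ext w; rw [mul_comm_aux, add_mul_aux, mul_comm_aux, mul_comm_aux w h]; rfl
    right_distrib := fun f g h => ext fun w => add_mul_aux w f g h
    zero_mul := fun f => ext fun w => zero_mul_aux w f
    mul_zero := fun f => ext fun w => (mul_comm_aux w f 0).trans (zero_mul_aux w f)
    mul_assoc := fun f g h => ext fun w => mul_assoc_aux w f g h
    one_mul := fun f => ext fun w => one_mul_aux w f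
    mul_one := fun f => ext fun w => (mul_comm_aux w f 1).trans (one_mul_aux w f)
    mul_comm := fun f g => ext fun w => mul_comm_aux w f g }

@[simp] lemma eval_sum {κ : Type*} (s : Finset κ) (f : κ → Shuffle ι R) (w : List ι) :
    (∑ i ∈ s, f i) w = ∑ i ∈ s, f i w :=
  map_sum (AddMonoidHom.mk' (fun f : Shuffle ι R => f w) fun _ _ => rfl) f s

/-- Apply a function to the values of a function of words. -/
def mapFun {S : Type*} (φ : R → S) (f : Shuffle ι R) : Shuffle ι S := fun w => φ (f w)

@[simp] lemma mapFun_apply {S : Type*} (φ : R → S) (f : Shuffle ι R) (w : List ι) :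
    mapFun φ f w = φ (f w) := rfl

@[simp] lemma shift_mapFun {S : Type*} (φ : R → S) (f : Shuffle ι R) (l : ι) :
    shift l (mapFun φ f) = mapFun φ (shift l f) := rfl

section Algebra

variable {k : Type*} [CommRing k] [Algebra k R]

instance : Module k (Shuffle ι R) := inferInstanceAs (Module k (List ι → R))

@[simp] lemma eval_smul (c : k) (f : Shuffle ι R) (w : List ι) : (c • f) w = c • f w := rfl

@[simp] lemma shift_smul (l : ι) (c : k) (f : Shuffle ι R) : shift l (c • f) = c • shift l f := rfl

lemma smul_mul_aux (c : k) (w : List ι) (f g : Shuffle ι R) : (c • f * g) w = c • (f * g) w := by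
  induction w generalizing f g with
  | nil => simp
  | cons l w ih => simp [mul_cons, ih]

instance : Algebra k (Shuffle ι R) :=
  Algebra.ofModule (fun c f g => ext fun w => smul_mul_aux c w f g)
    (fun c f g => ext fun w => by
      rw [mul_comm f, smul_mul_aux, mul_comm f]; rfl)

/-- A derivation of the coefficients, applied to the values of functions of words. -/
def coeffD (δ : Derivation k R R) : Derivation k (Shuffle ι R) (Shuffle ι R) :=
  Derivation.mk'
    { toFun := mapFun δ
      map_add' := fun f g => ext fun w => map_add δ (f w) (g w)
      map_smul' := fun c f => ext fun w => δ.map_smul c (f w) }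
    fun f g => by
      ext w
      change δ ((f * g) w) = (f * mapFun δ g) w + (g * mapFun δ f) w
      induction w generalizing f g with
      | nil => simp
      | cons l w ih => simp only [mul_cons, map_add, ih, shift_mapFun]; abel

@[simp] lemma coeffD_apply (δ : Derivation k R R) (f : Shuffle ι R) (w : List ι) :
    coeffD δ f w = δ (f w) := rfl

end Algebra

/-- A ring homomorphism of the coefficients, applied to the values of functions of words. -/
def mapHom {S : Type*} [CommRing S] (φ : R →+* S) : Shuffle ι R →+* Shuffle ι S where
  toFun := mapFun φ
  map_one' := by ext w; cases w <;> simp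
  map_zero' := by ext w; simp
  map_add' f g := by ext w; simp
  map_mul' f g := by
    ext w
    induction w generalizing f g with
    | nil => simp
    | cons l w ih =>
      simp only [mapFun_apply] at ih ⊢
      simp only [mul_cons, map_add, ih, shift_mapFun]

@[simp] lemma mapHom_apply {S : Type*} [CommRing S] (φ : R →+* S) (f : Shuffle ι R)
    (w : List ι) : mapHom φ f w = φ (f w) := rfl

/-- A product at `w` lies in an additive subgroup if this holds for all ways to distribute the
letters of `w` among the factors. -/
lemma mul_apply_mem (H : AddSubgroup R) (w : List ι) (f g : Shuffle ι R)
    (h : ∀ u v : List ι, u.Sublist w → v.Sublist w → (u ++ v).Perm w → f u * g v ∈ H) :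
    (f * g) w ∈ H := by
  induction w generalizing f g with
  | nil => exact h [] [] (List.Sublist.refl _) (List.Sublist.refl _) (List.Perm.refl _)
  | cons l w ih =>
    refine H.add_mem (ih _ _ fun u v hu hv huv => ?_) (ih _ _ fun u v hu hv huv => ?_)
    · exact h (l :: u) v (hu.cons_cons l) (hv.cons l) (huv.cons l)
    · exact h u (l :: v) (hu.cons l) (hv.cons_cons l) (List.perm_middle.trans (huv.cons l))

lemma mul_apply_eq_zero (w : List ι) (f g : Shuffle ι R)
    (h : ∀ u v : List ι, u.Sublist w → v.Sublist w → (u ++ v).Perm w → f u * g v = 0) :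
    (f * g) w = 0 := by
  simpa using mul_apply_mem ⊥ w f g (by simpa using h)

/-- A product at `w` only depends on the values of the factors at sublists of `w`. -/
lemma mul_congr {w : List ι} {f f' g g' : Shuffle ι R}
    (hf : ∀ v : List ι, v.Sublist w → f v = f' v)
    (hg : ∀ v : List ι, v.Sublist w → g v = g' v) :
    (f * g) w = (f' * g') w := by
  have h1 : ((f - f') * g) w = 0 := mul_apply_eq_zero _ _ _ fun u v hu _ _ => by
    simp [hf u hu]
  have h2 : (f' * (g - g')) w = 0 := mul_apply_eq_zero _ _ _ fun u v _ hv _ => by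
    simp [hg v hv]
  have h3 : f * g = f' * g' + (f - f') * g + f' * (g - g') := by ring
  rw [h3, eval_add, eval_add, h1, h2, add_zero, add_zero]

/-! ### Systems of differential equations -/

/-- `Φ g` at a word only depends on the values of `g` at words that are not longer. -/
def Causal (Φ : Shuffle ι R → Shuffle ι R) : Prop :=
  ∀ (g g' : Shuffle ι R) (w : List ι), (∀ v : List ι, v.length ≤ w.length → g v = g' v) →
    Φ g w = Φ g' w

lemma causal_id : Causal (fun g : Shuffle ι R => g) := fun _ _ w h => h w le_rfl

lemma causal_const (c : Shuffle ι R) : Causal (fun _ : Shuffle ι R => c) := fun _ _ _ _ => rfl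

lemma Causal.mul {Φ Ψ : Shuffle ι R → Shuffle ι R} (hΦ : Causal Φ) (hΨ : Causal Ψ) :
    Causal fun g => Φ g * Ψ g := fun g g' _ h =>
  mul_congr (fun v hv => hΦ g g' v fun u hu => h u (hu.trans hv.length_le))
    (fun v hv => hΨ g g' v fun u hu => h u (hu.trans hv.length_le))

lemma Causal.neg {Φ : Shuffle ι R → Shuffle ι R} (hΦ : Causal Φ) : Causal fun g => -Φ g :=
  fun g g' w h => congrArg Neg.neg (hΦ g g' w h)

/-- Successive approximations to the solution of `shift l g = Φ l g`, `g [] = a`. -/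
def approx (Φ : ι → Shuffle ι R → Shuffle ι R) (a : R) : ℕ → Shuffle ι R
  | 0 => fun _ => a
  | n + 1 => fun w => match w with
    | [] => a
    | l :: w => Φ l (approx Φ a n) w

/-- The solution of `shift l g = Φ l g`, `g [] = a`. -/
def solve (Φ : ι → Shuffle ι R → Shuffle ι R) (a : R) : Shuffle ι R :=
  fun w => approx Φ a w.length w

@[simp] lemma solve_nil (Φ : ι → Shuffle ι R → Shuffle ι R) (a : R) : solve Φ a [] = a := rfl

/-- By causality the `n`-th approximation is already final on words of length at most `n`; each
iteration settles one more letter. -/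
lemma approx_eq {Φ : ι → Shuffle ι R → Shuffle ι R} (hΦ : ∀ l, Causal (Φ l)) (a : R) (n : ℕ) :
    ∀ w : List ι, w.length ≤ n → approx Φ a n w = solve Φ a w := by
  induction n using Nat.strong_induction_on with
  | _ n ih =>
    intro w hw
    cases w with
    | nil => cases n <;> rfl
    | cons l w =>
      obtain ⟨n, rfl⟩ : ∃ m, n = m + 1 := ⟨n - 1, by simp at hw; omega⟩
      have hw' : w.length ≤ n := by simpa using hw
      change Φ l (approx Φ a n) w = Φ l (approx Φ a w.length) w
      refine hΦ l _ _ w fun v hv => ?_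
      rw [ih n (by omega) v (hv.trans hw'), ih w.length (by omega) v hv]

lemma shift_solve {Φ : ι → Shuffle ι R → Shuffle ι R} (hΦ : ∀ l, Causal (Φ l)) (a : R) (l : ι) :
    shift l (solve Φ a) = Φ l (solve Φ a) := by
  ext w
  change Φ l (approx Φ a w.length) w = _
  exact hΦ l _ _ w fun v hv => approx_eq hΦ a _ v hv

lemma eq_of_shift_eq {Φ : ι → Shuffle ι R → Shuffle ι R} (hΦ : ∀ l, Causal (Φ l))
    {g g' : Shuffle ι R} (h0 : g [] = g' []) (hg : ∀ l, shift l g = Φ l g)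
    (hg' : ∀ l, shift l g' = Φ l g') : g = g' := by
  ext w
  induction hn : w.length using Nat.strong_induction_on generalizing w with
  | _ n ih =>
    cases w with
    | nil => exact h0
    | cons l w =>
      change shift l g w = shift l g' w
      rw [hg, hg']
      exact hΦ l _ _ w fun v hv => ih v.length (by simp at hn; omega) v rfl

/-- The standard device for proving identities below: the difference of the two sides solves a
homogeneous linear system with zero initial value. -/
lemma eq_zero_of_shift_eq (c : ι → Shuffle ι R) {X : Shuffle ι R} (h0 : X [] = 0)
    (h : ∀ l, shift l X = c l * X) : X = 0 :=
  eq_of_shift_eq (Φ := fun l g => c l * g) (fun l => (causal_const _).mul causal_id) h0 h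
    (by simp)

/-- The exponential `g` of `S`: the solution of `∂ g = ∂ S * g` with `g [] = 1`. -/
def expo (S : Shuffle ι R) : Shuffle ι R := solve (fun l g => shift l S * g) 1

@[simp] lemma expo_nil (S : Shuffle ι R) : expo S [] = 1 := rfl

lemma shift_expo (S : Shuffle ι R) (l : ι) : shift l (expo S) = shift l S * expo S :=
  shift_solve (fun _ => (causal_const _).mul causal_id) 1 l

lemma eq_expo {S g : Shuffle ι R} (h0 : g [] = 1) (h : ∀ l, shift l g = shift l S * g) :
    g = expo S :=
  eq_of_shift_eq (Φ := fun l g => shift l S * g) (fun _ => (causal_const _).mul causal_id) h0 h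
    (shift_expo S)

/-- The inverse is constructed as the solution of `∂ g = -∂ f * g * g`; then `f * g - 1` solves a
homogeneous linear system. -/
lemma exists_mul_eq_one {f : Shuffle ι R} {b : R} (hb : f [] * b = 1) :
    ∃ g : Shuffle ι R, f * g = 1 ∧ g [] = b := by
  have hc : ∀ l : ι, Causal (fun g : Shuffle ι R => -(shift l f * g * g)) := fun l =>
    (((causal_const _).mul causal_id).mul causal_id).neg
  refine ⟨solve (fun l g => -(shift l f * g * g)) b, ?_, rfl⟩
  set g := solve (fun l g => -(shift l f * g * g)) b with hg
  have hs : ∀ l, shift l g = -(shift l f * g * g) := shift_solve hc b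
  rw [← sub_eq_zero]
  refine eq_zero_of_shift_eq (fun l => -(shift l f * g)) (by simp [hg, hb]) fun l => ?_
  rw [shift_sub, shift_mul, shift_one, hs]
  ring

/-- The chain rule. It only needs that `δ` commutes with `shift l` up to a multiple of `shift l`,
which covers both derivations of the coefficients and the gradings by letters. -/
lemma expo_derivation {k : Type*} [CommRing k] [Algebra k R]
    (δ : Derivation k (Shuffle ι R) (Shuffle ι R))
    (S : Shuffle ι R) (h0 : δ (expo S) [] = 0) (hS : δ S [] = 0) (c : ι → k) (hc : ∀ l f, shift l (δ f) = δ (shift l f) + c l • shift l f) :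
    δ (expo S) = δ S * expo S := by
  rw [← sub_eq_zero]
  refine eq_zero_of_shift_eq (fun l => shift l S) (by simp [hS, h0]) fun l => ?_
  rw [shift_sub, hc, shift_expo, shift_mul, hc, shift_expo, Derivation.leibniz]
  simp only [smul_eq_mul, add_mul, smul_mul_assoc]
  ring

lemma expo_coeffD {k : Type*} [CommRing k] [Algebra k R] (δ : Derivation k R R)
    (S : Shuffle ι R) (hS : S [] = 0) : coeffD δ (expo S) = coeffD δ S * expo S := by
  refine expo_derivation (coeffD δ) S ?_ ?_ (fun _ => 0) fun l f => ?_
  · simp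
  · simp [hS]
  · rw [zero_smul, add_zero]; rfl

lemma map_expo {S : Type*} [CommRing S] (φ : R →+* S) (f : Shuffle ι R) :
    mapHom φ (expo f) = expo (mapHom φ f) := by
  refine eq_expo (by simp) fun l => ?_
  change mapHom φ (shift l (expo f)) = mapHom φ (shift l f) * _
  rw [shift_expo, map_mul]

end Ring

end Shuffle

end

/-! ### Integrality, gradings and symmetrization -/

section

namespace Shuffle

variable {ι R : Type*} [CommRing R]

/-- The functions of words with values in a subring. -/
def regular (ι : Type*) (O : Subring R) : Subring (Shuffle ι R) where
  carrier := {f | ∀ w, f w ∈ O}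
  mul_mem' := fun {f g} hf hg w =>
    mul_apply_mem O.toAddSubgroup w f g fun u v _ _ _ => O.mul_mem (hf u) (hg v)
  one_mem' := fun w => by cases w <;> simp [O.one_mem, O.zero_mem]
  add_mem' := fun hf hg w => O.add_mem (hf w) (hg w)
  zero_mem' := fun w => O.zero_mem
  neg_mem' := fun hf w => O.neg_mem (hf w)

lemma shift_mem_regular {O : Subring R} {f : Shuffle ι R} (hf : f ∈ regular ι O) (l : ι) :
    shift l f ∈ regular ι O := fun w => hf (l :: w)

/-! ### Grading -/

section Grading

variable {k : Type*} [CommRing k] [Algebra k R]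

/-- The derivation which multiplies the value at `w` by the total weight of `w`. -/
def gradeD (k : Type*) [CommRing k] [Algebra k R] (d : ι → ℕ) :
    Derivation k (Shuffle ι R) (Shuffle ι R) :=
  Derivation.mk'
    { toFun := fun f w => (w.map d).sum • f w
      map_add' := fun f g => ext fun w => smul_add _ (f w) (g w)
      map_smul' := fun c f => ext fun w => smul_comm _ c (f w) }
    fun f g => by
      ext w
      let N : Shuffle ι R → Shuffle ι R := fun f w => (w.map d).sum • f w
      have hN : ∀ l f, shift l (N f) = N (shift l f) + d l • shift l f := fun l f => by
        ext v
        change ((l :: v).map d).sum • f (l :: v) = (v.map d).sum • f (l :: v) + d l • f (l :: v)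
        rw [List.map_cons, List.sum_cons, add_smul, add_comm]
      change (w.map d).sum • (f * g) w = (f * N g) w + (g * N f) w
      induction w generalizing f g with
      | nil =>
        change (0 : ℕ) • (f [] * g []) = f [] * ((0 : ℕ) • g []) + g [] * ((0 : ℕ) • f [])
        simp
      | cons l w ih =>
        simp only [mul_cons, hN, mul_add, eval_add, List.map_cons, List.sum_cons, add_smul,
          smul_add, ih, mul_smul_comm]
        rw [mul_comm g (shift l f)]
        have e1 : (d l • (shift l f * g)) w = d l • (shift l f * g) w := rfl
        have e2 : (d l • (f * shift l g)) w = d l • (f * shift l g) w := rfl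
        rw [e1, e2]
        abel

@[simp] lemma gradeD_apply (d : ι → ℕ) (f : Shuffle ι R) (w : List ι) :
    gradeD k d f w = (w.map d).sum • f w := rfl

lemma shift_gradeD (d : ι → ℕ) (l : ι) (f : Shuffle ι R) :
    shift l (gradeD k d f) = gradeD k d (shift l f) + (d l : k) • shift l f := by
  ext v
  rw [Nat.cast_smul_eq_nsmul]
  change ((l :: v).map d).sum • f (l :: v) = (v.map d).sum • f (l :: v) + d l • f (l :: v)
  rw [List.map_cons, List.sum_cons, add_smul, add_comm]

lemma expo_gradeD (d : ι → ℕ) (S : Shuffle ι R) :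
    gradeD k d (expo S) = gradeD k d S * expo S :=
  expo_derivation (gradeD k d) S (by simp) (by simp) (fun l => d l)
    fun l f => shift_gradeD d l f

end Grading

/-! ### Symmetric functions -/

/-- The function does not depend on the order of the letters. -/
def IsSymm (f : Shuffle ι R) : Prop := ∀ ⦃w w' : List ι⦄, w.Perm w' → f w = f w'

lemma IsSymm.shift {f : Shuffle ι R} (hf : IsSymm f) (l : ι) : IsSymm (shift l f) :=
  fun _ _ h => hf (h.cons l)

lemma IsSymm.shift_comm {f : Shuffle ι R} (hf : IsSymm f) (l m : ι) :
    Shuffle.shift l (Shuffle.shift m f) = Shuffle.shift m (Shuffle.shift l f) :=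
  ext fun w => hf (List.Perm.swap l m w)

lemma IsSymm.mul {f g : Shuffle ι R} (hf : IsSymm f) (hg : IsSymm g) : IsSymm (f * g) := by
  intro w w' h
  induction h generalizing f g with
  | nil => rfl
  | cons l _ ih => rw [mul_cons, mul_cons, ih (hf.shift l) hg, ih hf (hg.shift l)]
  | swap l m w =>
    simp only [mul_cons, hf.shift_comm l m, hg.shift_comm l m]
    ring
  | trans _ _ ih1 ih2 => rw [ih1 hf hg, ih2 hf hg]

/-- The letters of a word in decreasing order. -/
def sorted (w : List ℕ) : List ℕ := (w : Multiset ℕ).sort (· ≥ ·)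

lemma sorted_perm (w : List ℕ) : (sorted w).Perm w := by
  rw [← Multiset.coe_eq_coe]; exact Multiset.sort_eq _ _

lemma sorted_congr {w w' : List ℕ} (h : w.Perm w') : sorted w = sorted w' := by
  unfold sorted; rw [Multiset.coe_eq_coe.2 h]

lemma sorted_pairwise (w : List ℕ) : (sorted w).Pairwise (· ≥ ·) := Multiset.pairwise_sort _ _

lemma sorted_eq_self {w : List ℕ} (h : w.Pairwise (· ≥ ·)) : sorted w = w :=
  (sorted_perm w).eq_of_pairwise' (sorted_pairwise w) h

@[simp] lemma length_sorted (w : List ℕ) : (sorted w).length = w.length :=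
  (sorted_perm w).length_eq

@[simp] lemma sum_sorted (w : List ℕ) : (sorted w).sum = w.sum := (sorted_perm w).sum_eq

/-- The restriction of a function of words to decreasing words of positive integers, extended
by symmetry, and by zero to words containing the letter `0`. -/
def symFun (f : Shuffle ℕ R) : Shuffle ℕ R := fun w => if 0 ∈ w then 0 else f (sorted w)

lemma symFun_isSymm (f : Shuffle ℕ R) : IsSymm (symFun f) := fun w w' h => by
  simp only [symFun, h.mem_iff, sorted_congr h]

lemma symFun_apply_of_pairwise {f : Shuffle ℕ R} {w : List ℕ} (h0 : 0 ∉ w)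
    (h : w.Pairwise (· ≥ ·)) : symFun f w = f w := by
  rw [symFun, if_neg h0, sorted_eq_self h]

@[simp] lemma symFun_nil (f : Shuffle ℕ R) : symFun f [] = f [] := by
  rw [symFun_apply_of_pairwise (by simp) (by simp)]

lemma symFun_of_mem (f : Shuffle ℕ R) {w : List ℕ} (h : 0 ∈ w) : symFun f w = 0 := if_pos h

/-- A product at `w` only involves sublists of `w`, and sublists of decreasing words are decreasing.
Hence restriction to decreasing words loses no information needed for products. -/
lemma symFun_mul (f g : Shuffle ℕ R) : symFun (f * g) = symFun f * symFun g := by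
  ext w
  by_cases h0 : 0 ∈ w
  · rw [symFun_of_mem _ h0, mul_apply_eq_zero]
    intro u v _ _ huv
    rcases List.mem_append.1 (huv.mem_iff.2 h0) with h | h
    · rw [symFun_of_mem _ h, zero_mul]
    · rw [symFun_of_mem _ h, mul_zero]
  · rw [(symFun_isSymm f).mul (symFun_isSymm g) (sorted_perm w).symm, symFun, if_neg h0]
    have h0' : 0 ∉ sorted w := fun h => h0 ((sorted_perm w).mem_iff.1 h)
    refine mul_congr (fun v hv => ?_) fun v hv => ?_ <;>
    · exact (symFun_apply_of_pairwise (fun h => h0' (hv.subset h))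
        ((sorted_pairwise w).sublist hv)).symm

/-- `symFun` as a ring homomorphism. -/
def sym : Shuffle ℕ R →+* Shuffle ℕ R where
  toFun := symFun
  map_one' := by
    ext w
    by_cases h0 : 0 ∈ w
    · rw [symFun_of_mem _ h0]; cases w <;> simp_all
    · rw [symFun, if_neg h0]
      cases w with
      | nil => rw [(sorted_perm []).eq_nil]
      | cons l w =>
        obtain ⟨m, v, hv⟩ : ∃ m v, sorted (l :: w) = m :: v := by
          have := length_sorted (l :: w)
          match h : sorted (l :: w) with
          | [] => rw [h] at this; simp at this
          | m :: v => exact ⟨m, v, rfl⟩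
        rw [hv]; simp
  map_zero' := by ext w; simp [symFun]
  map_add' f g := by
    ext w; simp only [symFun, eval_add]; split_ifs <;> simp
  map_mul' := symFun_mul

lemma sym_isSymm (f : Shuffle ℕ R) : IsSymm (sym f) := symFun_isSymm f

@[simp] lemma sym_nil (f : Shuffle ℕ R) : sym f [] = f [] := symFun_nil f

lemma sym_of_mem (f : Shuffle ℕ R) {w : List ℕ} (h : 0 ∈ w) : sym f w = 0 := if_pos h

lemma sym_of_notMem (f : Shuffle ℕ R) {w : List ℕ} (h : 0 ∉ w) : sym f w = f (sorted w) :=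
  if_neg h

lemma sym_apply_of_pairwise {f : Shuffle ℕ R} {w : List ℕ} (h0 : 0 ∉ w)
    (h : w.Pairwise (· ≥ ·)) : sym f w = f w := symFun_apply_of_pairwise h0 h

lemma sym_eq_self {f : Shuffle ℕ R} (hf : IsSymm f) (h0 : ∀ w : List ℕ, 0 ∈ w → f w = 0) :
    sym f = f := by
  ext w
  by_cases h : 0 ∈ w
  · rw [sym_of_mem _ h, h0 w h]
  · rw [sym_of_notMem _ h, hf (sorted_perm w)]

lemma sym_mem_regular {O : Subring R} {f : Shuffle ℕ R} (hf : f ∈ regular ℕ O) :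
    sym f ∈ regular ℕ O := fun w => by
  by_cases h : 0 ∈ w
  · rw [sym_of_mem _ h]; exact O.zero_mem
  · rw [sym_of_notMem _ h]; exact hf _

lemma sym_smul {k : Type*} [CommRing k] [Algebra k R] (c : k) (f : Shuffle ℕ R) :
    sym (c • f) = c • sym f := by
  ext w
  by_cases h : 0 ∈ w
  · simp [sym_of_mem _ h]
  · simp [sym_of_notMem _ h]

instance [IsAddTorsionFree R] : IsAddTorsionFree (Shuffle ι R) :=
  inferInstanceAs (IsAddTorsionFree (List ι → R))

lemma sym_gradeD (d : ℕ → ℕ) (f : Shuffle ℕ R) :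
    sym (gradeD ℤ d f) = gradeD ℤ d (sym f) := by
  ext w
  by_cases h : 0 ∈ w
  · simp [sym_of_mem _ h]
  · simp [sym_of_notMem _ h, ((sorted_perm w).map d).sum_eq]

/-- The number-of-letters derivation replaces the shifts here, because it commutes with `sym` and
they do not. The equation at `w` determines only `w.length • f w`, whence the torsion-freeness. -/
lemma eq_of_gradeD_eq [IsAddTorsionFree R] {S f g : Shuffle ι R} (h0 : f [] = g [])
    (hf : gradeD ℤ (fun _ => 1) f = gradeD ℤ (fun _ => 1) S * f)
    (hg : gradeD ℤ (fun _ => 1) g = gradeD ℤ (fun _ => 1) S * g) : f = g := by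
  rw [← sub_eq_zero]
  have hX : gradeD ℤ (fun _ => 1) (f - g) = gradeD ℤ (fun _ => 1) S * (f - g) := by
    rw [map_sub, hf, hg, mul_sub]
  have hX0 : (f - g) [] = 0 := by simp [h0]
  generalize f - g = X at hX hX0 ⊢
  ext w
  induction hn : w.length using Nat.strong_induction_on generalizing w with
  | _ n ih =>
    rcases eq_or_ne w [] with rfl | hw
    · exact hX0
    have h1 := congrFun hX w
    rw [mul_apply_eq_zero, gradeD_apply] at h1
    · rw [List.map_const', List.sum_replicate, smul_eq_mul, mul_one] at h1
      exact (nsmul_eq_zero_iff_right (by simpa using hw)).1 h1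
    · intro u v hu hv huv
      rcases eq_or_ne u [] with rfl | hu0
      · simp
      · have h2 := huv.length_eq
        have h3 := List.length_pos_iff.2 hu0
        rw [ih v.length (by simp at h2; omega) v rfl]
        simp

lemma sym_expo [IsAddTorsionFree R] (S : Shuffle ℕ R) : sym (expo S) = expo (sym S) := by
  refine eq_of_gradeD_eq (S := sym S) (by simp) ?_ (expo_gradeD _ _)
  rw [← sym_gradeD, expo_gradeD, map_mul, sym_gradeD]

end Shuffle

end

/-! ### Letter weights; the pairing and the vertex as exponentials -/

section

namespace Shuffle

section Scale

variable {ι R k : Type*} [CommRing R] [CommRing k] [Algebra k R]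

/-- Multiply the value at a word by the product of the weights of its letters. -/
def scale (r : ι → k) : Shuffle ι R →+* Shuffle ι R where
  toFun f w := (w.map r).prod • f w
  map_one' := by ext w; cases w <;> simp
  map_zero' := by ext w; simp
  map_add' f g := by ext w; exact smul_add _ _ _
  map_mul' f g := by
    ext w
    let N : Shuffle ι R → Shuffle ι R := fun f w => (w.map r).prod • f w
    have hN : ∀ l f, shift l (N f) = r l • N (shift l f) := fun l f => by
      ext v
      change ((l :: v).map r).prod • f (l :: v) = r l • (v.map r).prod • f (l :: v)
      rw [List.map_cons, List.prod_cons, mul_smul]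
    change (w.map r).prod • (f * g) w = (N f * N g) w
    induction w generalizing f g with
    | nil =>
      change (1 : k) • (f [] * g []) = ((1 : k) • f []) * ((1 : k) • g [])
      simp
    | cons l w ih =>
      simp only [mul_cons, hN, smul_mul_assoc, mul_smul_comm, eval_smul, ← ih, List.map_cons,
        List.prod_cons, mul_smul, smul_add]

@[simp] lemma scale_apply (r : ι → k) (f : Shuffle ι R) (w : List ι) :
    scale r f w = (w.map r).prod • f w := rfl

lemma shift_scale (r : ι → k) (f : Shuffle ι R) (l : ι) :
    shift l (scale r f) = r l • scale r (shift l f) := by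
  ext v
  change ((l :: v).map r).prod • f (l :: v) = r l • (v.map r).prod • f (l :: v)
  rw [List.map_cons, List.prod_cons, mul_smul]

lemma scale_expo (r : ι → k) (S : Shuffle ι R) : scale r (expo S) = expo (scale r S) := by
  refine eq_expo (by simp) fun l => ?_
  rw [shift_scale, shift_scale, shift_expo, map_mul, smul_mul_assoc]

end Scale

end Shuffle

namespace ClassicalBlock

open Shuffle

section Field

variable {K : Type*} [Field K]

/-- The action of `L_k` on functionals of descendants for `ht = c = 0`. -/
def virAux : List ℕ → ℕ → Shuffle ℕ K → K
  | [], _, _ => 0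
  | l :: w, k, f => virAux w k (shift l f) +
      ((k : K) + l) * (if k < l then f ((l - k) :: w) else virAux w (k - l) f)

lemma virAux_add (w : List ℕ) (k : ℕ) (f g : Shuffle ℕ K) :
    virAux w k (f + g) = virAux w k f + virAux w k g := by
  induction w generalizing k f g with
  | nil => simp [virAux]
  | cons l w ih =>
    simp only [virAux, shift_add, ih, eval_add]
    split_ifs <;> ring

lemma virAux_smul (w : List ℕ) (k : ℕ) (a : K) (f : Shuffle ℕ K) :
    virAux w k (a • f) = a * virAux w k f := by
  induction w generalizing k f with
  | nil => simp [virAux]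
  | cons l w ih =>
    simp only [virAux, shift_smul, ih, eval_smul, smul_eq_mul]
    split_ifs <;> ring

/-- `virAux` as an operator on functions of words. -/
def virFun (k : ℕ) (f : Shuffle ℕ K) : Shuffle ℕ K := fun w => virAux w k f

lemma shift_virFun (k l : ℕ) (f : Shuffle ℕ K) : shift l (virFun k f) = virFun k (shift l f) +
    ((k : K) + l) • (if k < l then shift (l - k) f else virFun (k - l) f) := by
  ext v
  change virAux (l :: v) k f = _
  simp only [virAux, eval_add, eval_smul, smul_eq_mul]
  split_ifs <;> rfl

/-- By `shift_virFun`, the commutator of `shift l` and the action of `L_k` is a multiple of another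
shift or of some `L_{k-l}`. These obey the Leibniz rule on shorter words, so induction applies. -/
lemma virAux_mul (w : List ℕ) (k : ℕ) (f g : Shuffle ℕ K) :
    virAux w k (f * g) = (f * virFun k g + g * virFun k f) w := by
  induction w generalizing k f g with
  | nil => simp [virAux, virFun]
  | cons l w ih =>
    simp only [virAux, shift_mul, virAux_add, ih, eval_add, mul_cons, shift_virFun]
    split_ifs with h
    · rw [mul_add f, mul_add g, mul_smul_comm, mul_smul_comm, mul_comm (shift (l - k) f)]
      simp only [eval_add, eval_smul, smul_eq_mul]
      rw [mul_comm g (virFun k (shift l f)), mul_comm (shift l f) (virFun k g), mul_comm (virFun k g)]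
      ring
    · rw [mul_add f, mul_add g, mul_smul_comm, mul_smul_comm]
      simp only [eval_add, eval_smul, smul_eq_mul]
      ring

/-- The action of `L_k` on functionals of descendants for `ht = c = 0`, as a derivation. -/
def virD (k : ℕ) : Derivation K (Shuffle ℕ K) (Shuffle ℕ K) :=
  Derivation.mk'
    { toFun := virFun k
      map_add' := fun f g => ext fun w => virAux_add w k f g
      map_smul' := fun a f => ext fun w => virAux_smul w k a f }
    fun f g => ext fun w => virAux_mul w k f g

lemma virD_apply (k : ℕ) (f : Shuffle ℕ K) (w : List ℕ) : virD k f w = virAux w k f := rfl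

/-- The multiplicative part of the action of `L_k` on functionals of descendants. -/
def virM (ht c : K) : ℕ → Shuffle ℕ K
  | k, [] => if k = 0 then ht else 0
  | k, l :: w => if k < l then 0 else ((k : K) + l) * virM ht c (k - l) w +
      if k = l ∧ w = [] then c / 12 * ((k : K) ^ 3 - k) else 0

lemma virM_nil (ht c : K) (k : ℕ) : virM ht c k [] = if k = 0 then ht else 0 := by
  rw [virM]

lemma virM_cons (ht c : K) (k l : ℕ) (w : List ℕ) : virM ht c k (l :: w) =
    if k < l then 0 else ((k : K) + l) * virM ht c (k - l) w +
      if k = l ∧ w = [] then c / 12 * ((k : K) ^ 3 - k) else 0 := by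
  rw [virM]

lemma shift_virM (ht c : K) (k l : ℕ) : shift l (virM ht c k) =
    if k < l then 0 else ((k : K) + l) • virM ht c (k - l) +
      (if k = l then c / 12 * ((k : K) ^ 3 - k) else 0) • (1 : Shuffle ℕ K) := by
  ext w
  rw [shift_apply, virM_cons]
  by_cases h : k < l
  · simp [h]
  · rw [if_neg h, if_neg h]
    by_cases h2 : k = l <;> cases w <;> simp [h2]

/-- The transpose of `L_k` is a first-order differential operator. The parameters `ht` and `c` occur
only in its multiplicative part `virM`, and linearly. -/
lemma linearCombination_lower (ht c : K) (k : ℕ) (w : List ℕ) (f : Shuffle ℕ K) :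
    Finsupp.linearCombination K f (lower ht c k w) = (virD k f + virM ht c k * f) w := by
  induction w generalizing k f with
  | nil =>
    rw [lower]
    simp only [eval_add, virD_apply, virAux, mul_nil, virM_nil, zero_add]
    by_cases h : k = 0
    · simp only [h, if_true]
      exact Finsupp.linearCombination_single K _ _
    · simp only [h, if_false, map_zero, zero_mul]
  | cons l w ih =>
    have e1 : Finsupp.linearCombination K f ((lower ht c k w).mapDomain (List.cons l)) =
        Finsupp.linearCombination K (shift l f) (lower ht c k w) :=
      Finsupp.linearCombination_mapDomain K _ _
    rw [lower, map_add, e1, ih, eval_add, eval_add, mul_cons, shift_virM]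
    simp only [virD_apply, virAux]
    have hs : ∀ (v : List ℕ) (a : K),
        Finsupp.linearCombination K f (Finsupp.single v a) = a * f v :=
      fun v a => Finsupp.linearCombination_single K a v
    by_cases h : k < l
    · simp only [h, if_true, hs, zero_mul, eval_zero]
      ring
    · simp only [h, if_false, map_add, map_smul, ih, add_mul, smul_mul_assoc, one_mul, eval_add,
        eval_smul, smul_eq_mul, virD_apply]
      by_cases h2 : k = l
      · simp only [h2, if_true, hs]
        ring
      · simp only [h2, if_false, map_zero]
        ring

lemma foldl_lowerLin (ht c : K) (y : List ℕ) (v : List ℕ →₀ K) :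
    (y.foldl (fun v k => lowerLin ht c k v) v) [] =
      Finsupp.linearCombination K (pairing ht c y) v := by
  induction y generalizing v with
  | nil =>
    rw [List.foldl_nil, Finsupp.linearCombination_apply, Finsupp.sum]
    simp only [pairing, List.foldl_nil, smul_eq_mul]
    by_cases h : ([] : List ℕ) ∈ v.support
    · rw [Finset.sum_eq_single_of_mem [] h fun w _ hw => by simp [hw]]
      simp
    · rw [Finset.sum_eq_zero fun w hw => ?_]
      · simpa using h
      · have : w ≠ [] := fun e => h (e ▸ hw)
        simp [this]
  | cons k y ih =>
    rw [List.foldl_cons, ih]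
    have : (Finsupp.linearCombination K (pairing ht c y)).comp (lowerLin ht c k) =
        Finsupp.linearCombination K (pairing ht c (k :: y)) := by
      refine Finsupp.lhom_ext' fun w => LinearMap.ext_ring ?_
      simp only [LinearMap.comp_apply, Finsupp.lsingle_apply, Finsupp.linearCombination_single,
        one_smul]
      conv_rhs => rw [pairing, List.foldl_cons, ih]
    exact LinearMap.congr_fun this v

/-- The pairing as a function of two words. -/
noncomputable def pairingFun (ht c : K) : Shuffle ℕ (Shuffle ℕ K) := fun y w => pairing ht c y w

lemma pairingFun_nil (ht c : K) : pairingFun ht c [] = 1 := by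
  ext w
  cases w <;> simp [pairingFun, pairing]

lemma pairingFun_cons (ht c : K) (k : ℕ) (y : List ℕ) :
    pairingFun ht c (k :: y) =
      virD k (pairingFun ht c y) + virM ht c k * pairingFun ht c y := by
  ext w
  change pairing ht c (k :: y) w = _
  rw [pairing, List.foldl_cons, foldl_lowerLin]
  change Finsupp.linearCombination K _ (Finsupp.linearCombination K _ (Finsupp.single w 1)) = _
  rw [Finsupp.linearCombination_single, one_smul]
  exact linearCombination_lower ht c k w _

/-- The logarithm of `pairingFun`. -/
def logPairing (ht c : K) : Shuffle ℕ (Shuffle ℕ K)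
  | [] => 0
  | k :: y => virD k (logPairing ht c y) + if y = [] then virM ht c k else 0

/-- In its first argument the pairing solves `∂_k P = virD k P + virM k * P`. Since `virD k` is a
derivation, the logarithm solves the inhomogeneous linear equation `∂_k S = virD k S + virM k`, and
so is linear in `ht` and `c`. -/
lemma pairingFun_eq_expo (ht c : K) : pairingFun ht c = expo (logPairing ht c) := by
  refine eq_of_shift_eq (Φ := fun k g => coeffD (virD k) g + virM ht c k • g) ?_ ?_ ?_ ?_
  · intro l g g' w h
    simp [h w le_rfl]
  · exact pairingFun_nil ht c
  · intro l
    ext y : 1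
    exact pairingFun_cons ht c l y
  · intro l
    rw [expo_coeffD _ _ (by rfl), shift_expo]
    have : shift l (logPairing ht c) =
        coeffD (virD l) (logPairing ht c) + virM ht c l • (1 : Shuffle ℕ (Shuffle ℕ K)) := by
      ext y : 1
      change logPairing ht c (l :: y) = _
      rw [logPairing]
      cases y <;> simp
    rw [this, add_mul, smul_mul_assoc, one_mul]

/-! ### The matrix element of a primary field -/

/-- `vertex` as a function of words. -/
def vertexFun (a b ht : K) : Shuffle ℕ K := vertex a b ht

/-- The logarithm of `vertexFun`. -/
def logVertex (a b ht : K) : Shuffle ℕ K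
  | [] => 0
  | l :: w => w.sum * logVertex a b ht w + if w = [] then ht + l * a - b else 0

/-- The same mechanism as for the pairing: the recursion is `∂_l g = (grading) g + (ht + l a - b)
g`, with the grading by level in the role of the derivation. -/
lemma vertexFun_eq_expo (a b ht : K) : vertexFun a b ht = expo (logVertex a b ht) := by
  have key : ∀ w : List ℕ, (w.map (id : ℕ → ℕ)).sum = w.sum := fun w => by simp
  refine eq_of_shift_eq
    (Φ := fun l g => gradeD K (id : ℕ → ℕ) g + (ht + l * a - b : K) • g) ?_ ?_ ?_ ?_
  · intro l g g' w h
    simp [h w le_rfl]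
  · rfl
  · intro l
    ext w
    rw [eval_add, gradeD_apply, eval_smul, key, nsmul_eq_mul, smul_eq_mul]
    change (ht + l * a - b + (w.sum : ℕ)) * vertex a b ht w =
      w.sum * vertex a b ht w + (ht + l * a - b) * vertex a b ht w
    ring
  · intro l
    rw [expo_gradeD, shift_expo]
    have : shift l (logVertex a b ht) =
        gradeD K (id : ℕ → ℕ) (logVertex a b ht) + (ht + l * a - b : K) • (1 : Shuffle ℕ K) := by
      ext w
      change logVertex a b ht (l :: w) = _
      rw [logVertex]
      rw [eval_add, gradeD_apply, eval_smul, key, nsmul_eq_mul, smul_eq_mul]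
      cases w <;> simp
    rw [this, add_mul, smul_mul_assoc, one_mul]

end Field

end ClassicalBlock

end

/-! ### Scalings over a local ring and the normalized Gram matrix -/

section

namespace ClassicalBlock

open Shuffle

/-- A subring of a field with a residue homomorphism, which is local with respect to it. -/
structure Residue (K k : Type*) [Field K] [Field k] where
  /-- the subring -/
  ring : Subring K
  /-- the residue homomorphism -/
  res : ring →+* k
  inv_mem : ∀ x : ring, res x ≠ 0 → (x : K)⁻¹ ∈ ring

/-- A scaling of the intermediate dimension and of the central charge which tends to infinity with
`1 / ε`; the letters of a descendant get the weight `ε`, and `ε * ρ` if they are at least `2`. -/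
structure Scaling {K k : Type*} [Field K] [Field k] (V : Residue K k) where
  /-- the inverse scale of the dimensions -/
  ε : K
  /-- the relative weight of the letters which contribute to the central charge -/
  ρ : K
  /-- the intermediate dimension -/
  ht : K
  /-- the central charge -/
  c : K
  ε_mem : ε ∈ V.ring
  ρ_mem : ρ ∈ V.ring
  ε_ne : ε ≠ 0
  ρ_ne : ρ ≠ 0
  res_ε : V.res ⟨ε, ε_mem⟩ = 0
  ht_mem : ε * ht ∈ V.ring
  c_mem : ρ * (ε * c) ∈ V.ring
  -- `2 l ht + c / 12 (l ^ 3 - l)` is the norm of `L_{-l} |ht⟩`; the weights are chosen to make it a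
  -- unit.
  unit : ∀ l : ℕ, 1 ≤ l → ∃ h : ε * ((if l ≤ 1 then 1 else ρ) *
    (2 * l * ht + c / 12 * ((l : K) ^ 3 - l))) ∈ V.ring, V.res ⟨_, h⟩ ≠ 0

variable {K k : Type*} [Field K] [Field k]

namespace Residue

variable (V : Residue K k)

lemma inv_natCast_mem [CharZero k] (n : ℕ) : (n : K)⁻¹ ∈ V.ring := by
  rcases eq_or_ne n 0 with rfl | hn
  · simp [V.ring.zero_mem]
  · have := V.inv_mem (n : V.ring) (by simpa using hn)
    simpa using this

end Residue

namespace Scaling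

variable {V : Residue K k} (s : Scaling V)

/-- The relative weight of a letter. -/
def wt (l : ℕ) : K := if l ≤ 1 then 1 else s.ρ

lemma wt_mem (l : ℕ) : s.wt l ∈ V.ring := by
  unfold wt; split_ifs; exacts [V.ring.one_mem, s.ρ_mem]

lemma wt_ne (l : ℕ) : s.wt l ≠ 0 := by
  unfold wt; split_ifs; exacts [one_ne_zero, s.ρ_ne]

/-- The leading part of the norm of the descendant with one letter. -/
def norm (l : ℕ) : K :=
  s.ε * (s.wt l * (2 * l * s.ht + s.c / 12 * ((l : K) ^ 3 - l)))

/-- The multiples of `ε`. -/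
def small : AddSubgroup K := V.ring.toAddSubgroup.map (AddMonoidHom.mulLeft s.ε)

lemma small_le {x : K} (hx : x ∈ s.small) : x ∈ V.ring := by
  obtain ⟨a, ha, rfl⟩ := hx
  exact V.ring.mul_mem s.ε_mem ha

lemma mul_mem_small {x y : K} (hx : x ∈ V.ring) (hy : y ∈ s.small) : x * y ∈ s.small := by
  obtain ⟨a, ha, rfl⟩ := hy
  exact ⟨x * a, V.ring.mul_mem hx ha, by simp; ring⟩

lemma res_small {x : K} (hx : x ∈ s.small) : V.res ⟨x, s.small_le hx⟩ = 0 := by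
  obtain ⟨a, ha, rfl⟩ := hx
  have : (⟨s.ε * a, s.small_le ⟨a, ha, rfl⟩⟩ : V.ring) = ⟨s.ε, s.ε_mem⟩ * ⟨a, ha⟩ := rfl
  change V.res (⟨s.ε * a, s.small_le ⟨a, ha, rfl⟩⟩ : V.ring) = 0
  rw [this, map_mul, s.res_ε, zero_mul]

variable [CharZero k]

/-- The recursion lowers the index while the weight remains that of the original letter, hence two
indices. For `j ≤ 1` the weight lacks `ρ`, but then the central term is absent because `i ^ 3 = i`.
-/
lemma virM_mem (j i : ℕ) (hij : i ≤ j) (w : List ℕ) :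
    s.ε * (s.wt j * virM s.ht s.c i w) ∈ V.ring := by
  induction w generalizing i with
  | nil =>
    rw [virM_nil]
    split_ifs
    · rw [mul_left_comm]; exact V.ring.mul_mem (s.wt_mem j) s.ht_mem
    · simp [V.ring.zero_mem]
  | cons l w ih =>
    rw [virM_cons]
    split_ifs with h1 h2
    · simp [V.ring.zero_mem]
    · have e : s.ε * (s.wt j * (((i : K) + l) * virM s.ht s.c (i - l) w +
          s.c / 12 * ((i : K) ^ 3 - i))) = ((i : K) + l) *
          (s.ε * (s.wt j * virM s.ht s.c (i - l) w)) + s.wt j * (s.ε * s.c) *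
          (((12 : ℕ) : K)⁻¹ * ((i : K) ^ 3 - i)) := by push_cast; ring
      rw [e]
      refine V.ring.add_mem (V.ring.mul_mem (V.ring.add_mem (natCast_mem _ i) (natCast_mem _ l))
        (ih _ (by omega))) ?_
      by_cases hj : j ≤ 1
      · have : i = 0 ∨ i = 1 := by omega
        rcases this with rfl | rfl <;> simp [V.ring.zero_mem]
      · rw [wt, if_neg hj]
        exact V.ring.mul_mem s.c_mem (V.ring.mul_mem (V.inv_natCast_mem 12)
          (V.ring.sub_mem (pow_mem (natCast_mem _ i) 3) (natCast_mem _ i)))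
    · have e : s.ε * (s.wt j * (((i : K) + l) * virM s.ht s.c (i - l) w + 0)) = ((i : K) + l) *
          (s.ε * (s.wt j * virM s.ht s.c (i - l) w)) := by ring
      rw [e]
      exact V.ring.mul_mem (V.ring.add_mem (natCast_mem _ i) (natCast_mem _ l)) (ih _ (by omega))

lemma virAux_mem {O : Subring K} (w : List ℕ) (j : ℕ) {f : Shuffle ℕ K}
    (hf : f ∈ regular ℕ O) : virAux w j f ∈ O := by
  induction w generalizing j f with
  | nil => simp [virAux, O.zero_mem]
  | cons l w ih =>
    rw [virAux]
    refine O.add_mem (ih j (shift_mem_regular hf l))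
      (O.mul_mem (O.add_mem (natCast_mem _ j) (natCast_mem _ l)) ?_)
    split_ifs
    exacts [hf _, ih _ hf]

lemma virD_mem {O : Subring K} (j : ℕ) {f : Shuffle ℕ K}
    (hf : f ∈ regular ℕ O) : virD j f ∈ regular ℕ O := fun w => virAux_mem w j hf

/-- A single factor `ε` suffices for words of any length: each value is obtained from one `virM` by
operators `virD`, which have integral coefficients and do not involve `ht` or `c`. -/
lemma logPairing_regular :
    s.ε • scale s.wt (logPairing s.ht s.c) ∈ regular ℕ (regular ℕ V.ring) := by
  intro y
  rw [eval_smul, scale_apply]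
  induction y with
  | nil => simp [logPairing]
  | cons j y ih =>
    rw [logPairing, List.map_cons, List.prod_cons, smul_add, smul_add]
    refine Subring.add_mem _ ?_ ?_
    · have e : s.ε • (s.wt j * (y.map s.wt).prod) • virD j (logPairing s.ht s.c y) =
          s.wt j • virD j (s.ε • (y.map s.wt).prod • logPairing s.ht s.c y) := by
        rw [Derivation.map_smul, Derivation.map_smul, mul_smul, smul_comm s.ε]
      rw [e]
      exact fun w => V.ring.mul_mem (s.wt_mem j) (virD_mem j ih w)
    · intro w
      split_ifs with h
      · subst h
        simpa using s.virM_mem j j le_rfl w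
      · simp [V.ring.zero_mem]

lemma scale_pairingFun : scale s.wt (pairingFun s.ht s.c) =
    expo (scale s.wt (logPairing s.ht s.c)) := by
  rw [pairingFun_eq_expo, scale_expo]

/-! ### The Gram matrix -/

/-- The pairing with normalized words in the first argument. -/
noncomputable def normPairing (y : List ℕ) : Shuffle ℕ K :=
  (s.ε ^ y.length * (y.map s.wt).prod) • pairingFun s.ht s.c y

lemma normPairing_cons (j : ℕ) (y : List ℕ) : s.normPairing (j :: y) =
    (s.ε * s.wt j) • virD j (s.normPairing y) +
      ((s.ε * s.wt j) • virM s.ht s.c j) * s.normPairing y := by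
  rw [normPairing, normPairing, pairingFun_cons, Derivation.map_smul, smul_mul_smul_comm, smul_smul,
    ← smul_add]
  congr 1
  simp only [List.length_cons, List.map_cons, List.prod_cons]
  ring

lemma normPairing_mem (y : List ℕ) : s.normPairing y ∈ regular ℕ V.ring := by
  induction y with
  | nil =>
    have : s.normPairing [] = 1 := by simp [normPairing, pairingFun_nil]
    rw [this]; exact Subring.one_mem _
  | cons j y ih =>
    rw [normPairing_cons]
    refine Subring.add_mem _ ?_ (Subring.mul_mem _ ?_ ih)
    · exact fun w => V.ring.mul_mem (V.ring.mul_mem s.ε_mem (s.wt_mem j)) (virD_mem j ih w)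
    · intro w
      have := s.virM_mem j j le_rfl w
      rwa [← mul_assoc] at this

/-- Each letter of `y` brings a factor `ε`, which only a term with `virM` can absorb. As `virM j`
vanishes at `[]` for `j ≠ 0`, such a term uses up a letter of `w`; with fewer letters in `w` a
factor `ε` is left over. -/
lemma normPairing_small (y w : List ℕ) (hy : 0 ∉ y) (h : w.length < y.length) :
    s.normPairing y w ∈ s.small := by
  induction y generalizing w with
  | nil => simp at h
  | cons j y ih =>
    rw [normPairing_cons, eval_add]
    refine s.small.add_mem ⟨s.wt j * virD j (s.normPairing y) w, V.ring.mul_mem (s.wt_mem j)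
      (virD_mem j (s.normPairing_mem y) w), (mul_assoc _ _ _).symm⟩ ?_
    refine mul_apply_mem _ _ _ _ fun u v _ _ huv => ?_
    rcases eq_or_ne u [] with rfl | hu
    · have : j ≠ 0 := fun e => hy (by simp [e])
      simp [virM_nil, this, s.small.zero_mem]
    · refine s.mul_mem_small ?_ (ih v (fun h => hy (by simp [h])) ?_)
      · have := s.virM_mem j j le_rfl u
        rwa [← mul_assoc] at this
      · have h1 := huv.length_eq
        have h2 := List.length_pos_iff.2 hu
        simp at h1 h
        omega

/-- The leading part of the norm of a descendant. -/
def normProd : List ℕ → K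
  | [] => 1
  | j :: y => (y.count j + 1) * s.norm j * normProd y

/-- Modulo `ε` the factor `μ` must take exactly one letter: none gives `μ [] = 0`, two or more leave
a word on which `g` is small. This letter has to be a `j`, and there are `w.count j` choices. -/
lemma mul_sub_mem_small {μ : Shuffle ℕ K} (hμ : μ ∈ regular ℕ V.ring) (hμ0 : μ [] = 0) (j : ℕ)
    (b : K) (hμ1 : ∀ l, μ [l] = if l = j then b else 0) (w : List ℕ)
    (g h : Shuffle ℕ K) (hh : IsSymm h) (hg : g ∈ regular ℕ V.ring)
    (h1 : ∀ v : List ℕ, v.length + 1 < w.length → g v ∈ s.small)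
    (h2 : ∀ v : List ℕ, v.length + 1 = w.length → g v - h v ∈ s.small) :
    (μ * g) w - w.count j * b * h (w.erase j) ∈ s.small := by
  induction w generalizing g h with
  | nil => simp [hμ0, s.small.zero_mem]
  | cons l w ih =>
    have e1 : (shift l μ * g) w - μ [l] * g w ∈ s.small := by
      have : (shift l μ * g) w - μ [l] * g w = ((shift l μ - μ [l] • 1) * g) w := by
        rw [sub_mul, smul_mul_assoc, one_mul]; rfl
      rw [this]
      refine mul_apply_mem _ _ _ _ fun u v _ _ huv => ?_
      rcases eq_or_ne u [] with rfl | hu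
      · simp [s.small.zero_mem]
      · refine s.mul_mem_small ?_ (h1 v ?_)
        · obtain ⟨a, u, rfl⟩ := List.exists_cons_of_ne_nil hu
          simpa using hμ _
        · have h3 := huv.length_eq
          have h4 := List.length_pos_iff.2 hu
          simp at h3 ⊢
          omega
    have e2 : μ [l] * (g w - h w) ∈ s.small := s.mul_mem_small (hμ _) (h2 w rfl)
    have e3 := ih (shift l g) (shift l h) (hh.shift l) (shift_mem_regular hg l)
      (fun v hv => h1 _ (by simpa using hv)) fun v hv => h2 _ (by simpa using hv)
    have e4 := s.small.add_mem (s.small.add_mem e1 e2) e3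
    convert e4 using 1
    rw [mul_cons, hμ1]
    by_cases hlj : l = j
    · subst hlj
      rw [List.count_cons_self, List.erase_cons_head, if_pos rfl, shift_apply]
      by_cases hw : l ∈ w
      · rw [hh (List.perm_cons_erase hw).symm]
        push_cast; ring
      · rw [List.count_eq_zero_of_not_mem hw]
        push_cast; ring
    · rw [List.count_cons_of_ne hlj, List.erase_cons_tail (by simpa using hlj), if_neg hlj,
        shift_apply]
      ring

-- For equal lengths the leading term contracts each letter of `y` with an equal letter of `w`; the
-- multiplicities accumulate in `normProd`.
open Classical in
lemma normPairing_sub_small (y w : List ℕ) (hy : 0 ∉ y) (h : w.length = y.length) :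
    s.normPairing y w - (if y.Perm w then s.normProd y else 0) ∈ s.small := by
  induction y generalizing w with
  | nil =>
    have : w = [] := List.length_eq_zero_iff.1 h
    subst this
    simp [normPairing, pairingFun_nil, normProd, s.small.zero_mem]
  | cons j y ih =>
    have hj : j ≠ 0 := fun e => hy (by simp [e])
    have hy' : 0 ∉ y := fun h => hy (by simp [h])
    have key := s.mul_sub_mem_small (μ := (s.ε * s.wt j) • virM s.ht s.c j)
      (fun w => by simpa [mul_assoc] using s.virM_mem j j le_rfl w)
      (by simp [virM_nil, hj]) j (s.norm j)
      (fun l => by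
        rw [eval_smul, virM_cons, virM_nil]
        rcases lt_trichotomy j l with h | rfl | h
        · simp [h, h.ne']
        · simp only [lt_irrefl, Nat.sub_self, norm, smul_eq_mul, if_true, if_false, and_self]
          ring
        · simp [not_lt.2 h.le, h.ne, h.ne', Nat.sub_ne_zero_of_lt h]) w (s.normPairing y)
      (fun v => if y.Perm v then s.normProd y else 0)
      (fun v v' hv => by simp [hv.congr_right])
      (s.normPairing_mem y)
      (fun v hv => s.normPairing_small y v hy' (by simp at h; omega))
      (fun v hv => ih v hy' (by simp at h; omega))
    have e1 : (s.ε * s.wt j) • virD j (s.normPairing y) w ∈ s.small :=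
      ⟨s.wt j * virD j (s.normPairing y) w, V.ring.mul_mem (s.wt_mem j)
      (virD_mem j (s.normPairing_mem y) w), (mul_assoc _ _ _).symm⟩
    have e2 := s.small.add_mem e1 key
    convert e2 using 1
    rw [normPairing_cons, eval_add, eval_smul, add_sub_assoc]
    congr 2
    by_cases hp : (j :: y).Perm w
    · have hp' := List.cons_perm_iff_perm_erase.1 hp
      rw [if_pos hp, if_pos hp'.2, ← hp.count_eq, List.count_cons_self, normProd]
      push_cast; ring
    · rw [if_neg hp]
      by_cases hjw : j ∈ w
      · have : ¬ y.Perm (w.erase j) := fun h => hp (List.cons_perm_iff_perm_erase.2 ⟨hjw, h⟩)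
        rw [if_neg this, mul_zero]
      · rw [List.count_eq_zero_of_not_mem hjw]
        simp

lemma normProd_mem (y : List ℕ) (hy : 0 ∉ y) :
    ∃ h : s.normProd y ∈ V.ring, V.res ⟨_, h⟩ ≠ 0 := by
  induction y with
  | nil => exact ⟨V.ring.one_mem, by
      have : (⟨(1 : K), V.ring.one_mem⟩ : V.ring) = 1 := rfl
      simp only [normProd]
      rw [this, map_one]; exact one_ne_zero⟩
  | cons j y ih =>
    obtain ⟨h1, h2⟩ := ih fun h => hy (by simp [h])
    obtain ⟨h3, h4⟩ := s.unit j (by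
      rcases Nat.eq_zero_or_pos j with rfl | h
      · simp at hy
      · exact h)
    have e : (((y.count j + 1 : ℕ) : V.ring) * ⟨_, h3⟩ * ⟨_, h1⟩ : V.ring).1 =
        s.normProd (j :: y) := by
      simp [normProd, norm, wt]
    refine ⟨e ▸ Subtype.property _, ?_⟩
    have e' : (⟨s.normProd (j :: y), e ▸ Subtype.property _⟩ : V.ring) =
        ((y.count j + 1 : ℕ) : V.ring) * ⟨_, h3⟩ * ⟨_, h1⟩ := Subtype.ext e.symm
    rw [e', map_mul, map_mul, map_natCast]
    exact mul_ne_zero (mul_ne_zero (Nat.cast_ne_zero.2 (Nat.succ_ne_zero _)) h4) h2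

/-- The Gram matrix with normalized rows. -/
noncomputable def normGram (n : ℕ) : Matrix n.Partition n.Partition K :=
  Matrix.of fun p q => s.normPairing (word p) (word q)

end Scaling

lemma word_sum {n : ℕ} (p : n.Partition) : (word p).sum = n := by
  have : ((word p : List ℕ) : Multiset ℕ) = p.parts := Multiset.sort_eq _ _
  rw [← Multiset.sum_coe, this, p.parts_sum]

lemma zero_notMem_word {n : ℕ} (p : n.Partition) : 0 ∉ word p := fun h => by
  rw [word, Multiset.mem_sort] at h
  exact (p.parts_pos h).ne rfl

lemma word_pairwise {n : ℕ} (p : n.Partition) : (word p).Pairwise (· ≥ ·) :=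
  Multiset.pairwise_sort _ _

lemma word_perm_iff {n : ℕ} {p q : n.Partition} : (word p).Perm (word q) ↔ p = q := by
  refine ⟨fun h => ?_, fun h => h ▸ List.Perm.refl _⟩
  rw [← Multiset.coe_eq_coe, word, word, Multiset.sort_eq, Multiset.sort_eq] at h
  exact Nat.Partition.ext h

namespace Scaling

variable [CharZero k] {V : Residue K k} (s : Scaling V)

lemma normGram_mem (n : ℕ) (p q : n.Partition) : s.normGram n p q ∈ V.ring :=
  s.normPairing_mem _ _

/-- The Gram matrix with normalized rows, over the subring. -/
noncomputable def ringGram (n : ℕ) : Matrix n.Partition n.Partition V.ring :=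
  Matrix.of fun p q => ⟨s.normGram n p q, s.normGram_mem n p q⟩

/-- The residue matrix is block triangular for the number of parts, its diagonal blocks are
diagonal, and the diagonal entries are products of unit norms and multiplicities. -/
lemma res_det_ringGram (n : ℕ) : V.res (s.ringGram n).det ≠ 0 := by
  rw [RingHom.map_det]
  set M := V.res.mapMatrix (s.ringGram n) with hM
  have hlen : ∀ p q : n.Partition, (word q).length < (word p).length → M p q = 0 := fun p q h =>
    s.res_small (s.normPairing_small _ _ (zero_notMem_word p) h)
  have hoff : ∀ p q : n.Partition, (word q).length = (word p).length → p ≠ q → M p q = 0 :=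
    fun p q h hpq => by
      have := s.normPairing_sub_small _ _ (zero_notMem_word p) h
      rw [if_neg (word_perm_iff.not.2 hpq), sub_zero] at this
      exact s.res_small this
  have hdiag : ∀ p : n.Partition, M p p ≠ 0 := fun p => by
    have := s.normPairing_sub_small _ _ (zero_notMem_word p) (rfl : (word p).length = _)
    rw [if_pos (List.Perm.refl _)] at this
    obtain ⟨h1, h2⟩ := s.normProd_mem _ (zero_notMem_word p)
    have e : s.ringGram n p p = ⟨_, s.small_le this⟩ + ⟨_, h1⟩ :=
      Subtype.ext (sub_add_cancel _ _).symm
    change V.res (s.ringGram n p p) ≠ 0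
    rw [e, map_add, s.res_small this, zero_add]
    exact h2
  have hM' : M.BlockTriangular fun p => (word p).length := fun p q h => hlen p q h
  rw [hM'.det, Finset.prod_ne_zero_iff]
  intro a _
  have : M.toSquareBlock (fun p => (word p).length) a =
      Matrix.diagonal fun p => M p.1 p.1 := by
    ext p q
    rw [Matrix.toSquareBlock_def, Matrix.of_apply]
    by_cases hpq : p = q
    · subst hpq; rw [Matrix.diagonal_apply_eq]
    · rw [Matrix.diagonal_apply_ne _ hpq]
      exact hoff _ _ (q.2.trans p.2.symm) fun e => hpq (Subtype.ext e)
  rw [this, Matrix.det_diagonal, Finset.prod_ne_zero_iff]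
  exact fun p _ => hdiag p.1

lemma det_normGram (n : ℕ) : (s.normGram n).det = ((s.ringGram n).det : K) := by
  have := RingHom.map_det V.ring.subtype (s.ringGram n)
  exact this.symm

lemma det_normGram_ne (n : ℕ) : (s.normGram n).det ≠ 0 := by
  rw [det_normGram]
  intro h
  apply s.res_det_ringGram n
  rw [Subtype.ext (a2 := (0 : V.ring)) h, map_zero]

/-- A vector which is mapped into the lattice by the normalized Gram matrix lies in it. -/
lemma mem_of_vecMul_mem (n : ℕ) (x : n.Partition → K)
    (h : ∀ q, ∑ p, x p * s.normGram n p q ∈ V.ring) (p : n.Partition) : x p ∈ V.ring := by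
  have h1 : Matrix.vecMul x (s.normGram n * (s.normGram n).adjugate) p =
      (s.normGram n).det * x p := by
    rw [Matrix.mul_adjugate, Matrix.vecMul_smul, Matrix.vecMul_one, Pi.smul_apply, smul_eq_mul]
  rw [← Matrix.vecMul_vecMul] at h1
  have h2 : (s.normGram n).adjugate = V.ring.subtype.mapMatrix (s.ringGram n).adjugate := by
    rw [RingHom.map_adjugate]; rfl
  have h3 : (s.normGram n).det * x p ∈ V.ring := by
    rw [← h1, h2, Matrix.vecMul, dotProduct]
    exact V.ring.sum_mem fun q _ => V.ring.mul_mem (h q) (Subtype.property _)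
  have h4 : x p = ((s.normGram n).det)⁻¹ * ((s.normGram n).det * x p) := by
    rw [inv_mul_cancel_left₀ (s.det_normGram_ne n)]
  rw [h4]
  refine V.ring.mul_mem ?_ h3
  rw [det_normGram]
  exact V.inv_mem _ (s.res_det_ringGram n)

lemma normGram_eq (n : ℕ) : s.normGram n =
    Matrix.diagonal (fun p : n.Partition => s.ε ^ (word p).length * ((word p).map s.wt).prod) *
      gram s.ht s.c n := by
  ext p q
  rw [Matrix.diagonal_mul]
  rfl

lemma det_gram_ne (n : ℕ) : (gram s.ht s.c n).det ≠ 0 := by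
  intro h
  apply s.det_normGram_ne n
  rw [normGram_eq, Matrix.det_mul, h, mul_zero]

end Scaling

end ClassicalBlock

end

/-! ### Weighted sums over partitions; Euler operator on power series -/

section

open PowerSeries

namespace ClassicalBlock

open Shuffle

/-! ### Sums over partitions -/

/-- The order of the group of permutations which preserve a multiset. -/
def symFactor (m : Multiset ℕ) : ℕ := ∏ l ∈ m.toFinset, (m.count l).factorial

lemma symFactor_ne_zero (m : Multiset ℕ) : symFactor m ≠ 0 :=
  Finset.prod_ne_zero_iff.2 fun _ _ => Nat.factorial_ne_zero _

lemma symFactor_eq_prod (m : Multiset ℕ) (s : Finset ℕ) (h : m.toFinset ⊆ s) :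
    symFactor m = ∏ l ∈ s, (m.count l).factorial := by
  refine Finset.prod_subset h fun l _ hl => ?_
  rw [Multiset.mem_toFinset] at hl
  rw [Multiset.count_eq_zero_of_notMem hl, Nat.factorial_zero]

lemma symFactor_cons (l : ℕ) (m : Multiset ℕ) :
    symFactor (l ::ₘ m) = (m.count l + 1) * symFactor m := by
  have hm : m.toFinset ⊆ (l ::ₘ m).toFinset := by simp
  rw [symFactor_eq_prod m _ hm, symFactor,
    ← Finset.mul_prod_erase _ _ (Multiset.mem_toFinset.2 (Multiset.mem_cons_self l m)),
    ← Finset.mul_prod_erase (l ::ₘ m).toFinset _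
      (Multiset.mem_toFinset.2 (Multiset.mem_cons_self l m)), ← mul_assoc,
    Multiset.count_cons_self, Nat.factorial_succ]
  congr 1
  refine Finset.prod_congr rfl fun x hx => ?_
  rw [Multiset.count_cons_of_ne (Finset.ne_of_mem_erase hx)]

section PartitionSum

variable {K M : Type*} [Field K] [CharZero K] [AddCommGroup M] [Module K M]

/-- The weight of a descendant in the pairing of two exponentials. -/
noncomputable def weight (ε : K) (m : Multiset ℕ) : K := ε ^ (Multiset.card m) / symFactor m

lemma weight_cons (ε : K) (l : ℕ) (m : Multiset ℕ) :
    (m.count l + 1 : K) * weight ε (l ::ₘ m) = ε * weight ε m := by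
  have h1 : (symFactor m : K) ≠ 0 := Nat.cast_ne_zero.2 (symFactor_ne_zero m)
  have h2 : (m.count l + 1 : K) ≠ 0 := Nat.cast_add_one_ne_zero _
  rw [weight, weight, symFactor_cons, Multiset.card_cons]
  push_cast
  rw [pow_succ]
  field_simp

lemma weight_ne_zero {ε : K} (hε : ε ≠ 0) (m : Multiset ℕ) : weight ε m ≠ 0 :=
  div_ne_zero (pow_ne_zero _ hε) (Nat.cast_ne_zero.2 (symFactor_ne_zero m))

lemma sum_partition_cons (n l : ℕ) (h1 : 1 ≤ l) (hl : l ≤ n) (G : Multiset ℕ → M)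
    (hG : ∀ m : Multiset ℕ, l ∉ m → G m = 0) :
    ∑ q : (n - l).Partition, G (l ::ₘ q.parts) = ∑ q : n.Partition, G q.parts := by
  classical
  rw [← Finset.sum_filter_of_ne (s := Finset.univ) (p := fun q : n.Partition => l ∈ q.parts)
    fun q _ hq => by by_contra h; exact hq (hG _ h)]
  refine Finset.sum_bij' (fun q _ => ⟨l ::ₘ q.parts, ?_, ?_⟩)
    (fun q hq => ⟨q.parts.erase l, ?_, ?_⟩) ?_ ?_ ?_ ?_ ?_
  · intro i hi
    rcases Multiset.mem_cons.1 hi with rfl | hi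
    exacts [h1, q.parts_pos hi]
  · rw [Multiset.sum_cons, q.parts_sum]; omega
  · intro i hi
    exact q.parts_pos (Multiset.mem_of_mem_erase hi)
  · have h2 := Multiset.sum_erase (Finset.mem_filter.1 hq).2
    rw [q.parts_sum] at h2; omega
  · intro q _; simp
  · intro q _; simp
  · intro q _; ext1; simp
  · intro q hq
    ext1
    exact Multiset.cons_erase (Finset.mem_filter.1 hq).2
  · intro q _; rfl

/-- The recursion for weighted sums over partitions. -/
lemma nsmul_sum_partition (ε : K) (n : ℕ) (F : List ℕ → M)
    (hF : ∀ w w' : List ℕ, w.Perm w' → F w = F w') :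
    (n : K) • ∑ q : n.Partition, weight ε q.parts • F (word q) =
      ∑ l ∈ Finset.Icc 1 n, (l : K) • ∑ q : (n - l).Partition,
        weight ε q.parts • ε • F (l :: word q) := by
  set G : ℕ → Multiset ℕ → M := fun l m =>
    ((l : K) * m.count l) • weight ε m • F (m.sort (· ≥ ·)) with hGdef
  have h1 : ∀ l ∈ Finset.Icc 1 n, (l : K) • ∑ q : (n - l).Partition,
      weight ε q.parts • ε • F (l :: word q) = ∑ q : n.Partition, G l q.parts := by
    intro l hl
    obtain ⟨hl1, hln⟩ := Finset.mem_Icc.1 hl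
    rw [← sum_partition_cons n l hl1 hln (G l) fun m hm => by
      simp [hGdef, Multiset.count_eq_zero_of_notMem hm], Finset.smul_sum]
    refine Finset.sum_congr rfl fun q _ => ?_
    have h2 : F ((l ::ₘ q.parts).sort (· ≥ ·)) = F (l :: word q) := by
      refine hF _ _ ?_
      rw [← Multiset.coe_eq_coe, Multiset.sort_eq, ← Multiset.cons_coe, word, Multiset.sort_eq]
    simp only [hGdef, h2, Multiset.count_cons_self, smul_smul]
    congr 1
    rw [mul_comm (weight ε q.parts), ← weight_cons ε l]
    push_cast; ring
  rw [Finset.sum_congr rfl h1, Finset.sum_comm, Finset.smul_sum]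
  refine Finset.sum_congr rfl fun q _ => ?_
  simp only [hGdef, ← Finset.sum_smul]
  congr 1
  -- The factor `n` is distributed over the parts of `q`; a part `l` contributes `l` for each
  -- occurrence, and removing one occurrence gives the sum over partitions of `n - l`.
  have h3 : q.parts.sum = ∑ l ∈ Finset.Icc 1 n, q.parts.count l * l := by
    rw [Finset.sum_multiset_count]
    simp only [smul_eq_mul]
    refine Finset.sum_subset (fun l hl => ?_) fun l _ hl => ?_
    · rw [Multiset.mem_toFinset] at hl
      exact Finset.mem_Icc.2 ⟨q.parts_pos hl, by
        conv_rhs => rw [← q.parts_sum]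
        exact Multiset.single_le_sum (by simp) _ hl⟩
    · rw [Multiset.mem_toFinset] at hl
      rw [Multiset.count_eq_zero_of_notMem hl, zero_mul]
  conv_lhs => rw [← q.parts_sum, h3]
  push_cast
  exact Finset.sum_congr rfl fun l _ => mul_comm _ _

end PartitionSum

/-! ### Power series -/

section Series

variable {K R : Type*} [Field K] [CommRing R] [Algebra K R]

lemma coeff_base_smul (a : K) (f : R⟦X⟧) (n : ℕ) : coeff n (a • f) = a • coeff n f := rfl

/-- The derivation `X d/dX`. -/
noncomputable def eulerD (K : Type*) {R : Type*} [Field K] [CommRing R] [Algebra K R] :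
    Derivation K R⟦X⟧ R⟦X⟧ :=
  Derivation.mk'
    { toFun := fun f => PowerSeries.mk fun n => n • coeff n f
      map_add' := fun f g => by ext n; simp
      map_smul' := fun a f => by ext n; simp }
    fun f g => by
      ext n
      simp only [LinearMap.coe_mk, AddHom.coe_mk, coeff_mk, smul_eq_mul, map_add, coeff_mul,
        Finset.smul_sum]
      rw [← Finset.Nat.sum_antidiagonal_swap (f := fun p => coeff p.1 g * (p.2 • coeff p.2 f)),
        ← Finset.sum_add_distrib]
      refine Finset.sum_congr rfl fun p hp => ?_
      rw [← Finset.HasAntidiagonal.mem_antidiagonal.1 hp]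
      simp only [Prod.fst_swap, Prod.snd_swap, nsmul_eq_mul]
      push_cast; ring

@[simp] lemma coeff_eulerD (f : R⟦X⟧) (n : ℕ) : coeff n (eulerD K f) = n • coeff n f := by
  change coeff n (PowerSeries.mk fun n => n • coeff n f) = _
  rw [coeff_mk]

/-- The sum `∑ l Xˡ v_l`. -/
noncomputable def levelSum (v : ℕ → R⟦X⟧) : R⟦X⟧ :=
  PowerSeries.mk fun n => ∑ l ∈ Finset.Icc 1 n, l • coeff (n - l) (v l)

lemma coeff_levelSum (v : ℕ → R⟦X⟧) (n : ℕ) :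
    coeff n (levelSum v) = ∑ l ∈ Finset.Icc 1 n, l • coeff (n - l) (v l) := coeff_mk _ _

lemma coeff_levelSum_eq (v : ℕ → R⟦X⟧) (n N : ℕ) (h : n ≤ N) :
    coeff n (levelSum v) = coeff n (∑ l ∈ Finset.Icc 1 N, l • (X ^ l * v l)) := by
  rw [coeff_levelSum, map_sum]
  have : Finset.Icc 1 n ⊆ Finset.Icc 1 N := Finset.Icc_subset_Icc_right h
  rw [← Finset.sum_subset this]
  · refine Finset.sum_congr rfl fun l hl => ?_
    rw [map_nsmul, coeff_X_pow_mul', if_pos (Finset.mem_Icc.1 hl).2]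
  · intro l hl hl'
    rw [map_nsmul, coeff_X_pow_mul', if_neg fun h => hl' (Finset.mem_Icc.2
      ⟨(Finset.mem_Icc.1 hl).1, h⟩), smul_zero]

lemma levelSum_mul (v : ℕ → R⟦X⟧) (f : R⟦X⟧) :
    levelSum (fun l => v l * f) = levelSum v * f := by
  ext n
  rw [coeff_levelSum_eq _ n n le_rfl, coeff_mul]
  have : ∀ p ∈ Finset.HasAntidiagonal.antidiagonal n, coeff p.1 (levelSum v) * coeff p.2 f =
      coeff p.1 (∑ l ∈ Finset.Icc 1 n, l • (X ^ l * v l)) * coeff p.2 f := fun p hp => by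
    rw [coeff_levelSum_eq v p.1 n (Finset.HasAntidiagonal.antidiagonal.fst_le hp)]
  rw [Finset.sum_congr rfl this, ← coeff_mul, Finset.sum_mul]
  simp only [smul_mul_assoc, mul_assoc]

lemma levelSum_add (v v' : ℕ → R⟦X⟧) :
    levelSum (fun l => v l + v' l) = levelSum v + levelSum v' := by
  ext n
  simp [coeff_levelSum, Finset.sum_add_distrib]

lemma levelSum_smul (a : K) (v : ℕ → R⟦X⟧) :
    levelSum (fun l => a • v l) = a • levelSum v := by
  ext n
  simp [coeff_levelSum, Finset.smul_sum]

/-- The power series whose coefficients of degree less than `n` lie in a subring. -/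
def truncSubring (R₀ : Subring R) (n : ℕ) : Subring R⟦X⟧ where
  carrier := {f | ∀ j < n, coeff j f ∈ R₀}
  mul_mem' := fun {f g} hf hg j hj => by
    rw [coeff_mul]
    refine R₀.sum_mem fun p hp => R₀.mul_mem (hf _ ?_) (hg _ ?_)
    · exact (Finset.HasAntidiagonal.antidiagonal.fst_le hp).trans_lt hj
    · exact (Finset.HasAntidiagonal.antidiagonal.snd_le hp).trans_lt hj
  one_mem' := fun j _ => by
    rw [coeff_one]; split_ifs; exacts [R₀.one_mem, R₀.zero_mem]
  add_mem' := fun hf hg j hj => by rw [map_add]; exact R₀.add_mem (hf j hj) (hg j hj)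
  zero_mem' := fun j _ => by rw [map_zero]; exact R₀.zero_mem
  neg_mem' := fun hf j hj => by rw [map_neg]; exact R₀.neg_mem (hf j hj)

variable {ι : Type*}

/-- `levelSum` for functions of words. -/
noncomputable def levelSumFun (v : ℕ → Shuffle ι R⟦X⟧) : Shuffle ι R⟦X⟧ :=
  fun w => levelSum fun l => v l w

lemma levelSumFun_mul (v : ℕ → Shuffle ι R⟦X⟧) (f : Shuffle ι R⟦X⟧) :
    levelSumFun (fun l => v l * f) = levelSumFun v * f := by
  ext1 w
  induction w generalizing v f with
  | nil => exact levelSum_mul _ _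
  | cons i w ih =>
    rw [mul_cons]
    change levelSum (fun l => (shift i (v l) * f) w + (v l * shift i f) w) = _
    rw [levelSum_add]
    exact congrArg₂ (· + ·) (ih _ _) (ih _ _)

end Series

end ClassicalBlock

end

/-! ### Contraction of exponentials by the heat kernel -/

section

open PowerSeries

namespace ClassicalBlock

open Shuffle

section Heat

variable {R : Type*} [CommRing R]

/-- The letters of the first alphabet. -/
def lefts : List (ℕ ⊕ ℕ) → List ℕ
  | [] => []
  | .inl l :: w => l :: lefts w
  | .inr _ :: w => lefts w

/-- The letters of the second alphabet. -/
def rights : List (ℕ ⊕ ℕ) → List ℕ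
  | [] => []
  | .inl _ :: w => rights w
  | .inr l :: w => l :: rights w

/-- The tensor product of two functions of words. -/
def tensor (f g : Shuffle ℕ R) : Shuffle (ℕ ⊕ ℕ) R := fun w => f (lefts w) * g (rights w)

lemma shift_inl_tensor (l : ℕ) (f g : Shuffle ℕ R) :
    shift (.inl l) (tensor f g) = tensor (shift l f) g := rfl

lemma shift_inr_tensor (l : ℕ) (f g : Shuffle ℕ R) :
    shift (.inr l) (tensor f g) = tensor f (shift l g) := rfl

lemma tensor_add_left (f f' g : Shuffle ℕ R) :
    tensor (f + f') g = tensor f g + tensor f' g := by ext w; simp [tensor, add_mul]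

lemma tensor_add_right (f g g' : Shuffle ℕ R) :
    tensor f (g + g') = tensor f g + tensor f g' := by ext w; simp [tensor, mul_add]

lemma tensor_zero_left (g : Shuffle ℕ R) : tensor 0 g = 0 := by ext w; simp [tensor]

lemma tensor_zero_right (f : Shuffle ℕ R) : tensor f 0 = 0 := by ext w; simp [tensor]

lemma tensor_one_mul (a f g : Shuffle ℕ R) : tensor a 1 * tensor f g = tensor (a * f) g := by
  ext w
  induction w generalizing a f g with
  | nil =>
    change a [] * 1 * (f [] * g []) = a [] * f [] * g []
    ring
  | cons i w ih =>
    rw [mul_cons]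
    cases i with
    | inl l =>
      rw [shift_inl_tensor, shift_inl_tensor, ih, ih, ← eval_add, ← tensor_add_left, ← shift_mul]
      rfl
    | inr l =>
      rw [shift_inr_tensor, shift_inr_tensor, shift_one, tensor_zero_right, zero_mul, eval_zero,
        zero_add, ih]
      rfl

lemma one_tensor_mul (a f g : Shuffle ℕ R) : tensor 1 a * tensor f g = tensor f (a * g) := by
  ext w
  induction w generalizing a f g with
  | nil =>
    change 1 * a [] * (f [] * g []) = f [] * (a [] * g [])
    ring
  | cons i w ih =>
    rw [mul_cons]
    cases i with
    | inl l =>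
      rw [shift_inl_tensor, shift_inl_tensor, shift_one, tensor_zero_left, zero_mul, eval_zero,
        zero_add, ih]
      rfl
    | inr l =>
      rw [shift_inr_tensor, shift_inr_tensor, ih, ih, ← eval_add, ← tensor_add_right, ← shift_mul]
      rfl

variable {K : Type*} [Field K] [CharZero K] [Algebra K R]

/-- The generating function of the values of `f` at partitions. -/
noncomputable def partitionSeries (ε : K) (F : List ℕ → R) : R⟦X⟧ :=
  PowerSeries.mk fun n => ∑ q : n.Partition, weight ε q.parts • F (word q)

lemma coeff_partitionSeries (ε : K) (F : List ℕ → R) (n : ℕ) :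
    coeff n (partitionSeries ε F) = ∑ q : n.Partition, weight ε q.parts • F (word q) :=
  coeff_mk _ _

lemma constantCoeff_partitionSeries (ε : K) (F : List ℕ → R) :
    constantCoeff (partitionSeries ε F) = F [] := by
  rw [← coeff_zero_eq_constantCoeff_apply, coeff_partitionSeries]
  have : (default : Nat.Partition 0).parts = 0 := by
    rw [Multiset.eq_zero_iff_forall_notMem]
    intro a ha
    have h1 := (default : Nat.Partition 0).parts_pos ha
    have h2 := Multiset.single_le_sum (by simp) _ ha
    rw [Nat.Partition.parts_sum] at h2
    omega
  rw [Fintype.sum_unique, word, this]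
  simp [weight, symFactor]

/-- The generating function of all derivatives of a product of two functions, evolved by the heat
kernel. -/
noncomputable def heat (ε : K) (A W : Shuffle ℕ R) : Shuffle (ℕ ⊕ ℕ) R⟦X⟧ :=
  fun w => partitionSeries ε fun q => A (q ++ lefts w) * W (q ++ rights w)

/-- The heat equation `z ∂_z Z = ∑ l z ^ l ε ∂_l ∂'_l Z`: the Euler operator singles out one part
`l` of the summed partition, which by symmetry may be moved into both words. -/
lemma eulerD_heat (ε : K) {A W : Shuffle ℕ R} (hA : IsSymm A) (hW : IsSymm W) :
    coeffD (eulerD K) (heat ε A W) =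
      levelSumFun fun l => ε • shift (.inl l) (shift (.inr l) (heat ε A W)) := by
  ext1 w
  ext n
  rw [coeffD_apply, coeff_eulerD, levelSumFun, coeff_levelSum]
  have key := nsmul_sum_partition ε n (fun q => A (q ++ lefts w) * W (q ++ rights w))
    fun u v h => by rw [hA (h.append_right _), hW (h.append_right _)]
  rw [Nat.cast_smul_eq_nsmul] at key
  rw [heat, coeff_partitionSeries, key]
  refine Finset.sum_congr rfl fun l _ => ?_
  rw [Nat.cast_smul_eq_nsmul]
  congr 1
  change _ = coeff (n - l) (ε • heat ε A W (.inr l :: .inl l :: w))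
  rw [heat, coeff_base_smul, coeff_partitionSeries, Finset.smul_sum]
  refine Finset.sum_congr rfl fun q _ => ?_
  rw [smul_comm ε]
  congr 2
  rw [hA (show (l :: word q ++ lefts w).Perm (word q ++ lefts (.inr l :: .inl l :: w)) from
    List.perm_middle.symm), hW (show (l :: word q ++ rights w).Perm
      (word q ++ rights (.inr l :: .inl l :: w)) from List.perm_middle.symm)]

/-- The pairing of two exponentials is an exponential. -/
theorem exists_eulerD_partitionSeries {ε : K} (hε : ε ≠ 0) (R₀ : Subring R)
    (hεR : ∀ x ∈ R₀, ε • x ∈ R₀) (hR : ∀ (n : ℕ), ∀ x ∈ R₀, (n : K)⁻¹ • x ∈ R₀)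
    {SA SW : Shuffle ℕ R} (hA : IsSymm (expo SA)) (hW : IsSymm (expo SW))
    (hSA : ε • SA ∈ regular ℕ R₀) (hSW : ε • SW ∈ regular ℕ R₀) :
    ∃ r : R⟦X⟧, (∀ n, coeff n r ∈ R₀) ∧
      ε • eulerD K (partitionSeries ε fun q => expo SA q * expo SW q) =
        r * partitionSeries ε fun q => expo SA q * expo SW q := by
  set A := expo SA
  set W := expo SW
  set Z := heat ε A W with hZdef
  have hZnil : Z [] = partitionSeries ε fun q => A q * W q := by
    simp [hZdef, heat, lefts, rights]
  have hZ0 : constantCoeff (Z []) = ((1 : Rˣ) : R) := by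
    rw [hZnil, constantCoeff_partitionSeries]; simp [A, W]
  obtain ⟨Y, hY, -⟩ := exists_mul_eq_one (f := Z) (mul_invOfUnit (Z []) 1 hZ0)
  -- The Hopf–Cole variables `ε ∂_i log Z`, where `Y = 1 / Z`.
  set s : ℕ ⊕ ℕ → Shuffle (ℕ ⊕ ℕ) R⟦X⟧ := fun i => ε • shift i Z * Y
  have hs : ∀ i, ε • shift i Z = s i * Z := fun i => by
    rw [mul_assoc, mul_comm Y, hY, mul_one]
  set v : ℕ → Shuffle (ℕ ⊕ ℕ) R⟦X⟧ := fun l =>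
    ε • shift (.inl l) (s (.inr l)) + s (.inl l) * s (.inr l)
  have hv : ∀ l, ε • (ε • shift (.inl l) (shift (.inr l) Z)) = v l * Z := fun l => by
    rw [← shift_smul, hs, shift_mul, smul_add, ← mul_smul_comm (s := ε) (x := s (.inr l)), hs,
      add_mul, smul_mul_assoc]
    ring
  have hθ : ε • coeffD (eulerD K) Z = levelSumFun v * Z := by
    rw [eulerD_heat ε hA hW, ← levelSumFun_mul]
    ext1 w
    refine (levelSum_smul ε _).symm.trans ?_
    exact congrArg levelSum (funext fun l => congrFun (hv l) w)
  -- The Burgers equation: the Euler operator and `∂_i` commute, so both sides are mixed derivatives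
  -- of `ε log Z`. With `v` written in terms of `s`, no negative power of `ε` remains.
  have hshift : ∀ i, coeffD (eulerD K) (s i) = shift i (levelSumFun v) := fun i => by
    have e1 : coeffD (eulerD K) (ε • shift i Z) =
        shift i (levelSumFun v) * Z + levelSumFun v * shift i Z := by
      rw [Derivation.map_smul, ← shift_mul, ← hθ]; rfl
    rw [hs, Derivation.leibniz, smul_eq_mul, smul_eq_mul] at e1
    have e2 : ε • ((coeffD (eulerD K) (s i) - shift i (levelSumFun v)) * Z) = 0 := by
      have e3 : (coeffD (eulerD K) (s i) - shift i (levelSumFun v)) * Z =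
          levelSumFun v * shift i Z - s i * coeffD (eulerD K) Z := by
        rw [sub_mul, sub_eq_sub_iff_add_eq_add, mul_comm (coeffD (eulerD K) (s i))]
        linear_combination e1
      rw [e3, smul_sub, ← mul_smul_comm, ← mul_smul_comm, hs, hθ]
      ring
    have e4 : (coeffD (eulerD K) (s i) - shift i (levelSumFun v)) * Z = 0 := by
      have := congrArg (fun x => ε⁻¹ • x) e2
      simpa [smul_smul, hε] using this
    have e5 := congrArg (· * Y) e4
    rw [← sub_eq_zero]
    simpa [mul_assoc, hY] using e5
  -- the coefficients of `s` are regular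
  have hreg : ∀ n i, s i ∈ regular (ℕ ⊕ ℕ) (truncSubring R₀ n) := by
    have hsm : ∀ n, ∀ x ∈ truncSubring R₀ n, ε • x ∈ truncSubring R₀ n := fun n x hx j hj => by
      rw [coeff_base_smul]; exact hεR _ (hx j hj)
    intro n
    induction n with
    | zero => exact fun i w j hj => absurd hj (Nat.not_lt_zero _)
    | succ n ih =>
      intro i w j hj
      rcases Nat.lt_or_ge j n with h | h
      · exact ih i w j h
      obtain rfl : j = n := by omega
      rcases Nat.eq_zero_or_pos j with rfl | hj0
      -- The initial value: at `z = 0` the function `Z` is the tensor product of `A` and `W`, so `s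
      -- i` is `ε` times a derivative of `SA` or `SW`.
      · have e0 : mapHom constantCoeff Z = tensor A W := by
          ext1 u
          rw [mapHom_apply, hZdef, heat, constantCoeff_partitionSeries]
          rfl
        have e1 : mapHom constantCoeff (shift i Z) = shift i (tensor A W) := by rw [← e0]; rfl
        have e2 : mapHom constantCoeff (ε • shift i Z) = ε • mapHom constantCoeff (shift i Z) := by
          ext1 u
          rfl
        have e3 : ∃ t ∈ regular (ℕ ⊕ ℕ) R₀, ε • shift i (tensor A W) = t * tensor A W := by
          cases i with
          | inl l =>
            refine ⟨tensor (ε • shift l SA) 1, fun u => R₀.mul_mem (hSA _) ?_, ?_⟩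
            · exact (regular ℕ R₀).one_mem _
            · rw [tensor_one_mul, shift_inl_tensor, shift_expo, smul_mul_assoc]
              ext1 u
              exact (smul_mul_assoc ε ((shift l SA * A) (lefts u)) (W (rights u))).symm
          | inr l =>
            refine ⟨tensor 1 (ε • shift l SW), fun u => R₀.mul_mem ?_ (hSW _), ?_⟩
            · exact (regular ℕ R₀).one_mem _
            · rw [one_tensor_mul, shift_inr_tensor, shift_expo, smul_mul_assoc]
              ext1 u
              exact (mul_smul_comm ε (A (lefts u)) ((shift l SW * W) (rights u))).symm
        obtain ⟨t, ht, htA⟩ := e3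
        have e4 : mapHom constantCoeff (s i) = t := by
          change mapHom constantCoeff (ε • shift i Z * Y) = t
          rw [map_mul, e2, e1, htA, ← e0, mul_assoc, ← map_mul, hY, map_one, mul_one]
        rw [coeff_zero_eq_constantCoeff_apply]
        have := ht w
        rwa [← e4] at this
      · have hvreg : ∀ l, v l ∈ regular (ℕ ⊕ ℕ) (truncSubring R₀ j) := fun l =>
          Subring.add_mem _ (fun u => hsm j _ (ih _ _)) (Subring.mul_mem _ (ih _) (ih _))
        -- Every term of `levelSum` carries `X ^ l` with `l ≥ 1`, so the coefficient of degree `j`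
        -- only involves `s` in degrees below `j`.
        have e1 : j • coeff j (s i w) ∈ R₀ := by
          rw [← coeff_eulerD (K := K), ← coeffD_apply, hshift]
          change coeff j (levelSum fun l => v l (i :: w)) ∈ R₀
          rw [coeff_levelSum]
          refine R₀.sum_mem fun l hl => nsmul_mem (hvreg l _ _ ?_) _
          have := Finset.mem_Icc.1 hl
          omega
        have e2 := hR j _ e1
        rwa [← Nat.cast_smul_eq_nsmul K, smul_smul,
          inv_mul_cancel₀ (Nat.cast_ne_zero.2 hj0.ne'), one_smul] at e2
  refine ⟨levelSumFun v [], fun n => ?_, ?_⟩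
  · change coeff n (levelSum fun l => v l []) ∈ R₀
    rw [coeff_levelSum]
    refine R₀.sum_mem fun l hl => nsmul_mem ?_ _
    have hsm : ∀ x ∈ truncSubring R₀ (n + 1), ε • x ∈ truncSubring R₀ (n + 1) :=
      fun x hx j hj => by rw [coeff_base_smul]; exact hεR _ (hx j hj)
    have : v l ∈ regular (ℕ ⊕ ℕ) (truncSubring R₀ (n + 1)) :=
      Subring.add_mem _ (fun u => hsm _ (hreg _ _ _)) (Subring.mul_mem _ (hreg _ _) (hreg _ _))
    exact this [] _ (by omega)
  · rw [← hZnil]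
    exact congrFun hθ []

end Heat

end ClassicalBlock

end

/-! ### Logarithmic derivatives and decomposition by levels -/

section

open PowerSeries

namespace Shuffle

lemma exists_eq_expo {ι R : Type*} [CommRing R] {f : Shuffle ι R} (hf : f [] = 1) :
    ∃ S : Shuffle ι R, S [] = 0 ∧ f = expo S := by
  obtain ⟨g, hg, -⟩ := exists_mul_eq_one (f := f) (b := 1) (by rw [hf, mul_one])
  let S : Shuffle ι R := fun w => match w with
    | [] => 0
    | l :: w => (shift l f * g) w
  have hS : ∀ l, shift l S = shift l f * g := fun l => rfl
  refine ⟨S, rfl, eq_expo hf fun l => ?_⟩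
  rw [hS, mul_assoc, mul_comm g, hg, mul_one]

lemma sum_pos_of_notMem {v : List ℕ} (h : 0 ∉ v) (hv : v ≠ []) : 0 < v.sum := by
  obtain ⟨l, v, rfl⟩ := List.exists_cons_of_ne_nil hv
  have : l ≠ 0 := fun e => h (by simp [e])
  simp; omega

/-- Functions which agree on words of weight less than `n` have exponentials whose difference in
weight `n` is the difference of the functions. -/
lemma expo_sub_expo {R : Type*} [CommRing R] {S S' : Shuffle ℕ R} (n : ℕ)
    (h : ∀ w : List ℕ, w.sum < n → S w = S' w) (h0 : S [] = S' []) (w : List ℕ) (hw0 : 0 ∉ w)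
    (hw : w.sum ≤ n) : expo S w - expo S' w = S w - S' w := by
  induction hm : w.length using Nat.strong_induction_on generalizing w with
  | _ m ih =>
    cases w with
    | nil => simp [h0]
    | cons l w =>
      have hl : l ≠ 0 := fun e => hw0 (by simp [e])
      have hw0' : 0 ∉ w := fun e => hw0 (by simp [e])
      simp only [List.sum_cons, List.length_cons] at hw hm
      have e1 : shift l (expo S) - shift l (expo S') = (shift l S - shift l S') +
          (shift l S - shift l S') * (expo S - 1) + shift l S' * (expo S - expo S') := by
        rw [shift_expo, shift_expo]; ring
      have e2 : ((shift l S - shift l S') * (expo S - 1)) w = 0 := by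
        refine mul_apply_eq_zero _ _ _ fun u v hu hv huv => ?_
        rcases eq_or_ne v [] with rfl | hv0
        · simp
        · have h1 := huv.sum_eq
          have h2 := sum_pos_of_notMem (fun h => hw0' (hv.subset h)) hv0
          have h3 : S (l :: u) = S' (l :: u) := h _ (by simp at h1 ⊢; omega)
          simp [h3]
      have e3 : (shift l S' * (expo S - expo S')) w = 0 := by
        refine mul_apply_eq_zero _ _ _ fun u v hu hv huv => ?_
        have h1 := huv.sum_eq
        have h2 := hv.length_le
        simp only [List.sum_append] at h1
        rw [eval_sub, ih v.length (by omega) v (fun h => hw0' (hv.subset h)) (by omega) rfl,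
          h v (by omega), sub_self, mul_zero]
      have e4 := congrFun e1 w
      rw [eval_add, eval_add, e2, e3, add_zero, add_zero] at e4
      exact e4

end Shuffle

namespace ClassicalBlock

open Shuffle

section Log

variable {R : Type*} [CommRing R] [Algebra ℚ R]

lemma mul_derivative_logOf {f : R⟦X⟧} (hf : constantCoeff f = 1) :
    f * derivative R (logOf f) = derivative R f := by
  have hs : HasSubst (f - 1) := HasSubst.of_constantCoeff_zero' (by simp [hf])
  have h1 : (1 + X) * derivative R (log R) = 1 := by
    rw [deriv_log]
    ext n
    cases n with
    | zero => simp [add_mul]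
    | succ n => simp [add_mul, coeff_succ_X_mul, pow_succ, coeff_one]
  have h2 := congrArg (subst (f - 1)) h1
  rw [← coe_substAlgHom hs, map_mul, map_add, map_one, coe_substAlgHom hs, subst_X hs,
    add_sub_cancel] at h2
  rw [logOf_eq, derivative_subst hs, ← mul_assoc, h2, one_mul, map_sub, derivative_one, sub_zero]

lemma eulerD_eq {K : Type*} [Field K] [Algebra K R] (f : R⟦X⟧) :
    eulerD K f = X * derivative R f := by
  ext n
  rw [coeff_eulerD]
  cases n with
  | zero => simp
  | succ n => rw [coeff_succ_X_mul, coeff_derivative, nsmul_eq_mul, mul_comm]; push_cast; rfl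

lemma mul_eulerD_logOf {K : Type*} [Field K] [Algebra K R] {f : R⟦X⟧}
    (hf : constantCoeff f = 1) : f * eulerD K (logOf f) = eulerD K f := by
  rw [eulerD_eq, eulerD_eq, mul_left_comm, mul_derivative_logOf hf]

end Log

section LogDeriv

variable {K R : Type*} [Field K] [CommRing R] [Algebra K R]

/-- Since both constant terms are `1`, the first order at which two series differ enters their
logarithmic derivatives linearly. This isolates the unknown top level in the induction for the
covector. -/
lemma coeff_logDeriv_sub {ε : K} {f g r r' : R⟦X⟧} (hf : constantCoeff f = 1)
    (hg : constantCoeff g = 1) (hr : ε • eulerD K f = r * f) (hr' : ε • eulerD K g = r' * g)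
    (n : ℕ) (h : ∀ j < n, coeff j f = coeff j g) :
    coeff n r - coeff n r' = n • ε • (coeff n f - coeff n g) := by
  obtain ⟨u, hu⟩ : X ^ n ∣ f - g := X_pow_dvd_iff.2 fun j hj => by rw [map_sub, h j hj, sub_self]
  have h0 : constantCoeff r' = 0 := by
    have := congrArg (coeff 0) hr'
    rw [coeff_base_smul, coeff_eulerD, zero_smul, smul_zero, coeff_zero_eq_constantCoeff_apply,
      map_mul, hg, mul_one] at this
    exact this.symm
  have h1 : (r - r') * f = ε • eulerD K (f - g) - X ^ n * (r' * u) := by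
    have e : X ^ n * (r' * u) = r' * (f - g) := by rw [hu]; ring
    rw [e, map_sub, smul_sub, hr, hr']; ring
  have hf' : f * invOfUnit f 1 = 1 := mul_invOfUnit f 1 (by simpa using hf)
  obtain ⟨t, ht⟩ : X ^ n ∣ r - r' := by
    have h2 : X ^ n ∣ (r - r') * f := by
      rw [h1]
      refine dvd_sub (X_pow_dvd_iff.2 fun j hj => ?_) (dvd_mul_right _ _)
      rw [coeff_base_smul, coeff_eulerD, hu, coeff_X_pow_mul', if_neg (by omega), smul_zero,
        smul_zero]
    have h3 := h2.mul_right (invOfUnit f 1)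
    rwa [mul_assoc, hf', mul_one] at h3
  have h4 := congrArg (coeff n) h1
  have hn : ∀ x : R⟦X⟧, coeff n (X ^ n * x) = constantCoeff x := fun x => by
    rw [coeff_X_pow_mul', if_pos le_rfl, Nat.sub_self, coeff_zero_eq_constantCoeff_apply]
  rw [ht, mul_assoc, hn, map_mul, hf, mul_one, map_sub, hn, map_mul, h0, zero_mul, sub_zero,
    coeff_base_smul, coeff_eulerD, map_sub, smul_comm] at h4
  rw [← map_sub, ht, ← h4]
  simpa using hn t

end LogDeriv

/-! ### Decomposition by levels -/

section Level

variable {K : Type*} [Field K]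

/-- The restriction of a function of words to the words of weight `n`. -/
def level (n : ℕ) (f : Shuffle ℕ K) : Shuffle ℕ K := fun w => if w.sum = n then f w else 0

lemma level_apply (n : ℕ) (f : Shuffle ℕ K) (w : List ℕ) :
    level n f w = if w.sum = n then f w else 0 := rfl

lemma level_mul (n : ℕ) (f g : Shuffle ℕ K) :
    level n (f * g) = ∑ p ∈ Finset.HasAntidiagonal.antidiagonal n, level p.1 f * level p.2 g := by
  ext w
  rw [level_apply, eval_sum]
  split_ifs with hw
  · have h1 : ∀ p ∈ Finset.HasAntidiagonal.antidiagonal n,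
        (level p.1 f * level p.2 g) w = (level p.1 f * g) w := fun p hp => by
      rw [← sub_eq_zero, ← eval_sub, ← mul_sub]
      refine mul_apply_eq_zero _ _ _ fun u v _ _ huv => ?_
      have h2 := huv.sum_eq
      have h3 := Finset.HasAntidiagonal.mem_antidiagonal.1 hp
      rw [List.sum_append] at h2
      rw [eval_sub, level_apply, level_apply]
      by_cases hu : u.sum = p.1
      · rw [if_pos (show v.sum = p.2 by omega), sub_self, mul_zero]
      · rw [if_neg hu, zero_mul]
    rw [Finset.sum_congr rfl h1, ← eval_sum, ← Finset.sum_mul]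
    refine mul_congr (fun u hu => ?_) fun _ _ => rfl
    have hun : u.sum ≤ n := hw ▸ hu.sum_le_sum fun _ _ => Nat.zero_le _
    rw [eval_sum, Finset.sum_eq_single (u.sum, n - u.sum)]
    · rw [level_apply, if_pos rfl]
    · intro p hp hne
      rw [level_apply, if_neg]
      intro e
      have h3 := Finset.HasAntidiagonal.mem_antidiagonal.1 hp
      exact hne (Prod.ext e.symm (by simp; omega))
    · intro h
      exact absurd (Finset.HasAntidiagonal.mem_antidiagonal.2 (by simp; omega)) h
  · refine (Finset.sum_eq_zero fun p hp => mul_apply_eq_zero _ _ _ fun u v _ _ huv => ?_).symm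
    have h2 := huv.sum_eq
    have h3 := Finset.HasAntidiagonal.mem_antidiagonal.1 hp
    rw [List.sum_append] at h2
    rw [level_apply, level_apply]
    by_cases hu : u.sum = p.1
    · rw [if_neg (show v.sum ≠ p.2 by omega), mul_zero]
    · rw [if_neg hu, zero_mul]

/-- The generating function of the restrictions to levels. -/
noncomputable def levelSeries (f : Shuffle ℕ K) : (Shuffle ℕ K)⟦X⟧ :=
  PowerSeries.mk fun n => level n f

lemma coeff_levelSeries (f : Shuffle ℕ K) (n : ℕ) : coeff n (levelSeries f) = level n f :=
  coeff_mk _ _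

lemma levelSeries_mul (f g : Shuffle ℕ K) :
    levelSeries (f * g) = levelSeries f * levelSeries g := by
  ext1 n
  simp only [coeff_mul, coeff_levelSeries, level_mul]

lemma eulerD_levelSeries (f : Shuffle ℕ K) :
    eulerD K (levelSeries f) = levelSeries (gradeD K (id : ℕ → ℕ) f) := by
  ext1 n
  ext w
  rw [coeff_eulerD, coeff_levelSeries, coeff_levelSeries]
  change n • level n f w = _
  rw [level_apply, level_apply, gradeD_apply, List.map_id]
  split_ifs with h
  · rw [h]
  · rw [smul_zero]

lemma virAux_eq_zero (w : List ℕ) (j : ℕ) (f : Shuffle ℕ K)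
    (hf : ∀ v : List ℕ, v.sum + j = w.sum → f v = 0) : virAux w j f = 0 := by
  induction w generalizing j f with
  | nil => rfl
  | cons l w ih =>
    rw [virAux, ih j (shift l f) fun v hv => hf _ (by simp; omega), zero_add]
    split_ifs with h
    · rw [hf _ (by simp; omega), mul_zero]
    · rw [ih _ f fun v hv => hf v (by simp; omega), mul_zero]

lemma virM_eq_zero (ht c : K) (j : ℕ) (w : List ℕ) (h : w.sum ≠ j) : virM ht c j w = 0 := by
  induction w generalizing j with
  | nil => rw [virM_nil, if_neg fun e => h (by simp [e])]
  | cons l w ih =>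
    rw [virM_cons]
    split_ifs with h1 h2
    · rfl
    · exact absurd (by simp [h2.1, h2.2]) h
    · rw [ih _ fun e => h (by simp; omega), mul_zero, add_zero]

/-- `L_j` lowers the level by `j`, so descendants of different levels are orthogonal. -/
lemma pairingFun_eq_zero (ht c : K) (y w : List ℕ) (h : y.sum ≠ w.sum) :
    pairingFun ht c y w = 0 := by
  induction y generalizing w with
  | nil =>
    rw [pairingFun_nil]
    cases w
    · simp at h
    · simp
  | cons j y ih =>
    rw [pairingFun_cons, eval_add, virD_apply, virAux_eq_zero, Shuffle.mul_apply_eq_zero, add_zero]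
    · intro u v _ _ huv
      have h2 := huv.sum_eq
      rw [List.sum_append] at h2
      by_cases hu : u.sum = j
      · rw [ih v (by simp at h; omega), mul_zero]
      · rw [virM_eq_zero _ _ _ _ hu, zero_mul]
    · intro v hv
      exact ih v (by simp at h; omega)

end Level

end ClassicalBlock

end

/-! ### The inverse Gram matrix and the order of the logarithmic block -/

section

open PowerSeries

namespace ClassicalBlock

open Shuffle

variable {K k : Type*} [Field K] [Field k] [CharZero K] [CharZero k]

/-- The covector `∑ₚ A(p) (Q⁻¹)_{p q}`, as a function of the parts of `q`. -/
noncomputable def dualVector (ht c : K) (A : List ℕ → K) (m : Multiset ℕ) : K :=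
  if h : ∀ i ∈ m, 0 < i then
    ∑ p : m.sum.Partition, A (word p) * (gram ht c m.sum)⁻¹ p ⟨m, fun {i} => h i, rfl⟩
  -- A multiset containing `0` is no partition; the default `0` agrees with the convention of `sym`.
  else 0

lemma dualVector_parts (ht c : K) (A : List ℕ → K) {n : ℕ} (q : n.Partition) :
    dualVector ht c A q.parts = ∑ p : n.Partition, A (word p) * (gram ht c n)⁻¹ p q := by
  obtain ⟨m, hm, rfl⟩ := q
  rw [dualVector, dif_pos fun i hi => hm hi]

lemma sum_dualVector (ht c : K) (A : List ℕ → K) {n : ℕ} (hdet : (gram ht c n).det ≠ 0)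
    (p : n.Partition) :
    ∑ q : n.Partition, dualVector ht c A q.parts * gram ht c n q p = A (word p) := by
  have h1 : ∀ q : n.Partition, dualVector ht c A q.parts =
      Matrix.vecMul (fun p : n.Partition => A (word p)) (gram ht c n)⁻¹ q :=
    fun q => dualVector_parts ht c A q
  simp only [h1]
  change Matrix.vecMul (Matrix.vecMul _ _) (gram ht c n) p = _
  rw [Matrix.vecMul_vecMul, Matrix.nonsing_inv_mul _ (isUnit_iff_ne_zero.2 hdet),
    Matrix.vecMul_one]

lemma blockCoeff_eq (h : Fin 4 → K) (ht c : K) (n : ℕ) : blockCoeff h ht c n =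
    ∑ q : n.Partition, dualVector ht c (vertex (h 1) (h 0) ht) q.parts *
      vertex (h 2) (h 3) ht (word q) := by
  simp only [blockCoeff, dualVector_parts, Finset.sum_mul]
  exact Finset.sum_comm

/-- The partition with given parts. -/
def toPartition (w : List ℕ) (h : 0 ∉ w) : w.sum.Partition :=
  ⟨w, fun {i} hi => Nat.pos_of_ne_zero fun e => h (by rw [← e]; exact Multiset.mem_coe.1 hi),
    Multiset.sum_coe w⟩

lemma word_toPartition (w : List ℕ) (h : 0 ∉ w) : word (toPartition w h) = sorted w := rfl

lemma coe_word {n : ℕ} (q : n.Partition) : ((word q : List ℕ) : Multiset ℕ) = q.parts :=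
  Multiset.sort_eq _ _

namespace Scaling

variable {V : Residue K k} (s : Scaling V)

lemma prod_wt_ne (w : List ℕ) : (w.map s.wt).prod ≠ 0 := by
  rw [Ne, List.prod_eq_zero_iff]
  simp [s.wt_ne]

lemma prod_wt_mem (w : List ℕ) : (w.map s.wt).prod ∈ V.ring :=
  Subring.list_prod_mem _ fun x hx => by
    obtain ⟨l, -, rfl⟩ := List.mem_map.1 hx
    exact s.wt_mem l

/-- The normalized covector, as a symmetric function of words. -/
noncomputable def covector (A : List ℕ → K) : Shuffle ℕ K := fun w =>
  -- The divisor is the weight of the contraction in `partitionSeries` times the letter weights put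
  -- on the pairing, so that contracting with the weighted pairing reproduces the system defining
  -- `dualVector`.
  dualVector s.ht s.c A w / (weight s.ε w * (w.map s.wt).prod)

lemma covector_isSymm (A : List ℕ → K) : IsSymm (s.covector A) := fun w w' h => by
  simp only [covector, Multiset.coe_eq_coe.2 h, (h.map s.wt).prod_eq]

lemma covector_of_mem (A : List ℕ → K) (w : List ℕ) (h : 0 ∈ w) : s.covector A w = 0 := by
  rw [covector, dualVector, dif_neg, zero_div]
  exact fun h' => (h' 0 (Multiset.mem_coe.2 h)).ne rfl

lemma weight_mul_covector (A : List ℕ → K) {n : ℕ} (q : n.Partition) :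
    weight s.ε q.parts * (((word q).map s.wt).prod * s.covector A (word q)) =
      dualVector s.ht s.c A q.parts := by
  have h1 := weight_ne_zero s.ε_ne q.parts
  have h2 := s.prod_wt_ne (word q)
  rw [covector, coe_word]
  field_simp

lemma covector_nil (A : List ℕ → K) (hA : A [] = 1) : s.covector A [] = 1 := by
  have hw : ∀ q : Nat.Partition 0, word q = [] := fun q => by
    by_contra h
    have := sum_pos_of_notMem (zero_notMem_word q) h
    rw [word_sum] at this
    exact this.ne rfl
  have h1 := sum_dualVector s.ht s.c A (s.det_gram_ne 0) default
  rw [Fintype.sum_unique, ← s.weight_mul_covector, hw, hA, ← coe_word, hw] at h1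
  simpa [weight, symFactor, gram, hw, pairing] using h1

/-- The logarithm of the normalized pairing, symmetrized in both arguments. -/
noncomputable def symLogPairing : Shuffle ℕ (Shuffle ℕ K) :=
  sym (mapHom sym (scale s.wt (logPairing s.ht s.c)))

lemma expo_symLogPairing : expo s.symLogPairing =
    sym (mapHom sym (scale s.wt (pairingFun s.ht s.c))) := by
  rw [scale_pairingFun, map_expo, sym_expo, symLogPairing]

lemma symLogPairing_regular :
    s.ε • s.symLogPairing ∈ regular ℕ (regular ℕ V.ring) := by
  rw [symLogPairing, ← sym_smul]
  refine sym_mem_regular fun y => ?_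
  have : (s.ε • mapHom sym (scale s.wt (logPairing s.ht s.c))) y =
      sym ((s.ε • scale s.wt (logPairing s.ht s.c)) y) := by
    rw [eval_smul, eval_smul, mapHom_apply, sym_smul]
  rw [this]
  exact sym_mem_regular (s.logPairing_regular y)

lemma expo_symLogPairing_apply {n : ℕ} (q : n.Partition) (w : List ℕ) (hw : 0 ∉ w) :
    expo s.symLogPairing (word q) w =
      ((word q).map s.wt).prod * pairing s.ht s.c (word q) (sorted w) := by
  rw [expo_symLogPairing, sym_apply_of_pairwise (zero_notMem_word q) (word_pairwise q),
    mapHom_apply, sym_of_notMem _ hw, scale_apply]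
  rfl

lemma expo_symLogPairing_of_mem {n : ℕ} (q : n.Partition) (w : List ℕ) (hw : 0 ∈ w) :
    expo s.symLogPairing (word q) w = 0 := by
  rw [expo_symLogPairing, sym_apply_of_pairwise (zero_notMem_word q) (word_pairwise q),
    mapHom_apply, sym_of_mem _ hw]

lemma logVertex_regular {a b : K} (ha : s.ε * a ∈ V.ring) (hb : s.ε * b ∈ V.ring) :
    s.ε • logVertex a b s.ht ∈ regular ℕ V.ring := by
  intro w
  rw [eval_smul, smul_eq_mul]
  induction w with
  | nil => simp [logVertex, V.ring.zero_mem]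
  | cons l w ih =>
    rw [logVertex, mul_add, mul_left_comm]
    refine V.ring.add_mem (V.ring.mul_mem (natCast_mem _ _) ih) ?_
    split_ifs
    · rw [mul_sub, mul_add, mul_left_comm]
      exact V.ring.sub_mem (V.ring.add_mem s.ht_mem (V.ring.mul_mem (natCast_mem _ _) ha)) hb
    · simp [V.ring.zero_mem]

lemma eps_smul_mem {ι : Type*} {f : Shuffle ι K} (hf : f ∈ regular ι V.ring) :
    s.ε • f ∈ regular ι V.ring := fun w => V.ring.mul_mem s.ε_mem (hf w)

/-- Pairing the symmetrized Gram kernel with the normalized covector gives back `A`. -/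
lemma partitionSeries_covector (A : Shuffle ℕ K) :
    partitionSeries s.ε (fun q => expo s.symLogPairing q *
      mapHom (algebraMap K (Shuffle ℕ K)) (s.covector A) q) = levelSeries (sym A) := by
  ext1 n
  ext w
  rw [coeff_partitionSeries, coeff_levelSeries, level_apply, eval_sum]
  have h1 : ∀ q : n.Partition, (weight s.ε q.parts • (expo s.symLogPairing (word q) *
      mapHom (algebraMap K (Shuffle ℕ K)) (s.covector A) (word q))) w =
      weight s.ε q.parts * (s.covector A (word q) * expo s.symLogPairing (word q) w) :=
    fun q => by
      rw [mapHom_apply, mul_comm, ← Algebra.smul_def]; rfl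
  simp only [h1]
  by_cases h0 : 0 ∈ w
  · rw [sym_of_mem _ h0, ite_self]
    exact Finset.sum_eq_zero fun q _ => by rw [expo_symLogPairing_of_mem _ _ _ h0]; ring
  · split_ifs with hn
    · subst hn
      rw [sym_of_notMem _ h0, ← word_toPartition w h0,
        ← sum_dualVector s.ht s.c A (s.det_gram_ne _)]
      refine Finset.sum_congr rfl fun q _ => ?_
      have h2 := s.weight_mul_covector A q
      rw [s.expo_symLogPairing_apply q w h0, ← word_toPartition w h0]
      change _ * (_ * (_ * pairing _ _ _ _)) = dualVector s.ht s.c A _ * pairing _ _ _ _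
      rw [← h2]
      ring
    · refine Finset.sum_eq_zero fun q _ => ?_
      have := pairingFun_eq_zero s.ht s.c (word q) (sorted w)
        (by rw [word_sum, sum_sorted]; exact fun e => hn e.symm)
      rw [s.expo_symLogPairing_apply q w h0]
      change _ * (_ * (_ * pairingFun s.ht s.c (word q) (sorted w))) = 0
      rw [this]; ring

/-- The level generating function is multiplicative and turns the grading into the Euler operator;
thus the logarithmic derivative is the level series of the grading applied to `S`. -/
lemma exists_eulerD_levelSeries {S : Shuffle ℕ K} (hS : s.ε • S ∈ regular ℕ V.ring) :
    ∃ r : (Shuffle ℕ K)⟦X⟧, (∀ n, coeff n r ∈ regular ℕ V.ring) ∧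
      s.ε • eulerD K (levelSeries (expo S)) = r * levelSeries (expo S) := by
  refine ⟨s.ε • levelSeries (gradeD K (id : ℕ → ℕ) S), fun n w => ?_, ?_⟩
  · rw [coeff_base_smul, coeff_levelSeries, eval_smul, level_apply, gradeD_apply, smul_ite,
      smul_zero, smul_comm]
    split_ifs
    · exact nsmul_mem (hS w) _
    · exact V.ring.zero_mem
  · rw [eulerD_levelSeries, expo_gradeD, levelSeries_mul, smul_mul_assoc]

/-- The normalized covector of an exponential is an exponential. -/
theorem exists_covector_eq_expo {S : Shuffle ℕ K} (hS : s.ε • S ∈ regular ℕ V.ring) :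
    ∃ ω : Shuffle ℕ K, s.ε • ω ∈ regular ℕ V.ring ∧ s.covector (expo S) = expo ω := by
  set A := expo S
  obtain ⟨ω₀, h0, hω₀⟩ := exists_eq_expo (s.covector_nil A (expo_nil S))
  set ω := sym ω₀
  have hω0 : ω [] = 0 := (sym_nil ω₀).trans h0
  have hω : s.covector A = expo ω := by
    rw [← sym_expo, ← hω₀, sym_eq_self (s.covector_isSymm A) (s.covector_of_mem A)]
  refine ⟨ω, ?_, hω⟩
  -- Strong induction on the level: below level `n` regularity of `ε • ω` is known, and the defining
  -- system at level `n` yields it at level `n`.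
  suffices h : ∀ n, ∀ w : List ℕ, w.sum = n → s.ε * ω w ∈ V.ring from fun w => h _ w rfl
  intro n
  induction n using Nat.strong_induction_on with
  | _ n ih =>
    intro w hw
    by_cases hw0 : 0 ∈ w
    · rw [show ω w = 0 from sym_of_mem _ hw0, mul_zero]; exact V.ring.zero_mem
    rcases eq_or_ne w [] with rfl | hwne
    · rw [hω0, mul_zero]; exact V.ring.zero_mem
    have hn : n ≠ 0 := fun e => (sum_pos_of_notMem hw0 hwne).ne (hw.trans e).symm
    -- the truncation of `ω`
    set ω' : Shuffle ℕ K := fun w => if w.sum < n then ω w else 0 with hω'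
    have hω'reg : s.ε • ω' ∈ regular ℕ V.ring := fun v => by
      rw [eval_smul, smul_eq_mul]
      simp only [hω']
      split_ifs with h
      · exact ih _ h v rfl
      · rw [mul_zero]; exact V.ring.zero_mem
    have hsym' : sym ω' = ω' := sym_eq_self
      (fun u v h => by simp only [hω', h.sum_eq, sym_isSymm ω₀ h, ω])
      fun u hu => by simp only [hω', ω, sym_of_mem _ hu, ite_self]
    have hdiff : ∀ v : List ℕ, 0 ∉ v → v.sum ≤ n → expo ω v - expo ω' v = ω v - ω' v :=
      fun v hv hvn => expo_sub_expo n (fun u hu => by simp only [hω', if_pos hu])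
        (by simp only [hω']; split_ifs <;> simp [hω0]) v hv hvn
    have hdiff1 : ∀ v : List ℕ, 0 ∉ v → v.sum < n → expo ω v = expo ω' v := fun v hv hvn => by
      rw [← sub_eq_zero, hdiff v hv hvn.le]; simp only [hω', if_pos hvn, sub_self]
    have hdiff2 : ∀ v : List ℕ, 0 ∉ v → v.sum = n → expo ω v - expo ω' v = ω v :=
      fun v hv hvn => by
        rw [hdiff v hv hvn.le]; simp only [hω', if_neg hvn.not_lt, sub_zero]
    -- the logarithmic derivatives of the two pairings
    set ψ : Shuffle ℕ K →+* Shuffle ℕ (Shuffle ℕ K) := mapHom (algebraMap K (Shuffle ℕ K)) with hψ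
    obtain ⟨r', hr', hr'eq⟩ := exists_eulerD_partitionSeries (ε := s.ε) s.ε_ne (regular ℕ V.ring)
      (fun x hx => s.eps_smul_mem hx)
      (fun m x hx v => V.ring.mul_mem (V.inv_natCast_mem m) (hx v))
      (SA := s.symLogPairing) (SW := ψ ω') (by rw [expo_symLogPairing]; exact sym_isSymm _)
      (by
        rw [← map_expo, ← hsym', ← sym_expo]
        exact fun u v h => congrArg (algebraMap K (Shuffle ℕ K)) (sym_isSymm _ h))
      s.symLogPairing_regular
      (fun v => by
        have : (s.ε • ψ ω') v = algebraMap K (Shuffle ℕ K) ((s.ε • ω') v) := by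
          rw [eval_smul, eval_smul, smul_eq_mul, map_mul, ← Algebra.smul_def]; rfl
        rw [this, Algebra.algebraMap_eq_smul_one]
        intro u
        exact V.ring.mul_mem (hω'reg v) ((regular ℕ V.ring).one_mem u))
    -- The contraction with the full `ω` is the level series of `sym A`, hence has a regular
    -- logarithmic derivative for a reason independent of `ω`.
    obtain ⟨r, hr, hreq⟩ := s.exists_eulerD_levelSeries (S := sym S) (by
      rw [← sym_smul]; exact sym_mem_regular hS)
    rw [← sym_expo, ← s.partitionSeries_covector, hω] at hreq
    set f := partitionSeries s.ε (fun q => expo s.symLogPairing q *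
      mapHom (algebraMap K (Shuffle ℕ K)) (expo ω) q) with hf
    rw [← map_expo] at hr'eq
    set g := partitionSeries s.ε (fun q => expo s.symLogPairing q *
      mapHom (algebraMap K (Shuffle ℕ K)) (expo ω') q) with hg
    have hfg : ∀ j, coeff j f - coeff j g = ∑ q : j.Partition, weight s.ε q.parts •
        (expo s.symLogPairing (word q) *
          algebraMap K (Shuffle ℕ K) (expo ω (word q) - expo ω' (word q))) := fun j => by
      rw [hf, hg, coeff_partitionSeries, coeff_partitionSeries, ← Finset.sum_sub_distrib]
      refine Finset.sum_congr rfl fun q _ => ?_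
      rw [mapHom_apply, mapHom_apply, map_sub, ← smul_sub, ← mul_sub]
    have hfg0 : ∀ j < n, coeff j f = coeff j g := fun j hj => by
      rw [← sub_eq_zero, hfg]
      refine Finset.sum_eq_zero fun q _ => ?_
      rw [hdiff1 _ (zero_notMem_word q) (by rwa [word_sum]), sub_self, map_zero, mul_zero,
        smul_zero]
    have hc : ∀ η : Shuffle ℕ K, constantCoeff (partitionSeries s.ε (fun q =>
        expo s.symLogPairing q * mapHom (algebraMap K (Shuffle ℕ K)) (expo η) q)) = 1 := by
      intro η
      rw [constantCoeff_partitionSeries, mapHom_apply, expo_nil, expo_nil, map_one, one_mul]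
    -- Both logarithmic derivatives are regular, so their difference, which is linear in `ω` at
    -- level `n`, is regular too.
    have key := coeff_logDeriv_sub (hc ω) (hc ω') hreq hr'eq n hfg0
    have hreg : n • s.ε • (coeff n f - coeff n g) ∈ regular ℕ V.ring := by
      rw [← key]; exact Subring.sub_mem _ (hr n) (hr' n)
    rw [hfg] at hreg
    -- the linear system for the top level of `ω`
    have hsys : ∀ p : n.Partition, ∑ q : n.Partition,
        (s.ε * ω (word q) / symFactor q.parts) * s.normGram n q p ∈ V.ring := by
      intro p
      have h1 := V.ring.mul_mem (V.inv_natCast_mem n) (hreg (word p))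
      have h2 : ∀ q : n.Partition, (weight s.ε q.parts • (expo s.symLogPairing (word q) *
          algebraMap K (Shuffle ℕ K) (expo ω (word q) - expo ω' (word q)))) (word p) =
          ω (word q) / symFactor q.parts * s.normGram n q p := fun q => by
        rw [hdiff2 _ (zero_notMem_word q) (word_sum q), mul_comm, ← Algebra.smul_def, eval_smul,
          eval_smul, s.expo_symLogPairing_apply q _ (zero_notMem_word p),
          sorted_eq_self (word_pairwise p), weight, ← coe_word]
        change _ = _ * ((s.ε ^ _ * _) * pairing _ _ _ _)
        rw [Multiset.coe_card, smul_eq_mul, smul_eq_mul]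
        ring
      have h3 : (n • s.ε • ∑ q : n.Partition, weight s.ε q.parts •
          (expo s.symLogPairing (word q) *
          algebraMap K (Shuffle ℕ K) (expo ω (word q) - expo ω' (word q)))) (word p) =
          n • s.ε • ∑ q : n.Partition,
            (ω (word q) / symFactor q.parts * s.normGram n q p) := by
        rw [← Finset.sum_congr rfl fun q _ => h2 q, ← eval_sum]
        rfl
      rw [h3, nsmul_eq_mul, inv_mul_cancel_left₀ (Nat.cast_ne_zero.2 hn), smul_eq_mul,
        Finset.mul_sum] at h1
      convert h1 using 2 with q
      ring
    -- The factor `ε ^ length` from the contraction weight is exactly the row normalization of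
    -- `normGram`, which is invertible over the ring.
    have hx := s.mem_of_vecMul_mem n (fun q => s.ε * ω (word q) / symFactor q.parts) hsys
    subst hw
    have hxw := V.ring.mul_mem (natCast_mem V.ring (symFactor (toPartition w hw0).parts))
      (hx (toPartition w hw0))
    rw [mul_div_cancel₀ _ (Nat.cast_ne_zero.2 (symFactor_ne_zero _)), word_toPartition,
      show ω (sorted w) = ω w from sym_isSymm ω₀ (sorted_perm w)] at hxw
    exact hxw

/-- The logarithm of the block is of order `1 / ε`. -/
theorem eps_mul_logBlock_mem [Algebra ℚ K] (h : Fin 4 → K) (hh : ∀ i, s.ε * h i ∈ V.ring)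
    (n : ℕ) : s.ε * coeff n (logBlock h s.ht s.c) ∈ V.ring := by
  obtain ⟨ω, hω, hωeq⟩ := s.exists_covector_eq_expo (S := logVertex (h 1) (h 0) s.ht)
    (s.logVertex_regular (hh 1) (hh 0))
  -- The letter weights divided out of the covector are restored on the second vertex.
  set B := scale s.wt (sym (logVertex (h 2) (h 3) s.ht)) with hB
  have hBexp : expo B = scale s.wt (sym (vertexFun (h 2) (h 3) s.ht)) := by
    rw [vertexFun_eq_expo, sym_expo, scale_expo]
  have hblock : block h s.ht s.c = partitionSeries s.ε fun q => expo B q * expo ω q := by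
    ext1 n
    rw [block, coeff_mk, coeff_partitionSeries, blockCoeff_eq]
    refine Finset.sum_congr rfl fun q _ => ?_
    have := s.weight_mul_covector (vertexFun (h 1) (h 0) s.ht) q
    rw [vertexFun_eq_expo, hωeq, ← vertexFun_eq_expo] at this
    change dualVector s.ht s.c (vertexFun (h 1) (h 0) s.ht) q.parts * _ = _
    rw [← this, hBexp, scale_apply,
      sym_apply_of_pairwise (zero_notMem_word q) (word_pairwise q), smul_eq_mul, smul_eq_mul]
    change _ = _ * (_ * vertex _ _ _ _ * _)
    ring
  have hsB : IsSymm (expo B) := fun u v huv => by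
    rw [hBexp, scale_apply, scale_apply, sym_isSymm _ huv, (huv.map _).prod_eq]
  have hsω : IsSymm (expo ω) := hωeq ▸ s.covector_isSymm _
  obtain ⟨r, hr, hreq⟩ := exists_eulerD_partitionSeries (ε := s.ε) s.ε_ne V.ring
    (fun x hx => V.ring.mul_mem s.ε_mem hx)
    (fun m x hx => V.ring.mul_mem (V.inv_natCast_mem m) hx) hsB hsω
    (fun w => by
      have h1 := sym_mem_regular (s.logVertex_regular (hh 2) (hh 3)) w
      rw [sym_smul] at h1
      rw [hB, eval_smul, scale_apply, smul_comm]
      exact V.ring.mul_mem (s.prod_wt_mem w) h1) hω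
  rw [← hblock] at hreq
  have hc : constantCoeff (block h s.ht s.c) = 1 := by
    rw [hblock, constantCoeff_partitionSeries, expo_nil, expo_nil, one_mul]
  have h1 : s.ε • eulerD K (logBlock h s.ht s.c) = r := by
    have hne : block h s.ht s.c ≠ 0 := fun e => by rw [e, map_zero] at hc; exact zero_ne_one hc
    refine mul_left_cancel₀ hne ?_
    rw [mul_smul_comm, logBlock, mul_eulerD_logOf hc, hreq, mul_comm]
  rcases Nat.eq_zero_or_pos n with rfl | hn
  · rw [logBlock, coeff_zero_eq_constantCoeff_apply, constantCoeff_logOf hc, mul_zero]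
    exact V.ring.zero_mem
  · have h2 := congrArg (coeff n) h1
    rw [coeff_base_smul, coeff_eulerD, smul_comm, nsmul_eq_mul, smul_eq_mul] at h2
    have h3 := V.ring.mul_mem (V.inv_natCast_mem n) (hr n)
    rwa [← h2, inv_mul_cancel_left₀ (Nat.cast_ne_zero.2 hn.ne')] at h3

end Scaling

end ClassicalBlock

end

/-! ### Specialization of fractions and functoriality of the block -/

section

open PowerSeries

namespace ClassicalBlock

open Shuffle

namespace Residue

section Eval

variable {A K L : Type*} [CommRing A] [Field K] [Field L]

/-- The subring of the fractions `N / D` with `φ D ≠ 0`. -/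
def fractionSubring (j : A →+* K) (φ : A →+* L) : Subring K where
  carrier := {z | ∃ N D, φ D ≠ 0 ∧ z * j D = j N}
  zero_mem' := ⟨0, 1, by simp, by simp⟩
  one_mem' := ⟨1, 1, by simp, by simp⟩
  add_mem' := by
    rintro a b ⟨N, D, h, e⟩ ⟨N', D', h', e'⟩
    refine ⟨N * D' + N' * D, D * D', by simp [h, h'], ?_⟩
    simp only [map_mul, map_add, ← e, ← e']; ring
  mul_mem' := by
    rintro a b ⟨N, D, h, e⟩ ⟨N', D', h', e'⟩
    refine ⟨N * N', D * D', by simp [h, h'], ?_⟩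
    simp only [map_mul, ← e, ← e']; ring
  neg_mem' := by
    rintro a ⟨N, D, h, e⟩
    exact ⟨-N, D, h, by simp [← e]⟩

lemma exists_fractionVal (j : A →+* K) (φ : A →+* L) (z : fractionSubring j φ) :
    ∃ v : L, ∃ N D, φ D ≠ 0 ∧ (z : K) * j D = j N ∧ v = φ N / φ D := by
  obtain ⟨z, N, D, h, e⟩ := z
  exact ⟨_, N, D, h, e, rfl⟩

/-- The value of a fraction. -/
noncomputable def fractionVal (j : A →+* K) (φ : A →+* L) (z : fractionSubring j φ) : L :=
  (exists_fractionVal j φ z).choose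

lemma fractionVal_eq {j : A →+* K} (hj : Function.Injective j) {φ : A →+* L}
    (z : fractionSubring j φ) {N D : A} (h : φ D ≠ 0) (e : (z : K) * j D = j N) :
    fractionVal j φ z = φ N / φ D := by
  obtain ⟨N', D', h', e', e2⟩ := (exists_fractionVal j φ z).choose_spec
  have : N' * D = N * D' := hj (by rw [map_mul, map_mul, ← e, ← e']; ring)
  rw [fractionVal, e2, div_eq_div_iff h' h, ← map_mul, ← map_mul, this]

/-- The fractions `N / D` with `φ D ≠ 0`, with the value `φ N / φ D`. -/
noncomputable def ofHom (j : A →+* K) (hj : Function.Injective j) (φ : A →+* L) :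
    Residue K L where
  ring := fractionSubring j φ
  res :=
    { toFun := fractionVal j φ
      map_zero' := by rw [fractionVal_eq hj (N := 0) (D := 1)] <;> simp
      map_one' := by rw [fractionVal_eq hj (N := 1) (D := 1)] <;> simp
      map_add' := fun a b => by
        obtain ⟨N, D, h, e⟩ := a.2
        obtain ⟨N', D', h', e'⟩ := b.2
        rw [fractionVal_eq hj a h e, fractionVal_eq hj b h' e',
          fractionVal_eq hj (a + b) (N := N * D' + N' * D) (D := D * D') (by simp [h, h']),
          div_add_div _ _ h h']
        · simp only [map_mul, map_add]; ring
        · simp only [map_mul, map_add, ← e, ← e', Subring.coe_add]; ring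
      map_mul' := fun a b => by
        obtain ⟨N, D, h, e⟩ := a.2
        obtain ⟨N', D', h', e'⟩ := b.2
        rw [fractionVal_eq hj a h e, fractionVal_eq hj b h' e',
          fractionVal_eq hj (a * b) (N := N * N') (D := D * D') (by simp [h, h']),
          div_mul_div_comm]
        · simp only [map_mul]
        · simp only [map_mul, ← e, ← e', Subring.coe_mul]; ring }
  inv_mem := fun x hx => by
    obtain ⟨N, D, h, e⟩ := x.2
    have hN : φ N ≠ 0 := fun h0 => hx (by
      change fractionVal j φ x = 0
      rw [fractionVal_eq hj x h e, h0, zero_div])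
    have h1 : (x : K) ≠ 0 := fun h0 => hN (by
      rw [hj (e.symm.trans (by rw [h0, zero_mul, map_zero]) : j N = j 0), map_zero])
    exact ⟨D, N, hN, by rw [← e, inv_mul_cancel_left₀ h1]⟩

variable {j : A →+* K} {hj : Function.Injective j} {φ : A →+* L}

lemma mem_ofHom {z : K} : z ∈ (ofHom j hj φ).ring ↔ ∃ N D, φ D ≠ 0 ∧ z * j D = j N := Iff.rfl

lemma map_mem_ofHom (a : A) : j a ∈ (ofHom j hj φ).ring := mem_ofHom.2 ⟨a, 1, by simp, by simp⟩

end Eval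

variable {K L : Type*} [Field K] [Field L] (W : Residue K L)

/-- `a` belongs to the subring, and `b` is its residue. -/
def Spec (a : K) (b : L) : Prop := ∃ h : a ∈ W.ring, W.res ⟨a, h⟩ = b

variable {W} {a a' : K} {b b' : L}

lemma spec_map {A : Type*} [CommRing A] {j : A →+* K} {hj : Function.Injective j} {φ : A →+* L}
    (a : A) : (ofHom j hj φ).Spec (j a) (φ a) :=
  ⟨map_mem_ofHom a, (fractionVal_eq hj (N := a) (D := 1) _ (by simp) (by simp)).trans (by simp)⟩

lemma Spec.unique (h : W.Spec a b) (h' : W.Spec a b') : b = b' := by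
  obtain ⟨_, rfl⟩ := h
  obtain ⟨_, rfl⟩ := h'
  rfl

lemma spec_of_mem (h : a ∈ W.ring) : W.Spec a (W.res ⟨a, h⟩) := ⟨h, rfl⟩

lemma Spec.zero : W.Spec 0 0 := ⟨W.ring.zero_mem, map_zero W.res⟩

lemma Spec.one : W.Spec 1 1 := ⟨W.ring.one_mem, map_one W.res⟩

lemma Spec.natCast (n : ℕ) : W.Spec n n := ⟨natCast_mem W.ring n, map_natCast W.res n⟩

lemma Spec.add (h : W.Spec a b) (h' : W.Spec a' b') : W.Spec (a + a') (b + b') := by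
  obtain ⟨h, rfl⟩ := h
  obtain ⟨h', rfl⟩ := h'
  exact ⟨W.ring.add_mem h h', map_add W.res ⟨a, h⟩ ⟨a', h'⟩⟩

lemma Spec.mul (h : W.Spec a b) (h' : W.Spec a' b') : W.Spec (a * a') (b * b') := by
  obtain ⟨h, rfl⟩ := h
  obtain ⟨h', rfl⟩ := h'
  exact ⟨W.ring.mul_mem h h', map_mul W.res ⟨a, h⟩ ⟨a', h'⟩⟩

lemma Spec.sub (h : W.Spec a b) (h' : W.Spec a' b') : W.Spec (a - a') (b - b') := by
  obtain ⟨h, rfl⟩ := h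
  obtain ⟨h', rfl⟩ := h'
  exact ⟨W.ring.sub_mem h h', map_sub W.res ⟨a, h⟩ ⟨a', h'⟩⟩

lemma Spec.inv (h : W.Spec a b) (hb : b ≠ 0) : W.Spec a⁻¹ b⁻¹ := by
  obtain ⟨h, rfl⟩ := h
  have hi := W.inv_mem ⟨a, h⟩ hb
  refine ⟨hi, ?_⟩
  have ha : a ≠ 0 := by
    rintro rfl
    exact hb (map_zero W.res)
  have : W.res ⟨a⁻¹, hi⟩ * W.res ⟨a, h⟩ = 1 := by
    rw [← map_mul, ← map_one W.res]
    exact congrArg W.res (Subtype.ext (inv_mul_cancel₀ ha))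
  exact eq_inv_of_mul_eq_one_left this

lemma Spec.div (h : W.Spec a b) (h' : W.Spec a' b') (hb : b' ≠ 0) :
    W.Spec (a / a') (b / b') := by
  rw [div_eq_mul_inv, div_eq_mul_inv]
  exact h.mul (h'.inv hb)

lemma Spec.pow (h : W.Spec a b) (n : ℕ) : W.Spec (a ^ n) (b ^ n) := by
  obtain ⟨h, rfl⟩ := h
  exact ⟨pow_mem h n, map_pow W.res ⟨a, h⟩ n⟩

lemma Spec.ite {p : Prop} [Decidable p] (h : p → W.Spec a b) (h' : ¬p → W.Spec a' b') :
    W.Spec (if p then a else a') (if p then b else b') := by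
  split_ifs with hp
  exacts [h hp, h' hp]

lemma Spec.sum {ι : Type*} {s : Finset ι} {f : ι → K} {g : ι → L}
    (h : ∀ i ∈ s, W.Spec (f i) (g i)) : W.Spec (∑ i ∈ s, f i) (∑ i ∈ s, g i) := by
  classical
  induction s using Finset.induction_on with
  | empty => exact Spec.zero
  | insert i s hi ih =>
    rw [Finset.sum_insert hi, Finset.sum_insert hi]
    exact (h i (Finset.mem_insert_self i s)).add
      (ih fun k hk => h k (Finset.mem_insert_of_mem hk))

section Matrix

variable {n : Type*} [Fintype n] [DecidableEq n] {M : Matrix n n K} {N : Matrix n n L}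

lemma exists_lift (h : ∀ i k, W.Spec (M i k) (N i k)) :
    ∃ M' : Matrix n n W.ring, W.ring.subtype.mapMatrix M' = M ∧ W.res.mapMatrix M' = N :=
  ⟨Matrix.of fun i k => ⟨M i k, (h i k).1⟩, rfl, Matrix.ext fun i k => (h i k).2⟩

lemma Spec.det (h : ∀ i k, W.Spec (M i k) (N i k)) : W.Spec M.det N.det := by
  obtain ⟨M', rfl, rfl⟩ := exists_lift h
  rw [← RingHom.map_det, ← RingHom.map_det]
  exact ⟨M'.det.2, rfl⟩

lemma Spec.matrix_inv (h : ∀ i k, W.Spec (M i k) (N i k)) (hN : N.det ≠ 0) (i k : n) :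
    W.Spec (M⁻¹ i k) (N⁻¹ i k) := by
  have hdet := Spec.det h
  obtain ⟨M', rfl, rfl⟩ := exists_lift h
  rw [Matrix.inv_def, Matrix.inv_def, Ring.inverse_eq_inv', Ring.inverse_eq_inv',
    ← RingHom.map_adjugate, ← RingHom.map_adjugate]
  exact (hdet.inv hN).mul ⟨(M'.adjugate i k).2, rfl⟩

end Matrix

end Residue

open Residue

section Functoriality

variable {K L : Type*} [Field K] [Field L] [CharZero L] {W : Residue K L} {ht c : K} {ht' c' : L}

lemma spec_virAux (w : List ℕ) (i : ℕ) {f : Shuffle ℕ K} {g : Shuffle ℕ L}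
    (h : ∀ v, W.Spec (f v) (g v)) : W.Spec (virAux w i f) (virAux w i g) := by
  induction w generalizing i f g with
  | nil => exact Spec.zero
  | cons l w ih =>
    rw [virAux, virAux]
    exact (ih i fun v => h (l :: v)).add (((Spec.natCast i).add (Spec.natCast l)).mul
      (Spec.ite (fun _ => h _) fun _ => ih _ h))

lemma spec_virM (hht : W.Spec ht ht') (hc : W.Spec c c') (i : ℕ) (w : List ℕ) :
    W.Spec (virM ht c i w) (virM ht' c' i w) := by
  induction w generalizing i with
  | nil =>
    rw [virM_nil, virM_nil]
    exact Spec.ite (fun _ => hht) fun _ => Spec.zero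
  | cons l w ih =>
    rw [virM_cons, virM_cons]
    refine Spec.ite (fun _ => Spec.zero) fun _ =>
      (((Spec.natCast i).add (Spec.natCast l)).mul (ih _)).add
        (Spec.ite (fun _ => Spec.mul ?_ (((Spec.natCast i).pow 3).sub (Spec.natCast i)))
          fun _ => Spec.zero)
    exact_mod_cast hc.div (Spec.natCast 12) (Nat.cast_ne_zero.2 (by norm_num))

lemma spec_mul {f f' : Shuffle ℕ K} {g g' : Shuffle ℕ L} (h : ∀ v, W.Spec (f v) (g v))
    (h' : ∀ v, W.Spec (f' v) (g' v)) (w : List ℕ) : W.Spec ((f * f') w) ((g * g') w) := by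
  induction w generalizing f f' g g' with
  | nil => exact (h []).mul (h' [])
  | cons l w ih =>
    rw [mul_cons, mul_cons]
    exact (ih (fun v => h (l :: v)) h').add (ih h fun v => h' (l :: v))

lemma spec_pairing (hht : W.Spec ht ht') (hc : W.Spec c c') (y w : List ℕ) :
    W.Spec (pairing ht c y w) (pairing ht' c' y w) := by
  change W.Spec (pairingFun ht c y w) (pairingFun ht' c' y w)
  induction y generalizing w with
  | nil =>
    rw [pairingFun_nil, pairingFun_nil]
    cases w
    exacts [Spec.one, Spec.zero]
  | cons i y ih =>
    rw [pairingFun_cons, pairingFun_cons]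
    exact (spec_virAux w i ih).add (spec_mul (spec_virM hht hc i) ih w)

lemma spec_vertex {a b : K} {a' b' : L} (ha : W.Spec a a') (hb : W.Spec b b')
    (hht : W.Spec ht ht') (w : List ℕ) : W.Spec (vertex a b ht w) (vertex a' b' ht' w) := by
  induction w with
  | nil => exact Spec.one
  | cons l w ih =>
    rw [vertex, vertex]
    exact (((hht.add ((Spec.natCast l).mul ha)).sub hb).add (Spec.natCast _)).mul ih

/-- All ingredients are polynomial apart from the inverse Gram matrix. The determinant over `L` must
be nonzero, since otherwise `⁻¹` there is the default value `0`, unrelated to the inverse over `K`.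
-/
lemma spec_blockCoeff {h : Fin 4 → K} {h' : Fin 4 → L} (hh : ∀ i, W.Spec (h i) (h' i))
    (hht : W.Spec ht ht') (hc : W.Spec c c') (n : ℕ) (hdet : (gram ht' c' n).det ≠ 0) :
    W.Spec (blockCoeff h ht c n) (blockCoeff h' ht' c' n) :=
  Spec.sum fun p _ => Spec.sum fun q _ => ((spec_vertex (hh 1) (hh 0) hht _).mul
    (Spec.matrix_inv (fun p q => spec_pairing hht hc (word p) (word q)) hdet p q)).mul
      (spec_vertex (hh 2) (hh 3) hht _)

end Functoriality

section Log

variable {K : Type*} [Field K] [CharZero K]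

lemma blockCoeff_zero (h : Fin 4 → K) (ht c : K) : blockCoeff h ht c 0 = 1 := by
  have hw : word (default : Nat.Partition 0) = [] := by
    rw [List.eq_nil_iff_forall_not_mem]
    intro i hi
    rw [word, Multiset.mem_sort] at hi
    have h1 := (default : Nat.Partition 0).parts_pos hi
    have h2 := Multiset.le_sum_of_mem hi
    rw [(default : Nat.Partition 0).parts_sum] at h2
    omega
  have hg : gram ht c 0 = 1 := by
    ext p q
    rw [Subsingleton.elim p default, Subsingleton.elim q default, Matrix.one_apply_eq]
    simp [gram, hw, pairing]
  rw [blockCoeff, Fintype.sum_unique, Fintype.sum_unique, hg, hw]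
  simp [vertex]

lemma constantCoeff_block (h : Fin 4 → K) (ht c : K) : constantCoeff (block h ht c) = 1 := by
  rw [← coeff_zero_eq_constantCoeff_apply, block, coeff_mk, blockCoeff_zero]

variable [Algebra ℚ K]

/-- The recursion contained in `F * (z d/dz) log F = (z d/dz) F`; it lets the logarithm be
specialized by induction on `n`. -/
lemma natCast_mul_coeff_logBlock (h : Fin 4 → K) (ht c : K) (n : ℕ) :
    (n : K) * coeff n (logBlock h ht c) = n * blockCoeff h ht c n -
      ∑ i : Fin n, blockCoeff h ht c (n - i) * (i * coeff i (logBlock h ht c)) := by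
  have h0 := constantCoeff_block h ht c
  have h1 := congrArg (coeff n) (mul_eulerD_logOf (K := K) h0)
  rw [mul_comm, coeff_mul, Finset.Nat.sum_antidiagonal_eq_sum_range_succ_mk, Finset.sum_range_succ,
    coeff_eulerD, coeff_eulerD, Nat.sub_self, coeff_zero_eq_constantCoeff_apply, h0, mul_one,
    nsmul_eq_mul, nsmul_eq_mul, block, coeff_mk] at h1
  rw [eq_sub_iff_add_eq', ← h1, ← Fin.sum_univ_eq_sum_range (fun i => coeff i (eulerD K
    (logOf (mk (blockCoeff h ht c)))) * coeff (n - i) (mk (blockCoeff h ht c)))]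
  congr 1
  refine Finset.sum_congr rfl fun i _ => ?_
  rw [coeff_eulerD, coeff_mk, nsmul_eq_mul, mul_comm]
  rfl

end Log

section

variable {K L : Type*} [Field K] [Field L] [CharZero K] [CharZero L] [Algebra ℚ K] [Algebra ℚ L]
  {W : Residue K L} {ht c : K} {ht' c' : L}

/-- The coefficients of the logarithmic block specialize, as long as the Gram matrices remain
invertible. -/
theorem spec_coeff_logBlock {h : Fin 4 → K} {h' : Fin 4 → L} (hh : ∀ i, W.Spec (h i) (h' i))
    (hht : W.Spec ht ht') (hc : W.Spec c c') (n : ℕ)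
    (hdet : ∀ i ≤ n, (gram ht' c' i).det ≠ 0) :
    W.Spec (coeff n (logBlock h ht c)) (coeff n (logBlock h' ht' c')) := by
  induction n using Nat.strong_induction_on with
  | _ n ih =>
    rcases eq_or_ne n 0 with rfl | hn
    · rw [coeff_zero_eq_constantCoeff_apply, coeff_zero_eq_constantCoeff_apply, logBlock, logBlock,
        constantCoeff_logOf (constantCoeff_block h ht c),
        constantCoeff_logOf (constantCoeff_block h' ht' c')]
      exact Spec.zero
    · have hn' : (n : L) ≠ 0 := Nat.cast_ne_zero.2 hn
      have key : W.Spec ((n : K) * coeff n (logBlock h ht c))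
          ((n : L) * coeff n (logBlock h' ht' c')) := by
        rw [natCast_mul_coeff_logBlock, natCast_mul_coeff_logBlock]
        exact ((Spec.natCast n).mul (spec_blockCoeff hh hht hc n (hdet n le_rfl))).sub
          (Spec.sum fun i _ => (spec_blockCoeff hh hht hc _ (hdet _ (Nat.sub_le _ _))).mul
            ((Spec.natCast i).mul (ih i i.2 fun k hk => hdet k (hk.trans i.2.le))))
      have := key.div (Spec.natCast n) hn'
      rwa [mul_div_cancel_left₀ _ hn', mul_div_cancel_left₀ _ (Nat.cast_ne_zero.2 hn)] at this

variable {k : Type*} [Field k] [CharZero k] {V : Residue K k} (s : Scaling V)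

/-- A Gram matrix remains invertible if the inverse of the normalized Gram determinant
specializes. -/
lemma Scaling.det_gram_spec_ne (hht : W.Spec s.ht ht') (hc : W.Spec s.c c')
    (hε : s.ε ∈ W.ring) (hρ : s.ρ ∈ W.ring) (n : ℕ) (hn : (s.normGram n).det⁻¹ ∈ W.ring) :
    (gram ht' c' n).det ≠ 0 := by
  have h1 : W.Spec (gram s.ht s.c n).det (gram ht' c' n).det :=
    Spec.det fun p q => spec_pairing hht hc (word p) (word q)
  set d := (Matrix.diagonal fun p : n.Partition =>
    s.ε ^ (word p).length * ((word p).map s.wt).prod).det with hd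
  have h2 : d ∈ W.ring := by
    rw [hd, Matrix.det_diagonal]
    refine Subring.prod_mem _ fun p _ => W.ring.mul_mem (pow_mem hε _)
      (Subring.list_prod_mem _ fun x hx => ?_)
    obtain ⟨l, _, rfl⟩ := List.mem_map.1 hx
    rw [Scaling.wt]
    split_ifs
    exacts [W.ring.one_mem, hρ]
  have h3 := h1.mul ((spec_of_mem h2).mul (spec_of_mem hn))
  -- All three factors are regular and their product is `1`; hence the residue of the Gram
  -- determinant cannot vanish.
  have h4 : (gram s.ht s.c n).det * (d * (s.normGram n).det⁻¹) = 1 := by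
    rw [← mul_assoc, mul_comm _ d, hd, ← Matrix.det_mul, ← s.normGram_eq,
      mul_inv_cancel₀ (s.det_normGram_ne n)]
  rw [h4] at h3
  intro h5
  rw [h5, zero_mul] at h3
  exact one_ne_zero (Spec.one.unique h3)

end

end ClassicalBlock

end

/-! ### Universal fractions in two variables -/

section

open PowerSeries

namespace ClassicalBlock

open Residue

section Generic

open Polynomial

/-- Evaluation of a polynomial in two variables. -/
noncomputable def evalTwo {L : Type*} [CommRing L] [Algebra ℂ L] (x y : L) : ℂ[X][X] →+* L :=
  Polynomial.eval₂RingHom (Polynomial.aeval x : ℂ[X] →ₐ[ℂ] L).toRingHom y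

section

variable {L : Type*} [CommRing L] [Algebra ℂ L] (x y : L)

lemma evalTwo_C (p : ℂ[X]) : evalTwo x y (C p) = aeval x p := by simp [evalTwo]

lemma evalTwo_X : evalTwo x y X = y := by simp [evalTwo]

lemma evalTwo_zero_zero (p : ℂ[X][X]) : evalTwo (0 : ℂ) 0 p = (p.coeff 0).coeff 0 := by
  induction p using Polynomial.induction_on' with
  | add p q hp hq => simp [hp, hq]
  | monomial n a =>
    rcases eq_or_ne n 0 with rfl | h
    · simp [evalTwo, Polynomial.coeff_zero_eq_eval_zero]
    · simp [evalTwo, h, Polynomial.coeff_monomial]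

end

/-- The field of rational functions in two variables. -/
abbrev Rational : Type := FractionRing ℂ[X][X]

lemma algebraMap_rational_injective : Function.Injective (algebraMap ℂ[X][X] Rational) :=
  IsFractionRing.injective _ _

instance : CharZero Rational := charZero_of_injective_algebraMap algebraMap_rational_injective

/-- Rational functions which are defined at a point. -/
noncomputable def evalResidue {L : Type*} [Field L] [Algebra ℂ L] (x y : L) :
    Residue Rational L :=
  Residue.ofHom (algebraMap ℂ[X][X] Rational) algebraMap_rational_injective (evalTwo x y)

lemma spec_evalResidue {L : Type*} [Field L] [Algebra ℂ L] (x y : L) (p : ℂ[X][X]) :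
    (evalResidue x y).Spec (algebraMap _ _ p) (evalTwo x y p) := spec_map p

lemma exists_fraction {L : Type*} [Field L] [Algebra ℂ L] {x y : L} {z : Rational}
    (hz : z ∈ (evalResidue x y).ring) : ∃ N D : ℂ[X][X], evalTwo x y D ≠ 0 ∧
      z * algebraMap _ _ D = algebraMap _ _ N := hz

lemma spec_of_fraction {L : Type*} [Field L] [Algebra ℂ L] {x y : L} {z : Rational}
    {N D : ℂ[X][X]} (hD : evalTwo x y D ≠ 0) (h : z * algebraMap _ _ D = algebraMap _ _ N) :
    (evalResidue x y).Spec z (evalTwo x y N / evalTwo x y D) :=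
  ⟨⟨N, D, hD, h⟩, fractionVal_eq algebraMap_rational_injective _ hD h⟩

/-- The coefficients of the logarithmic block are given by one rational function, whose
denominator does not vanish at the origin, at all points. -/
theorem exists_universal_fraction (s : Scaling (evalResidue (0 : ℂ) 0)) {h : Fin 4 → Rational}
    (hh : ∀ i, s.ε * h i ∈ (evalResidue (0 : ℂ) 0).ring) (n : ℕ) :
    ∃ N D : ℂ[X][X], evalTwo (0 : ℂ) 0 D ≠ 0 ∧
      ∀ {L : Type} [Field L] [CharZero L] [Algebra ℚ L] [Algebra ℂ L] {x y : L} {ε ht c : L}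
        {h' : Fin 4 → L}, (evalResidue x y).Spec s.ε ε → s.ρ ∈ (evalResidue x y).ring →
        (evalResidue x y).Spec s.ht ht → (evalResidue x y).Spec s.c c →
        (∀ i, (evalResidue x y).Spec (h i) (h' i)) → evalTwo x y D ≠ 0 →
        evalTwo x y D * (ε * PowerSeries.coeff n (logBlock h' ht c)) = evalTwo x y N := by
  have h1 : ∀ i, (s.normGram i).det⁻¹ ∈ (evalResidue (0 : ℂ) 0).ring := fun i => by
    rw [s.det_normGram]
    exact (evalResidue (0 : ℂ) 0).inv_mem _ (s.res_det_ringGram i)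
  choose N' D' hD' e' using fun i => exists_fraction (h1 i)
  obtain ⟨N, D, hD, e⟩ := exists_fraction (s.eps_mul_logBlock_mem h hh n)
  have hP : evalTwo (0 : ℂ) 0 (∏ i ∈ Finset.range (n + 1), D' i) ≠ 0 := by
    rw [map_prod, Finset.prod_ne_zero_iff]
    exact fun i _ => hD' i
  -- The denominators of all inverse Gram determinants up to level `n` are included in the new
  -- denominator, so that its nonvanishing at a point also makes the Gram matrices there invertible.
  refine ⟨N * ∏ i ∈ Finset.range (n + 1), D' i, D * ∏ i ∈ Finset.range (n + 1), D' i,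
    by rw [map_mul]; exact mul_ne_zero hD hP, ?_⟩
  intro L _ _ _ _ x y ε ht c h' hε hρ hht hc hh' hne
  rw [map_mul, map_prod] at hne
  have hD1 := left_ne_zero_of_mul hne
  have hD2 := Finset.prod_ne_zero_iff.1 (right_ne_zero_of_mul hne)
  have h2 := spec_coeff_logBlock hh' hht hc n fun i hi =>
    s.det_gram_spec_ne hht hc hε.1 hρ i
      (spec_of_fraction (hD2 i (Finset.mem_range.2 (Nat.lt_succ_of_le hi))) (e' i)).1
  have h3 := (hε.mul h2).unique (spec_of_fraction hD1 e)
  rw [h3, map_mul, map_mul]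
  field_simp

/-- A constant as a rational function. -/
noncomputable def const (a : ℂ) : Rational := algebraMap ℂ[X][X] _ (C (C a))

/-- The first variable. -/
noncomputable def varX : Rational := algebraMap ℂ[X][X] _ (C X)

/-- The second variable. -/
noncomputable def varY : Rational := algebraMap ℂ[X][X] _ X

section

variable {L : Type*} [Field L] [Algebra ℂ L] (x y : L)

lemma spec_const (a : ℂ) : (evalResidue x y).Spec (const a) (algebraMap ℂ L a) := by
  have := spec_evalResidue x y (C (C a))
  rwa [evalTwo_C, aeval_C] at this

lemma spec_varX : (evalResidue x y).Spec varX x := by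
  have := spec_evalResidue x y (C X)
  rwa [evalTwo_C, aeval_X] at this

lemma spec_varY : (evalResidue x y).Spec varY y := by
  have := spec_evalResidue x y X
  rwa [evalTwo_X] at this

end

lemma varX_ne_zero : varX ≠ 0 :=
  (map_ne_zero_iff _ algebraMap_rational_injective).2 (C_ne_zero.2 X_ne_zero)

lemma varY_ne_zero : varY ≠ 0 :=
  (map_ne_zero_iff _ algebraMap_rational_injective).2 X_ne_zero

lemma cube_sub_ne_zero {l : ℕ} (hl : 2 ≤ l) : ((l : ℂ) ^ 3 - l) ≠ 0 := by
  have h1 : l < l ^ 3 := lt_self_pow₀ (by omega) (by norm_num)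
  rw [sub_ne_zero]
  exact_mod_cast h1.ne'

/-- Dimensions of order `1 / y`, and a central charge of order `1 / (x * y)`. -/
noncomputable def smallScaling {d : ℂ} (hd : d ≠ 0) : Scaling (evalResidue (0 : ℂ) 0) where
  ε := varY
  -- For a letter `l ≥ 2` the norm is of order `c`, that is `1 / (x * y)`, and needs the extra
  -- factor `x`; its residue is `(l ^ 3 - l) / 12`. For `l = 1` the central term vanishes and the
  -- residue is `2 * d`.
  ρ := varX
  ht := const d / varY
  c := 1 / (varX * varY)
  ε_mem := (spec_varY _ _).1
  ρ_mem := (spec_varX _ _).1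
  ε_ne := varY_ne_zero
  ρ_ne := varX_ne_zero
  res_ε := (spec_varY _ _).2
  ht_mem := by
    rw [mul_div_cancel₀ _ varY_ne_zero]
    exact (spec_const _ _ d).1
  c_mem := by
    have h1 := varX_ne_zero
    have h2 := varY_ne_zero
    rw [show varX * (varY * (1 / (varX * varY))) = 1 by field_simp]
    exact Subring.one_mem _
  unit l hl := by
    have h1 := varX_ne_zero
    have h2 := varY_ne_zero
    suffices h : ∃ b : ℂ, b ≠ 0 ∧ (evalResidue (0 : ℂ) 0).Spec
        (varY * ((if l ≤ 1 then 1 else varX) * (2 * l * (const d / varY) +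
          1 / (varX * varY) / 12 * ((l : Rational) ^ 3 - l)))) b by
      obtain ⟨b, hb, h, e⟩ := h
      exact ⟨h, e.trans_ne hb⟩
    split_ifs with hl1
    · obtain rfl : l = 1 := by omega
      refine ⟨(2 : ℕ) * d, mul_ne_zero (by norm_num) hd, ?_⟩
      have := (Spec.natCast 2).mul (spec_const (0 : ℂ) 0 d)
      rw [Algebra.algebraMap_self_apply] at this
      convert this using 1
      push_cast
      field_simp
      ring
    · refine ⟨((l : ℂ) ^ 3 - l) / (12 : ℕ),
        div_ne_zero (cube_sub_ne_zero (by omega)) (by norm_num), ?_⟩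
      have := (((Spec.natCast 2).mul (Spec.natCast l)).mul (spec_const (0 : ℂ) 0 d)).mul
        (spec_varX (0 : ℂ) 0) |>.add ((((Spec.natCast l).pow 3).sub (Spec.natCast l)).div
          (Spec.natCast 12) (by norm_num))
      rw [mul_zero, zero_add] at this
      convert this using 1
      push_cast
      field_simp

/-- Dimensions of order `1 / y`, and a central charge of order `x / y`. -/
noncomputable def largeScaling {d : ℂ} (hd : d ≠ 0) : Scaling (evalResidue (0 : ℂ) 0) where
  ε := varY
  ρ := 1
  ht := const d / varY
  c := varX / varY
  ε_mem := (spec_varY _ _).1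
  ρ_mem := Subring.one_mem _
  ε_ne := varY_ne_zero
  ρ_ne := one_ne_zero
  res_ε := (spec_varY _ _).2
  ht_mem := by
    rw [mul_div_cancel₀ _ varY_ne_zero]
    exact (spec_const _ _ d).1
  c_mem := by
    rw [mul_div_cancel₀ _ varY_ne_zero, one_mul]
    exact (spec_varX _ _).1
  -- Here `c` is small compared to the dimensions: the central term has residue `0` and `2 * l * d`
  -- remains for every `l`.
  unit l hl := by
    have h2 := varY_ne_zero
    suffices h : (evalResidue (0 : ℂ) 0).Spec
        (varY * ((if l ≤ 1 then 1 else 1) * (2 * l * (const d / varY) +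
          varX / varY / 12 * ((l : Rational) ^ 3 - l)))) ((2 : ℕ) * l * d) by
      obtain ⟨h, e⟩ := h
      exact ⟨h, e.trans_ne (mul_ne_zero (mul_ne_zero (by norm_num)
        (Nat.cast_ne_zero.2 (by omega))) hd)⟩
    have := (((Spec.natCast 2).mul (Spec.natCast l)).mul (spec_const (0 : ℂ) 0 d)).add
      ((spec_varX (0 : ℂ) 0).mul ((((Spec.natCast l).pow 3).sub (Spec.natCast l)).div
          (Spec.natCast 12) (by norm_num)))
    rw [zero_mul, add_zero, Algebra.algebraMap_self_apply] at this
    convert this using 1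
    rw [ite_self]
    push_cast
    field_simp

/-- One pair `N, D` serves every field `L`. It is used for two kinds of points in Hahn series: `x` a
constant, which gives the Zamolodchikov block, and `x` a power of `c`, which gives `f^(α)`. -/
theorem exists_small_fraction (δ : Fin 4 → ℂ) {d : ℂ} (hd : d ≠ 0) (n : ℕ) :
    ∃ N D : ℂ[X][X], (D.coeff 0).coeff 0 ≠ 0 ∧
      ∀ {L : Type} [Field L] [CharZero L] [Algebra ℚ L] [Algebra ℂ L] {x y : L},
        x ≠ 0 → y ≠ 0 → evalTwo x y D ≠ 0 → evalTwo x y D * (y * PowerSeries.coeff n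
          (logBlock (fun i => algebraMap ℂ L (δ i) / y) (algebraMap ℂ L d / y) (1 / (x * y)))) =
            evalTwo x y N := by
  obtain ⟨N, D, h, key⟩ := exists_universal_fraction (smallScaling hd)
    (h := fun i => const (δ i) / varY) (fun i => by
      change varY * _ ∈ _
      rw [mul_div_cancel₀ _ varY_ne_zero]
      exact (spec_const _ _ _).1) n
  refine ⟨N, D, by rwa [evalTwo_zero_zero] at h, ?_⟩
  intro L _ _ _ _ x y hx hy hD
  exact key (spec_varY _ _) (spec_varX _ _).1 ((spec_const _ _ _).div (spec_varY _ _) hy)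
    (Spec.one.div ((spec_varX _ _).mul (spec_varY _ _)) (mul_ne_zero hx hy))
    (fun i => (spec_const _ _ _).div (spec_varY _ _) hy) hD

theorem exists_large_fraction (δ : Fin 4 → ℂ) {d : ℂ} (hd : d ≠ 0) (n : ℕ) :
    ∃ N D : ℂ[X][X], (D.coeff 0).coeff 0 ≠ 0 ∧
      ∀ {L : Type} [Field L] [CharZero L] [Algebra ℚ L] [Algebra ℂ L] {x y : L},
        y ≠ 0 → evalTwo x y D ≠ 0 → evalTwo x y D * (y * PowerSeries.coeff n
          (logBlock (fun i => algebraMap ℂ L (δ i) / y) (algebraMap ℂ L d / y) (x / y))) =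
            evalTwo x y N := by
  obtain ⟨N, D, h, key⟩ := exists_universal_fraction (largeScaling hd)
    (h := fun i => const (δ i) / varY) (fun i => by
      change varY * _ ∈ _
      rw [mul_div_cancel₀ _ varY_ne_zero]
      exact (spec_const _ _ _).1) n
  refine ⟨N, D, by rwa [evalTwo_zero_zero] at h, ?_⟩
  intro L _ _ _ _ x y hy hD
  exact key (spec_varY _ _) (Subring.one_mem _) ((spec_const _ _ _).div (spec_varY _ _) hy)
    ((spec_varX _ _).div (spec_varY _ _) hy)
    (fun i => (spec_const _ _ _).div (spec_varY _ _) hy) hD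

end Generic

end ClassicalBlock

end

/-! ### Orders in Hahn series and Taylor coefficients -/

section

namespace ClassicalBlock

section Hahn

open Polynomial
open HahnSeries (single addVal addVal_apply orderTop_single orderTop_single_le
  coeff_eq_zero_of_lt_orderTop single_pow single_mul_single coeff_single_same coeff_single_of_ne)

lemma algebraMap_hahnSeries (a : ℂ) : algebraMap ℂ (HahnSeries ℚ ℂ) a = single 0 a := by
  simp [HahnSeries.algebraMap_apply']

instance : CharZero (HahnSeries ℚ ℂ) :=
  charZero_of_injective_algebraMap (algebraMap ℂ (HahnSeries ℚ ℂ)).injective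

variable {x y : HahnSeries ℚ ℂ}

local notation "v" => addVal ℚ ℂ

lemma zero_le_addVal_algebraMap (a : ℂ) : 0 ≤ v (algebraMap ℂ (HahnSeries ℚ ℂ) a) := by
  rw [algebraMap_hahnSeries, addVal_apply]
  exact orderTop_single_le

lemma addVal_algebraMap {a : ℂ} (ha : a ≠ 0) : v (algebraMap ℂ (HahnSeries ℚ ℂ) a) = 0 := by
  rw [algebraMap_hahnSeries, addVal_apply, orderTop_single ha]
  rfl

lemma zero_le_addVal_aeval (hx : 0 ≤ v x) (p : ℂ[X]) : 0 ≤ v (aeval x p) := by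
  induction p using Polynomial.induction_on' with
  | add p q hp hq => rw [map_add]; exact (v).map_le_add hp hq
  | monomial n a =>
    rw [aeval_monomial, (v).map_mul, (v).map_pow]
    exact add_nonneg (zero_le_addVal_algebraMap a) (nsmul_nonneg hx n)

lemma zero_le_addVal_evalTwo (hx : 0 ≤ v x) (hy : 0 ≤ v y) (p : ℂ[X][X]) :
    0 ≤ v (evalTwo x y p) := by
  induction p using Polynomial.induction_on' with
  | add p q hp hq => rw [map_add]; exact (v).map_le_add hp hq
  | monomial n a =>
    rw [← C_mul_X_pow_eq_monomial, map_mul, map_pow, evalTwo_C, evalTwo_X, (v).map_mul,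
      (v).map_pow]
    exact add_nonneg (zero_le_addVal_aeval hx a) (nsmul_nonneg hy n)

lemma exists_evalTwo_eq (p : ℂ[X][X]) : ∃ q : ℂ[X][X],
    evalTwo x y p = y * evalTwo x y q + aeval x (p.coeff 0) :=
  ⟨p.divX, by
    conv_lhs => rw [← X_mul_divX_add p]
    rw [map_add, map_mul, evalTwo_X, evalTwo_C]⟩

lemma exists_aeval_eq (p : ℂ[X]) : ∃ q : ℂ[X],
    aeval x p = x * aeval x q + algebraMap ℂ _ (p.coeff 0) :=
  ⟨p.divX, by
    conv_lhs => rw [← X_mul_divX_add p]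
    rw [map_add, map_mul, aeval_X, aeval_C]⟩

/-- Up to terms of positive order `D(x, y)` is the nonzero constant `d`, hence a unit of the
valuation ring. -/
lemma addVal_evalTwo {d : ℂ} (hd : d ≠ 0) {D : ℂ[X][X]} (hx : 0 ≤ v x) (hy : 0 < v y)
    (h : 0 < v (aeval x (D.coeff 0) - algebraMap ℂ _ d)) : v (evalTwo x y D) = 0 := by
  obtain ⟨q, hq⟩ := exists_evalTwo_eq (x := x) (y := y) D
  have e : evalTwo x y D = algebraMap ℂ _ d +
      ((aeval x (D.coeff 0) - algebraMap ℂ _ d) + y * evalTwo x y q) := by rw [hq]; ring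
  rw [e, (v).map_add_eq_of_lt_left, addVal_algebraMap hd]
  rw [addVal_algebraMap hd]
  refine (v).map_lt_add h ?_
  rw [(v).map_mul]
  exact add_pos_of_pos_of_nonneg hy (zero_le_addVal_evalTwo hx hy.le q)

lemma evalTwo_ne_zero_of_addVal {D : ℂ[X][X]} (h : v (evalTwo x y D) = 0) :
    evalTwo x y D ≠ 0 := fun h0 => by
  rw [h0, (v).map_zero] at h
  exact WithTop.top_ne_zero h

/-- Two series agree up to order `r` if they do after multiplication by a unit. -/
lemma coeff_eq_of_lt_addVal {D G H : HahnSeries ℚ ℂ} (hD : v D = 0) {r : ℚ}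
    (h : (r : WithTop ℚ) < v (D * (G - H))) : G.coeff r = H.coeff r := by
  rw [(v).map_mul, hD, zero_add, addVal_apply] at h
  have := coeff_eq_zero_of_lt_orderTop h
  rwa [HahnSeries.coeff_sub, sub_eq_zero] at this

/-- The coefficients of a fraction of monomials are Taylor coefficients, below the order of the
second monomial. -/
lemma coeff_fraction {N D : ℂ[X][X]} (hD : (D.coeff 0).coeff 0 ≠ 0) {a : ℕ → ℂ} (i : ℕ)
    (ha : X ^ (i + 1) ∣ N.coeff 0 - D.coeff 0 * ∑ k ∈ Finset.range (i + 1), C (a k) * X ^ k)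
    {p q : ℚ} (hp : 0 < p) (hi : i * p < q) (G : HahnSeries ℚ ℂ)
    (hG : evalTwo (single p (1 : ℂ)) (single q 1) D ≠ 0 →
      evalTwo (single p (1 : ℂ)) (single q 1) D * G = evalTwo (single p (1 : ℂ)) (single q 1) N) :
    G.coeff (i * p) = a i := by
  set x : HahnSeries ℚ ℂ := single p 1 with hxdef
  set y : HahnSeries ℚ ℂ := single q 1
  have hq : 0 < q := lt_of_le_of_lt (by positivity) hi
  have hx : v x = p := by rw [addVal_apply]; exact orderTop_single one_ne_zero
  have hy : v y = q := by rw [addVal_apply]; exact orderTop_single one_ne_zero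
  have hx0 : 0 < v x := by rw [hx]; exact_mod_cast hp
  have hy0 : 0 < v y := by rw [hy]; exact_mod_cast hq
  have hvD : v (evalTwo x y D) = 0 := addVal_evalTwo hD hx0.le hy0 (by
    obtain ⟨r, hr⟩ := exists_aeval_eq (x := x) (D.coeff 0)
    rw [hr, add_sub_cancel_right, (v).map_mul]
    exact add_pos_of_pos_of_nonneg hx0 (zero_le_addVal_aeval hx0.le r))
  set A : ℂ[X] := ∑ k ∈ Finset.range (i + 1), C (a k) * X ^ k with hA
  obtain ⟨R, hR⟩ := ha
  obtain ⟨S, hS⟩ := exists_evalTwo_eq (x := x) (y := y) (N - D * C A)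
  have key : G.coeff (i * p) = (aeval x A).coeff (i * p) := by
    refine coeff_eq_of_lt_addVal hvD ?_
    -- The error consists of a multiple of `y`, of order at least `q > i * p`, and the Taylor
    -- remainder at `y = 0`, of order at least `(i + 1) * p`.
    have e : evalTwo x y D * (G - aeval x A) = y * evalTwo x y S + x ^ (i + 1) * aeval x R := by
      rw [mul_sub, hG (evalTwo_ne_zero_of_addVal hvD), ← evalTwo_C x y A, ← map_mul, ← map_sub,
        hS, coeff_sub, coeff_mul_C, hR, map_mul, map_pow, aeval_X]
    rw [e]
    refine (v).map_lt_add ?_ ?_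
    · rw [(v).map_mul, hy]
      calc ((i * p : ℚ) : WithTop ℚ) < q := WithTop.coe_lt_coe.2 hi
        _ ≤ _ := le_add_of_nonneg_right (zero_le_addVal_evalTwo hx0.le hy0.le S)
    · rw [(v).map_mul, (v).map_pow, hx]
      calc ((i * p : ℚ) : WithTop ℚ) < ((i + 1) • p : ℚ) := by
            rw [nsmul_eq_mul, WithTop.coe_lt_coe]; push_cast; linarith
        _ = (i + 1) • (p : WithTop ℚ) := WithTop.coe_nsmul p (i + 1)
        _ ≤ _ := le_add_of_nonneg_right (zero_le_addVal_aeval hx0.le R)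
  have hc : ∀ k : ℕ, (aeval x (C (a k) * X ^ k)).coeff (i * p) = if k = i then a k else 0 := by
    intro k
    rw [map_mul, aeval_C, map_pow, aeval_X, algebraMap_hahnSeries, single_pow, single_mul_single,
      one_pow, mul_one, zero_add, nsmul_eq_mul]
    split_ifs with h
    · rw [h, coeff_single_same]
    · refine coeff_single_of_ne fun e => h ?_
      exact_mod_cast (mul_right_cancel₀ hp.ne' e).symm
  rw [key, hA, map_sum, HahnSeries.coeff_sum, Finset.sum_congr rfl fun k _ => hc k,
    Finset.sum_ite_eq' (Finset.range (i + 1)) i a, if_pos (by simp)]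

/-- The leading coefficient of a fraction whose first argument is a constant. -/
lemma coeff_fraction_const {N D : ℂ[X][X]} {t : ℂ} (hD : (D.coeff 0).eval t ≠ 0) {q : ℚ}
    (hq : 0 < q) {b : ℂ} (hb : b ≠ 0) (G : HahnSeries ℚ ℂ)
    (hG : evalTwo (single 0 t) (single q b) D ≠ 0 → evalTwo (single 0 t) (single q b) D * G =
      evalTwo (single 0 t) (single q b) N) :
    G.coeff 0 = (N.coeff 0).eval t / (D.coeff 0).eval t := by
  set x : HahnSeries ℚ ℂ := single 0 t with hxdef
  set y : HahnSeries ℚ ℂ := single q b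
  have hx : 0 ≤ v x := by rw [addVal_apply]; exact orderTop_single_le
  have hy : v y = q := by rw [addVal_apply]; exact orderTop_single hb
  have hy0 : 0 < v y := by rw [hy]; exact_mod_cast hq
  have hev : ∀ p : ℂ[X], aeval x p = algebraMap ℂ _ (p.eval t) := fun p => by
    rw [hxdef, ← algebraMap_hahnSeries, aeval_algebraMap_apply_eq_algebraMap_eval]
  have hvD : v (evalTwo x y D) = 0 := addVal_evalTwo hD hx hy0 (by
    rw [hev, sub_self, (v).map_zero]; exact WithTop.top_pos)
  set A : ℂ := (N.coeff 0).eval t / (D.coeff 0).eval t with hA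
  obtain ⟨S, hS⟩ := exists_evalTwo_eq (x := x) (y := y) (N - D * C (C A))
  have key : G.coeff 0 = (algebraMap ℂ (HahnSeries ℚ ℂ) A).coeff 0 := by
    refine coeff_eq_of_lt_addVal hvD ?_
    have e : evalTwo x y D * (G - algebraMap ℂ _ A) = y * evalTwo x y S := by
      rw [mul_sub, hG (evalTwo_ne_zero_of_addVal hvD), ← aeval_C x A, ← evalTwo_C x y, ← map_mul,
        ← map_sub, hS, coeff_sub, coeff_mul_C, hev, eval_sub, eval_mul, eval_C, hA,
        mul_div_cancel₀ _ hD, sub_self, map_zero, add_zero]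
    rw [e, (v).map_mul]
    exact add_pos_of_pos_of_nonneg hy0 (zero_le_addVal_evalTwo hx hy0.le S)
  rw [key, algebraMap_hahnSeries, coeff_single_same]

end Hahn

section Taylor

open Polynomial

lemma X_pow_dvd_of_isBigO (m : ℕ) (P : ℂ[X])
    (h : (fun t => P.eval t) =O[𝓝[≠] (0 : ℂ)] fun t => t ^ m) : X ^ m ∣ P := by
  induction m generalizing P with
  | zero => simp
  | succ m ih =>
    have h1 : Tendsto (fun t : ℂ => t ^ (m + 1)) (𝓝[≠] 0) (𝓝 0) :=
      (((continuous_pow (m + 1)).tendsto' _ _ (by simp)).mono_left nhdsWithin_le_nhds)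
    have h2 : Tendsto (fun t => P.eval t) (𝓝[≠] 0) (𝓝 (P.eval 0)) :=
      P.continuous.continuousAt.tendsto.mono_left nhdsWithin_le_nhds
    have h3 : P.eval 0 = 0 := tendsto_nhds_unique h2 (h.trans_tendsto h1)
    obtain ⟨Q, rfl⟩ : X ∣ P := X_dvd_iff.2 (by rwa [coeff_zero_eq_eval_zero])
    rw [pow_succ', mul_dvd_mul_iff_left X_ne_zero]
    refine ih Q ?_
    have h4 : (fun t : ℂ => t⁻¹) =O[𝓝[≠] (0 : ℂ)] fun t => t⁻¹ := Asymptotics.isBigO_refl _ _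
    refine (h4.mul h).congr' ?_ ?_
    · filter_upwards [self_mem_nhdsWithin] with t (ht : t ≠ 0)
      rw [eval_mul, eval_X, inv_mul_cancel_left₀ ht]
    · filter_upwards [self_mem_nhdsWithin] with t (ht : t ≠ 0)
      rw [pow_succ', inv_mul_cancel_left₀ ht]

/-- The Taylor expansion of a fraction of polynomials. -/
lemma exists_taylor {N D : ℂ[X]} (hD : D.coeff 0 ≠ 0) : ∃ a : ℕ → ℂ,
    (∀ᶠ t in 𝓝 (0 : ℂ), D.eval t ≠ 0 ∧ HasSum (fun i => a i * t ^ i) (N.eval t / D.eval t)) ∧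
      ∀ i, X ^ (i + 1) ∣ N - D * ∑ k ∈ Finset.range (i + 1), C (a k) * X ^ k := by
  have hD0 : D.eval 0 ≠ 0 := by rwa [← coeff_zero_eq_eval_zero]
  have hf : AnalyticAt ℂ (fun t => N.eval t / D.eval t) 0 :=
    (AnalyticOnNhd.eval_polynomial N 0 trivial).div (AnalyticOnNhd.eval_polynomial D 0 trivial) hD0
  obtain ⟨p, hp⟩ := hf
  have hDe : ∀ᶠ t in 𝓝 (0 : ℂ), D.eval t ≠ 0 := D.continuous.continuousAt.eventually_ne hD0
  refine ⟨p.coeff, ?_, fun i => X_pow_dvd_of_isBigO _ _ ?_⟩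
  · filter_upwards [hDe, hasFPowerSeriesAt_iff.1 hp] with t h1 h2
    refine ⟨h1, ?_⟩
    rw [zero_add] at h2
    simpa only [smul_eq_mul, mul_comm] using h2
  -- The analytic remainder `O(t ^ (i + 1))`, multiplied by the bounded `D`, is a polynomial; the
  -- bound therefore becomes divisibility by `X ^ (i + 1)`.
  · have h1 : (fun t => N.eval (0 + t) / D.eval (0 + t) - p.partialSum (i + 1) t) =O[𝓝 0]
        fun t : ℂ => t ^ (i + 1) := Asymptotics.IsBigO.of_norm_right (by
      simpa only [norm_pow] using hp.isBigO_sub_partialSum_pow (i + 1))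
    have h2 : (fun t => D.eval t) =O[𝓝 (0 : ℂ)] fun _ => (1 : ℂ) :=
      D.continuous.continuousAt.tendsto.isBigO_one ℂ
    refine ((h2.mul h1).mono nhdsWithin_le_nhds).congr' ?_ ?_
    · filter_upwards [hDe.filter_mono nhdsWithin_le_nhds] with t ht
      rw [zero_add, mul_sub, mul_div_cancel₀ _ ht, eval_sub, eval_mul, eval_finsetSum]
      congr 2
      rw [FormalMultilinearSeries.partialSum]
      refine Finset.sum_congr rfl fun k _ => ?_
      rw [FormalMultilinearSeries.apply_eq_pow_smul_coeff, smul_eq_mul, eval_mul, eval_C, eval_pow,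
        eval_X, mul_comm]
    · exact Eventually.of_forall fun t => one_mul _

end Taylor

end ClassicalBlock

end

/-! ### Coefficients along rays and uniqueness of expansions -/

section

namespace ClassicalBlock

lemma hasSum_of_forall_eq {ι : Type*} {f g : ι → ℂ} {a : ℂ} (hg : HasSum g a)
    (h : ∀ i, f i = g i) : HasSum f a := by
  rwa [funext h]

section Coefficients

open HahnSeries (single)

lemma algebraMap_div_single (a b : ℂ) (q : ℚ) :
    algebraMap ℂ (HahnSeries ℚ ℂ) a / single q b = single (-q) (a / b) := by
  rw [algebraMap_hahnSeries, HahnSeries.single_div_single, zero_sub]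

lemma coeff_single_mul_sub (p q : ℚ) (b : ℂ) (G : HahnSeries ℚ ℂ) :
    (single q b * G).coeff p = b * G.coeff (p - q) := HahnSeries.coeff_single_mul

/-- The logarithm depends on the choice of a `ℚ`-algebra structure on Hahn series; any two coincide.
-/
lemma heavyLogBlock_eq [Algebra ℚ (HahnSeries ℚ ℂ)] (α : ℚ) (δ : Fin 4 → ℂ) (d : ℂ) :
    heavyLogBlock α δ d = logBlock (fun i => single (-α) (δ i)) (single (-α) d)
      (single (-1 : ℚ) (1 : ℂ)) := by
  unfold heavyLogBlock
  congr 1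
  exact Subsingleton.elim _ _

/-- The expansion around zero dimensions, along a ray. -/
theorem exists_small_coeff (δ : Fin 4 → ℂ) {d : ℂ} (hd : d ≠ 0) (n : ℕ) : ∃ a : ℕ → ℂ,
    (∀ᶠ t in 𝓝[≠] (0 : ℂ), HasSum (fun i => a i * t ^ (i + 1))
      (PowerSeries.coeff n (zamolodchikovBlock (t • δ) (t * d)))) ∧
    ∀ m : ℕ, 1 ≤ m → ∀ α : ℚ, SmallRange m α →
      PowerSeries.coeff n (classicalCoeff α (m * α - m + 1) δ d) = a (m - 1) := by
  obtain ⟨N, D, hD, key⟩ := exists_small_fraction δ hd n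
  obtain ⟨a, ha, ha'⟩ := exists_taylor (N := N.coeff 0) hD
  refine ⟨a, ?_, ?_⟩
  · filter_upwards [ha.filter_mono nhdsWithin_le_nhds, self_mem_nhdsWithin] with t ht
      (ht0 : t ≠ 0)
    -- The point `x = t`, `y = c ^ (-1) / t`: dimensions `t * δ * c` and central charge `1 / (x * y)
    -- = c`.
    have h1 := coeff_fraction_const (t := t) (N := N) ht.1 (one_pos : (0 : ℚ) < 1)
      (inv_ne_zero ht0) _
      (key (HahnSeries.single_ne_zero ht0) (HahnSeries.single_ne_zero (inv_ne_zero ht0)))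
    have e1 : (1 : HahnSeries ℚ ℂ) / (single 0 t * single 1 t⁻¹) = single (-1) 1 := by
      rw [HahnSeries.single_mul_single, zero_add, mul_inv_cancel₀ ht0, one_div,
        HahnSeries.inv_single, inv_one]
    simp only [algebraMap_div_single, e1, coeff_single_mul_sub, zero_sub, div_inv_eq_mul] at h1
    have h2 : PowerSeries.coeff n (zamolodchikovBlock (t • δ) (t * d)) =
        t * ((N.coeff 0).eval t / (D.coeff 0).eval t) := by
      rw [← h1, mul_inv_cancel_left₀ ht0]
      simp only [zamolodchikovBlock, classicalCoeff, PowerSeries.coeff_mk, heavyLogBlock_eq,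
        Pi.smul_apply, smul_eq_mul, mul_comm]
    rw [h2]
    exact hasSum_of_forall_eq (ht.2.mul_left t) fun i => by rw [pow_succ]; ring
  · intro m hm α ⟨h1, h2⟩
    have hm0 : (0 : ℚ) < m := by exact_mod_cast hm
    have hm1 : ((m - 1 : ℕ) : ℚ) = m - 1 := by push_cast [hm]; ring
    rw [div_lt_iff₀ hm0] at h1
    -- The point `x = c ^ (α - 1)`, `y = c ^ (-α)`. The side condition `(m - 1) * (1 - α) < α` is
    -- the lower bound `(m - 1) / m < α`.
    have h3 := coeff_fraction (N := N) hD (m - 1) (ha' (m - 1)) (p := 1 - α) (q := α)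
      (by linarith) (by rw [hm1]; nlinarith) _
      (key (HahnSeries.single_ne_zero one_ne_zero) (HahnSeries.single_ne_zero one_ne_zero))
    have e1 : (1 : HahnSeries ℚ ℂ) / (single (1 - α) 1 * single α 1) = single (-1) 1 := by
      rw [HahnSeries.single_mul_single, sub_add_cancel, one_div, HahnSeries.inv_single, mul_one,
        inv_one]
    simp only [algebraMap_div_single, e1, coeff_single_mul_sub, one_mul, div_one] at h3
    rw [← h3, hm1, classicalCoeff, PowerSeries.coeff_mk, heavyLogBlock_eq]
    congr 1
    ring

/-- The expansion around infinite dimensions, along a ray. -/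
theorem exists_large_coeff (δ : Fin 4 → ℂ) {d : ℂ} (hd : d ≠ 0) (n : ℕ) : ∃ a : ℕ → ℂ,
    (∀ᶠ t in Bornology.cobounded ℂ, HasSum (fun i => a i * t ^ (1 - i : ℤ))
      (PowerSeries.coeff n (zamolodchikovBlock (t • δ) (t * d)))) ∧
    ∀ k : ℤ, -1 ≤ k → ∀ α : ℚ, LargeRange k α →
      PowerSeries.coeff n (classicalCoeff α (-k * α + k + 1) δ d) = a (k + 1).toNat := by
  obtain ⟨N, D, hD, key⟩ := exists_large_fraction δ hd n
  obtain ⟨a, ha, ha'⟩ := exists_taylor (N := N.coeff 0) hD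
  refine ⟨a, ?_, ?_⟩
  · filter_upwards [tendsto_inv₀_cobounded.eventually ha,
      Bornology.eventually_ne_cobounded (0 : ℂ)] with t ht ht0
    -- The point `x = 1 / t`, `y = c ^ (-1) / t`, for which `x / y = c`.
    have h1 := coeff_fraction_const (t := t⁻¹) (N := N) ht.1 (one_pos : (0 : ℚ) < 1)
      (inv_ne_zero ht0) _ (key (HahnSeries.single_ne_zero (inv_ne_zero ht0)))
    have e1 : (single 0 t⁻¹ : HahnSeries ℚ ℂ) / single 1 t⁻¹ = single (-1) 1 := by
      rw [HahnSeries.single_div_single, zero_sub, div_self (inv_ne_zero ht0)]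
    simp only [algebraMap_div_single, e1, coeff_single_mul_sub, zero_sub, div_inv_eq_mul] at h1
    have h2 : PowerSeries.coeff n (zamolodchikovBlock (t • δ) (t * d)) =
        t * ((N.coeff 0).eval t⁻¹ / (D.coeff 0).eval t⁻¹) := by
      rw [← h1, mul_inv_cancel_left₀ ht0]
      simp only [zamolodchikovBlock, classicalCoeff, PowerSeries.coeff_mk, heavyLogBlock_eq,
        Pi.smul_apply, smul_eq_mul, mul_comm]
    rw [h2]
    refine hasSum_of_forall_eq (ht.2.mul_left t) fun i => ?_
    rw [zpow_sub₀ ht0, zpow_one, zpow_natCast, inv_pow]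
    ring
  · intro k hk α ⟨h1, h2⟩
    obtain ⟨i, rfl⟩ : ∃ i : ℕ, k = i - 1 := ⟨(k + 1).toNat, by omega⟩
    -- The point `x = c ^ (1 - α)`, `y = c ^ (-α)`. The side condition `i * (α - 1) < α` is
    -- automatic for `i ≤ 1`, that is `k ≤ 0`; otherwise it is the upper bound on `α`.
    have h3 := coeff_fraction (N := N) hD i (ha' i) (p := α - 1) (q := α)
      (by linarith) (by
        rcases le_or_gt i 1 with hi | hi
        · interval_cases i
          · norm_num
            linarith
          · norm_num
        · have h4 := h2 (by omega)
          have hi' : (1 : ℚ) < i := by exact_mod_cast hi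
          push_cast at h4
          rw [lt_div_iff₀ (by linarith)] at h4
          linarith) _ (key (HahnSeries.single_ne_zero one_ne_zero))
    have e1 : (single (α - 1) 1 : HahnSeries ℚ ℂ) / single α 1 = single (-1) 1 := by
      rw [HahnSeries.single_div_single, div_one, sub_sub_cancel_left]
    simp only [algebraMap_div_single, e1, coeff_single_mul_sub, one_mul, div_one] at h3
    rw [show ((i : ℤ) - 1 + 1).toNat = i by omega, ← h3, classicalCoeff, PowerSeries.coeff_mk,
      heavyLogBlock_eq]
    congr 1
    push_cast
    ring

end Coefficients

section Laurent

/-- A Laurent series which vanishes on a circle is zero. -/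
lemma eq_zero_of_hasSum_zpow {e : ℤ → ℂ} {r : ℝ} (hr : 0 < r)
    (h : ∀ t : ℂ, ‖t‖ = r → HasSum (fun m => e m * t ^ m) 0) (k : ℤ) : e k = 0 := by
  have hr0 : (r : ℂ) ≠ 0 := by exact_mod_cast hr.ne'
  -- The terms of the series on the circle times `exp (-i k θ)`. Integrating over a period kills all
  -- of them except `m = k`; absolute convergence allows termwise integration.
  set g : ℤ → C(ℝ, ℂ) := fun m =>
    ⟨fun θ => e m * r ^ m * Complex.exp (((m - k : ℤ) * Complex.I) * θ), by fun_prop⟩ with hg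
  have hnorm : ∀ m θ, ‖g m θ‖ = ‖e m * (r : ℂ) ^ m‖ := fun m θ => by
    change ‖e m * r ^ m * Complex.exp (((m - k : ℤ) * Complex.I) * θ)‖ = _
    rw [norm_mul, show ((m - k : ℤ) * Complex.I) * (θ : ℂ) = (((m - k : ℤ) * θ : ℝ) : ℂ) *
      Complex.I by push_cast; ring, Complex.norm_exp_ofReal_mul_I, mul_one]
  have hsum : Summable fun m => ‖e m * (r : ℂ) ^ m‖ :=
    (h r (by rw [Complex.norm_real, Real.norm_of_nonneg hr.le])).summable.norm
  have h1 := intervalIntegral.hasSum_intervalIntegral_of_summable_norm (a := 0)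
    (b := 2 * Real.pi) (f := g) (hsum.of_nonneg_of_le (fun _ => norm_nonneg _) fun m => by
      rw [ContinuousMap.norm_le _ (norm_nonneg _)]
      exact fun θ => (hnorm m θ).le)
  have h2 : ∀ θ : ℝ, ∑' m, g m θ = 0 := fun θ => by
    have h3 := (h (r * Complex.exp (θ * Complex.I)) (by
      rw [norm_mul, Complex.norm_exp_ofReal_mul_I, mul_one, Complex.norm_real,
        Real.norm_of_nonneg hr.le])).mul_right (Complex.exp (-(k * Complex.I * θ)))
    rw [zero_mul] at h3
    refine (hasSum_of_forall_eq h3 fun m => ?_).tsum_eq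
    change e m * r ^ m * Complex.exp (((m - k : ℤ) * Complex.I) * θ) = _
    rw [mul_zpow, ← Complex.exp_int_mul, ← mul_assoc, mul_assoc _ (Complex.exp _),
      ← Complex.exp_add]
    congr 2
    push_cast
    ring
  simp only [h2, intervalIntegral.integral_zero] at h1
  have h3 : ∀ m ≠ k, ∫ θ in (0 : ℝ)..2 * Real.pi, g m θ = 0 := fun m hm => by
    change ∫ θ in (0 : ℝ)..2 * Real.pi,
      e m * r ^ m * Complex.exp (((m - k : ℤ) * Complex.I) * θ) = 0
    have hmk : ((m - k : ℤ) : ℂ) * Complex.I ≠ 0 :=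
      mul_ne_zero (by exact_mod_cast sub_ne_zero.2 hm) Complex.I_ne_zero
    rw [intervalIntegral.integral_const_mul, integral_exp_mul_complex hmk,
      show ((m - k : ℤ) : ℂ) * Complex.I * ((2 * Real.pi : ℝ) : ℂ) =
        (m - k : ℤ) * (2 * Real.pi * Complex.I) by push_cast; ring,
      Complex.exp_int_mul_two_pi_mul_I]
    simp
  have h4 : ∫ θ in (0 : ℝ)..2 * Real.pi, g k θ = 2 * Real.pi * (e k * r ^ k) := by
    have : ∀ θ : ℝ, g k θ = e k * r ^ k := fun θ => by
      change e k * r ^ k * Complex.exp (((k - k : ℤ) * Complex.I) * θ) = _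
      simp
    simp only [this, intervalIntegral.integral_const]
    simp
  have h5 := h1.unique (hasSum_single k h3)
  rw [h4] at h5
  have hpi : (2 * Real.pi : ℂ) ≠ 0 := by exact_mod_cast Real.two_pi_pos.ne'
  exact (mul_eq_zero.1 ((mul_eq_zero.1 h5.symm).resolve_left hpi)).resolve_right
    (zpow_ne_zero _ hr0)

lemma eq_zero_of_eventually_nhds {e : ℤ → ℂ}
    (h : ∀ᶠ t in 𝓝[≠] (0 : ℂ), HasSum (fun m => e m * t ^ m) 0) (k : ℤ) : e k = 0 := by
  rw [eventually_nhdsWithin_iff, Metric.eventually_nhds_iff] at h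
  obtain ⟨ε, hε, h⟩ := h
  refine eq_zero_of_hasSum_zpow (half_pos hε) (fun t ht => h ?_ ?_) k
  · rw [dist_zero_right, ht]
    linarith
  · rintro rfl
    rw [norm_zero] at ht
    linarith

lemma eq_zero_of_eventually_cobounded {e : ℤ → ℂ}
    (h : ∀ᶠ t in Bornology.cobounded ℂ, HasSum (fun m => e m * t ^ (-m)) 0) (k : ℤ) :
    e k = 0 := by
  obtain ⟨R, -, h⟩ := (hasBasis_cobounded_norm (E := ℂ)).eventually_iff.1 h
  have hR : 0 < max R 1 := lt_max_of_lt_right one_pos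
  refine eq_zero_of_hasSum_zpow (inv_pos.2 hR) (fun t ht => ?_) k
  have h1 := h (x := t⁻¹) (by
    change R ≤ ‖t⁻¹‖
    rw [norm_inv, ht, inv_inv]
    exact le_max_left _ _)
  simpa only [zpow_neg, inv_zpow, inv_inv] using h1

end Laurent

section Expansion

/-- Expansions in homogeneous functions of the degrees `σ m` are determined by the expansions along
rays. -/
lemma expansion_of_rays {l : Filter ℂ} {σ : ℤ → ℤ} (hl0 : ∀ᶠ t in l, t ≠ 0)
    (hl : ∀ s : ℂ, s ≠ 0 → Tendsto (fun t => t * s) l l)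
    (hσ : ∀ e : ℤ → ℂ, (∀ᶠ t in l, HasSum (fun m => e m * t ^ σ m) 0) → ∀ k, e k = 0)
    {f : (Fin 4 → ℂ) → ℂ → PowerSeries ℂ} {A : (Fin 4 → ℂ) → ℂ → ℕ → ℤ → ℂ}
    (hA : ∀ δ d, d ≠ 0 → ∀ n, ∀ᶠ t in l, HasSum (fun m => A δ d n m * t ^ σ m)
      (PowerSeries.coeff n (f (t • δ) (t * d)))) :
    (∀ δ d s, d ≠ 0 → s ≠ 0 → ∀ n m, A (s • δ) (s * d) n m = s ^ σ m * A δ d n m) ∧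
    ∀ P : ℤ → (Fin 4 → ℂ) → ℂ → PowerSeries ℂ, (∀ m, IsHomogeneous (σ m) (P m)) →
      (∀ δ d, d ≠ 0 → ∀ n, ∀ᶠ t in l,
        HasSum (fun m => PowerSeries.coeff n (P m (t • δ) (t * d)))
          (PowerSeries.coeff n (f (t • δ) (t * d)))) →
      ∀ δ d, d ≠ 0 → ∀ n m, PowerSeries.coeff n (P m δ d) = A δ d n m := by
  constructor
  · intro δ d s hd hs n m
    rw [← sub_eq_zero]
    refine hσ (fun m => A (s • δ) (s * d) n m - s ^ σ m * A δ d n m) ?_ m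
    -- The ray through `(s • δ, s * d)` is the ray through `(δ, d)` with parameter `t * s`;
    -- comparing the two expansions gives homogeneity of the coefficients.
    filter_upwards [hA (s • δ) (s * d) (mul_ne_zero hs hd) n, (hl s hs).eventually (hA δ d hd n)]
      with t h1 h2
    rw [mul_smul, mul_assoc] at h2
    have h3 := h1.sub h2
    rw [sub_self] at h3
    exact hasSum_of_forall_eq h3 fun m => by rw [mul_zpow]; ring
  · intro P hP hPs δ d hd n m
    rw [← sub_eq_zero]
    refine hσ (fun m => PowerSeries.coeff n (P m δ d) - A δ d n m) ?_ m
    filter_upwards [hl0, hA δ d hd n, hPs δ d hd n] with t ht h1 h2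
    have h3 := h2.sub h1
    rw [sub_self] at h3
    exact hasSum_of_forall_eq h3 fun m => by
      rw [hP m δ d t hd ht, PowerSeries.coeff_C_mul]; ring

end Expansion

end ClassicalBlock

end

/-! ### Assembling the two expansions -/

namespace ClassicalBlock

section Final

lemma hasSum_ite_toNat {a : ℕ → ℂ} {b : ℤ → ℂ} {c : ℤ} {F : ℂ}
    (h : HasSum (fun i : ℕ => a i * b (i + c)) F) :
    HasSum (fun m : ℤ => (if c ≤ m then a (m - c).toNat else 0) * b m) F := by
  have hinj : Function.Injective fun i : ℕ => (i : ℤ) + c := fun i k h => by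
    simpa using h
  rw [← hinj.hasSum_iff]
  · exact hasSum_of_forall_eq h fun i => by simp
  · intro m hm
    rw [if_neg, zero_mul]
    exact fun hc => hm ⟨(m - c).toNat, by simp; omega⟩

/-- The coefficients of the expansion around zero dimensions. -/
lemma exists_small_rays : ∃ A : (Fin 4 → ℂ) → ℂ → ℕ → ℤ → ℂ,
    (∀ δ d, d ≠ 0 → ∀ n, ∀ᶠ t in 𝓝[≠] (0 : ℂ), HasSum (fun m => A δ d n m * t ^ m)
      (PowerSeries.coeff n (zamolodchikovBlock (t • δ) (t * d)))) ∧
    (∀ δ d, ∀ n, ∀ m ≤ 0, A δ d n m = 0) ∧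
    ∀ δ d, d ≠ 0 → ∀ n, ∀ m : ℕ, 1 ≤ m → ∀ α : ℚ, SmallRange m α →
      PowerSeries.coeff n (classicalCoeff α (m * α - m + 1) δ d) = A δ d n m := by
  classical
  choose a ha ha' using fun (δ : Fin 4 → ℂ) (d : {d : ℂ // d ≠ 0}) => exists_small_coeff δ d.2
  refine ⟨fun δ d n m => if 1 ≤ m then (if h : d ≠ 0 then a δ ⟨d, h⟩ n (m - 1).toNat else 0)
    else 0, fun δ d hd n => ?_, fun δ d n m hm => if_neg (by omega), ?_⟩
  · filter_upwards [ha δ ⟨d, hd⟩ n] with t ht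
    simp only [dif_pos hd]
    exact hasSum_ite_toNat (a := a δ ⟨d, hd⟩ n) (b := fun m => t ^ m) (by exact_mod_cast ht)
  · intro δ d hd n m hm α hα
    beta_reduce
    rw [ha' δ ⟨d, hd⟩ n m hm α hα, if_pos (by exact_mod_cast hm), dif_pos hd]
    congr 1
    omega

/-- The coefficients of the expansion around infinite dimensions. -/
lemma exists_large_rays : ∃ A : (Fin 4 → ℂ) → ℂ → ℕ → ℤ → ℂ,
    (∀ δ d, d ≠ 0 → ∀ n, ∀ᶠ t in Bornology.cobounded ℂ, HasSum (fun k => A δ d n k * t ^ (-k))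
      (PowerSeries.coeff n (zamolodchikovBlock (t • δ) (t * d)))) ∧
    (∀ δ d, ∀ n, ∀ k < -1, A δ d n k = 0) ∧
    ∀ δ d, d ≠ 0 → ∀ n, ∀ k : ℤ, -1 ≤ k → ∀ α : ℚ, LargeRange k α →
      PowerSeries.coeff n (classicalCoeff α (-k * α + k + 1) δ d) = A δ d n k := by
  classical
  choose a ha ha' using fun (δ : Fin 4 → ℂ) (d : {d : ℂ // d ≠ 0}) => exists_large_coeff δ d.2
  refine ⟨fun δ d n k => if -1 ≤ k then (if h : d ≠ 0 then a δ ⟨d, h⟩ n (k - -1).toNat else 0)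
    else 0, fun δ d hd n => ?_, fun δ d n k hk => if_neg (by omega), ?_⟩
  · filter_upwards [ha δ ⟨d, hd⟩ n] with t ht
    simp only [dif_pos hd]
    refine hasSum_ite_toNat (a := a δ ⟨d, hd⟩ n) (b := fun m => t ^ (-m))
      (hasSum_of_forall_eq ht fun i => ?_)
    rw [neg_add, neg_neg, neg_add_eq_sub]
  · intro δ d hd n k hk α hα
    beta_reduce
    rw [ha' δ ⟨d, hd⟩ n k hk α hα, if_pos hk, dif_pos hd, sub_neg_eq_add]

lemma tendsto_mul_right_punctured {s : ℂ} (hs : s ≠ 0) :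
    Tendsto (fun t => t * s) (𝓝[≠] 0) (𝓝[≠] 0) := by
  refine tendsto_nhdsWithin_iff.2 ⟨?_, ?_⟩
  · exact ((continuous_id.mul continuous_const).tendsto' 0 0 (by simp)).mono_left
      nhdsWithin_le_nhds
  · filter_upwards [self_mem_nhdsWithin] with t ht
    exact mul_ne_zero ht hs

/-- The functions with given coefficients. -/
lemma isHomogeneous_mk {A : (Fin 4 → ℂ) → ℂ → ℕ → ℤ → ℂ} {σ : ℤ → ℤ}
    (h : ∀ δ d s, d ≠ 0 → s ≠ 0 → ∀ n m, A (s • δ) (s * d) n m = s ^ σ m * A δ d n m) (m : ℤ) :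
    IsHomogeneous (σ m) fun δ d => PowerSeries.mk fun n => A δ d n m := by
  intro δ d t hd ht
  ext n
  rw [PowerSeries.coeff_C_mul, PowerSeries.coeff_mk, PowerSeries.coeff_mk, h δ d t hd ht]

end Final

end ClassicalBlock

theorem proposition3p1 :
    -- expansion around zero classical dimensions: existence and identification of the pieces
    (∃ P, ClassicalBlock.IsSmallExpansion P ClassicalBlock.zamolodchikovBlock) ∧
    (∀ P, ClassicalBlock.IsSmallExpansion P ClassicalBlock.zamolodchikovBlock →
      (∀ m : ℤ, m ≤ 0 → ∀ (δ : Fin 4 → ℂ) (δt : ℂ), δt ≠ 0 → P m δ δt = 0) ∧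
      (∀ m : ℕ, 1 ≤ m → ∀ α : ℚ, ClassicalBlock.SmallRange m α →
        ∀ (δ : Fin 4 → ℂ) (δt : ℂ), δt ≠ 0 →
          P m δ δt = ClassicalBlock.classicalCoeff α (m * α - m + 1) δ δt)) ∧
    -- the resulting representation of the Zamolodchikov block
    (∀ α : ℕ+ → ℚ, (∀ m : ℕ+, ClassicalBlock.SmallRange m (α m)) →
      ClassicalBlock.SumsNearZero
        (fun m : ℕ+ => ClassicalBlock.classicalCoeff (α m) ((m : ℕ) * α m - (m : ℕ) + 1))
        ClassicalBlock.zamolodchikovBlock) ∧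
    -- expansion around infinite classical dimensions
    (∃ S, ClassicalBlock.IsLargeExpansion S ClassicalBlock.zamolodchikovBlock) ∧
    (∀ S, ClassicalBlock.IsLargeExpansion S ClassicalBlock.zamolodchikovBlock →
      (∀ k : ℤ, k < -1 → ∀ (δ : Fin 4 → ℂ) (δt : ℂ), δt ≠ 0 → S k δ δt = 0) ∧
      (∀ k : ℤ, -1 ≤ k → ∀ α : ℚ, ClassicalBlock.LargeRange k α →
        ∀ (δ : Fin 4 → ℂ) (δt : ℂ), δt ≠ 0 →
          S k δ δt = ClassicalBlock.classicalCoeff α (-k * α + k + 1) δ δt)) ∧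
    (∀ α : ℤ → ℚ, (∀ k : ℤ, -1 ≤ k → ClassicalBlock.LargeRange k (α k)) →
      ClassicalBlock.SumsNearInfinity
        (fun k : {k : ℤ // -1 ≤ k} =>
          ClassicalBlock.classicalCoeff (α k) (-(k : ℤ) * α k + (k : ℤ) + 1))
        ClassicalBlock.zamolodchikovBlock) := by

  classical
  obtain ⟨A, hA, hA0, hAc⟩ := ClassicalBlock.exists_small_rays
  obtain ⟨B, hB, hB0, hBc⟩ := ClassicalBlock.exists_large_rays
  obtain ⟨hAh, hAu⟩ := ClassicalBlock.expansion_of_rays (σ := fun m => m)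
    (l := nhdsWithin 0 {0}ᶜ) self_mem_nhdsWithin
    (fun s hs => ClassicalBlock.tendsto_mul_right_punctured hs)
    (fun e he => ClassicalBlock.eq_zero_of_eventually_nhds he) hA
  obtain ⟨hBh, hBu⟩ := ClassicalBlock.expansion_of_rays (σ := fun m => -m)
    (Bornology.eventually_ne_cobounded 0)
    (fun s hs => Filter.tendsto_mul_right_cobounded hs)
    (fun e he => ClassicalBlock.eq_zero_of_eventually_cobounded he) hB
  refine ⟨⟨_, ClassicalBlock.isHomogeneous_mk hAh, fun δ d hd n => ?_⟩, fun P hP => ?_,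
    fun α hα δ d hd n => ?_, ⟨_, ClassicalBlock.isHomogeneous_mk hBh, fun δ d hd n => ?_⟩,
    fun S hS => ?_, fun α hα δ d hd n => ?_⟩
  · filter_upwards [hA δ d hd n, self_mem_nhdsWithin] with t ht ht0
    refine ClassicalBlock.hasSum_of_forall_eq ht fun m => ?_
    rw [PowerSeries.coeff_mk, hAh δ d t hd ht0, mul_comm]
  · have key := hAu P hP.homogeneous hP.sums
    refine ⟨fun m hm δ d hd => ?_, fun m hm α hα δ d hd => ?_⟩
    · ext n
      rw [key δ d hd, hA0 δ d n m hm, map_zero]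
    · ext n
      rw [key δ d hd, hAc δ d hd n m hm α hα]
  · filter_upwards [hA δ d hd n, self_mem_nhdsWithin] with t ht ht0
    have hinj : Function.Injective fun m : ℕ+ => ((m : ℕ) : ℤ) := fun i k h => by
      simpa using h
    rw [← hinj.hasSum_iff] at ht
    · refine ClassicalBlock.hasSum_of_forall_eq ht fun m => ?_
      -- The classical coefficient is identified at the scaled point itself, then homogeneity of `A`
      -- brings out the power of `t`.
      rw [hAc _ _ (mul_ne_zero ht0 hd) n m m.2 _ (hα m), hAh δ d t hd ht0, mul_comm]
      rfl
    · intro m hm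
      rw [hA0 δ d n m, zero_mul]
      by_contra! h
      exact hm ⟨⟨m.toNat, by omega⟩, by simp; omega⟩
  · filter_upwards [hB δ d hd n, Bornology.eventually_ne_cobounded 0] with t ht ht0
    refine ClassicalBlock.hasSum_of_forall_eq ht fun m => ?_
    rw [PowerSeries.coeff_mk, hBh δ d t hd ht0, mul_comm]
  · have key := hBu S hS.homogeneous hS.sums
    refine ⟨fun m hm δ d hd => ?_, fun m hm α hα δ d hd => ?_⟩
    · ext n
      rw [key δ d hd, hB0 δ d n m hm, map_zero]
    · ext n
      rw [key δ d hd, hBc δ d hd n m hm α hα]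
  · filter_upwards [hB δ d hd n, Bornology.eventually_ne_cobounded 0] with t ht ht0
    rw [← (Subtype.val_injective (p := fun k : ℤ => -1 ≤ k)).hasSum_iff] at ht
    · refine ClassicalBlock.hasSum_of_forall_eq ht fun m => ?_
      rw [hBc _ _ (mul_ne_zero ht0 hd) n m m.2 _ (hα m m.2), hBh δ d t hd ht0, mul_comm]
      rfl
    · intro m hm
      rw [hB0 δ d n m, zero_mul]
      by_contra! h
      exact hm ⟨⟨m, h⟩, rfl⟩
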